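/- Let $L,T\ge 1$ and let $G=(V,A)$ be the $L$-by-$T$ grid: $V=\{v_{l,t} : 1\le l\le L,\ 1\le t\le T\}$, and $A$ consists of the downward arcs $(v_{l,t},v_{l+1,t})$ ($l\le L-1$) and the forward arcs $(v_{l,t},v_{l,t+1})$ ($t\le T-1$). An instance of the uncapacitated minimum-concave-cost grid flow problem (U-MFG) consists of supplies $b\in\mathbb{Z}^V$ with $\sum_{v\in V} b_v=0$ and of cost functions $c_a:\mathbb{R}\to\mathbb{R}$ ($a\in A$) that are concave on $[0,\infty)$; the task is to find a vector $x\in\mathbb{R}^A$ that minimizes $\sum_{a\in A}c_a(x_a)$ subject to $$\sum_{a\in\delta^+(v)}x_a-\sum_{a\in\delta^-(v)}x_a=b_v\quad (v\in V),\qquad x_a\ge 0\quad (a\in A),$$ where $\delta^+(v)$ and $\delta^-(v)$ are the sets of outgoing and incoming arcs of $v$. A source is a vertex $v$ with $b_v>0$. There is no restriction on the location of the sinks (the vertices with $b_v<0$). The model of computation is a real RAM: registers hold real numbers with infinite precision (and natural numbers used as counters and addresses), each arithmetic operation, comparison and memory access takes one step, and the cost functions are given by an oracle which, for an arc $a$ and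 a real number $x$, returns $c_a(x)$ in one step. The input is $L$, $T$ and $b$. Theorem. There are a single real RAM program and a constant $C$ such that, for all $L,T\ge 1$ and every feasible instance of the U-MFG on the $L$-by-$T$ grid in which all sources lie in one row, the program halts after at most $C\cdot L\,T^{8L^2-12L+5}$ steps (all operations and oracle queries counted) and outputs an optimal flow. That is, the U-MFG with all sources in one row can be solved in $O(L\,T^{8L^2-12L+5})$ time. -/

import Mathlib

/-! ## A real random access machine with a cost oracle

The machine has two banks of registers, both indexed by the natural numbers: index registers, which
hold natural numbers (counters and addresses), and real registers, which hold real numbers with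
infinite precision. Addresses are computed, so both direct and indirect addressing are available.
Programs are structured (sequence, branching, loops). Every constant, every memory access, every
arithmetic operation, every comparison, every branch or loop test and every oracle query costs one
step. There is no rounding and no conversion from real numbers to natural numbers. -/

namespace RealRAM

/-- The two kinds of arcs of the grid, used to name an arc in an oracle query. -/
inductive Dir : Type
  | forward
  | downward

/-- The oracle: kind of the arc, row and column of its tail, flow value. -/
abbrev Oracle : Type := Dir → ℕ → ℕ → ℝ → ℝ

/-- The contents of the two register banks. -/
structure State : Type where
  idx : ℕ → ℕ
  real : ℕ → ℝ

/-- Index expressions. -/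
inductive IExp : Type
  | const (n : ℕ)
  | load (addr : IExp)
  | add (e₁ e₂ : IExp)
  | sub (e₁ e₂ : IExp)
  | mul (e₁ e₂ : IExp)

/-- Real expressions. The only constants in a program are integers. -/
inductive RExp : Type
  | const (z : ℤ)
  | load (addr : IExp)
  | add (e₁ e₂ : RExp)
  | sub (e₁ e₂ : RExp)
  | mul (e₁ e₂ : RExp)
  | div (e₁ e₂ : RExp)
  | query (d : Dir) (row col : IExp) (x : RExp)

/-- Tests. -/
inductive BExp : Type
  | leIdx (e₁ e₂ : IExp)
  | leReal (e₁ e₂ : RExp)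
  | not (p : BExp)
  | and (p q : BExp)

/-- Programs. -/
inductive Prog : Type
  | skip
  | setIdx (addr : IExp) (val : IExp)
  | setReal (addr : IExp) (val : RExp)
  | seq (p q : Prog)
  | ite (b : BExp) (p q : Prog)
  | while (b : BExp) (p : Prog)

/-- Value of an index expression (`sub` is truncated subtraction). -/
def IExp.eval (s : State) : IExp → ℕ
  | const n => n
  | load a => s.idx (a.eval s)
  | add e₁ e₂ => e₁.eval s + e₂.eval s
  | sub e₁ e₂ => e₁.eval s - e₂.eval s
  | mul e₁ e₂ => e₁.eval s * e₂.eval s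

/-- Number of steps needed to evaluate an index expression. -/
def IExp.cost : IExp → ℕ
  | const _ => 1
  | load a => 1 + a.cost
  | add e₁ e₂ => 1 + e₁.cost + e₂.cost
  | sub e₁ e₂ => 1 + e₁.cost + e₂.cost
  | mul e₁ e₂ => 1 + e₁.cost + e₂.cost

/-- Value of a real expression. -/
noncomputable def RExp.eval (O : Oracle) (s : State) : RExp → ℝ
  | const z => (z : ℝ)
  | load a => s.real (a.eval s)
  | add e₁ e₂ => e₁.eval O s + e₂.eval O s
  | sub e₁ e₂ => e₁.eval O s - e₂.eval O s
  | mul e₁ e₂ => e₁.eval O s * e₂.eval O s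
  | div e₁ e₂ => e₁.eval O s / e₂.eval O s
  | query d l t x => O d (l.eval s) (t.eval s) (x.eval O s)

/-- Number of steps needed to evaluate a real expression. -/
def RExp.cost : RExp → ℕ
  | const _ => 1
  | load a => 1 + a.cost
  | add e₁ e₂ => 1 + e₁.cost + e₂.cost
  | sub e₁ e₂ => 1 + e₁.cost + e₂.cost
  | mul e₁ e₂ => 1 + e₁.cost + e₂.cost
  | div e₁ e₂ => 1 + e₁.cost + e₂.cost
  | query _ l t x => 1 + l.cost + t.cost + x.cost

/-- Truth of a test. -/
def BExp.eval (O : Oracle) (s : State) : BExp → Prop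
  | leIdx e₁ e₂ => e₁.eval s ≤ e₂.eval s
  | leReal e₁ e₂ => e₁.eval O s ≤ e₂.eval O s
  | not p => ¬ p.eval O s
  | and p q => p.eval O s ∧ q.eval O s

/-- Number of steps needed to evaluate a test. -/
def BExp.cost : BExp → ℕ
  | leIdx e₁ e₂ => 1 + e₁.cost + e₂.cost
  | leReal e₁ e₂ => 1 + e₁.cost + e₂.cost
  | not p => 1 + p.cost
  | and p q => 1 + p.cost + q.cost

/-- `Exec O p s s' n`: with oracle `O`, the program `p` started in the state `s` halts in the
state `s'` after exactly `n` steps. -/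
inductive Exec (O : Oracle) : Prog → State → State → ℕ → Prop
  | skip (s : State) : Exec O .skip s s 1
  | setIdx (a e : IExp) (s : State) :
      Exec O (.setIdx a e) s { s with idx := Function.update s.idx (a.eval s) (e.eval s) }
        (1 + a.cost + e.cost)
  | setReal (a : IExp) (e : RExp) (s : State) :
      Exec O (.setReal a e) s { s with real := Function.update s.real (a.eval s) (e.eval O s) }
        (1 + a.cost + e.cost)
  | seq {p q : Prog} {s s' s'' : State} {m n : ℕ}
      (hp : Exec O p s s' m) (hq : Exec O q s' s'' n) : Exec O (.seq p q) s s'' (m + n)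
  | iteTrue {b : BExp} {p q : Prog} {s s' : State} {n : ℕ}
      (hb : b.eval O s) (hp : Exec O p s s' n) : Exec O (.ite b p q) s s' (1 + b.cost + n)
  | iteFalse {b : BExp} {p q : Prog} {s s' : State} {n : ℕ}
      (hb : ¬ b.eval O s) (hq : Exec O q s s' n) : Exec O (.ite b p q) s s' (1 + b.cost + n)
  | whileFalse {b : BExp} {p : Prog} {s : State}
      (hb : ¬ b.eval O s) : Exec O (.while b p) s s (1 + b.cost)
  | whileTrue {b : BExp} {p : Prog} {s s' s'' : State} {m n : ℕ}
      (hb : b.eval O s) (hp : Exec O p s s' m) (hw : Exec O (.while b p) s' s'' n) :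
      Exec O (.while b p) s s'' (1 + b.cost + m + n)

end RealRAM

/-! ## The uncapacitated minimum-concave-cost flow problem in a grid -/

/-- Vertices of the grid with `L` rows and `T` columns: pairs (row, column), numbered from `0`. -/
abbrev GridVertex (L T : ℕ) : Type := Fin L × Fin T

/-- Arcs go one row down in the same column, or one column forward in the same row. -/
def IsGridArc {L T : ℕ} (u v : GridVertex L T) : Prop :=
  ((v.1 : ℕ) = (u.1 : ℕ) + 1 ∧ v.2 = u.2) ∨ (v.1 = u.1 ∧ (v.2 : ℕ) = (u.2 : ℕ) + 1)

instance {L T : ℕ} (u v : GridVertex L T) : Decidable (IsGridArc u v) :=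
  inferInstanceAs (Decidable (_ ∨ _))

/-- Arcs of the grid, as pairs (tail, head). -/
abbrev GridArc (L T : ℕ) : Type :=
  {a : GridVertex L T × GridVertex L T // IsGridArc a.1 a.2}

/-- The forward arc with tail in row `l` and column `t`. -/
def GridArc.forward {L T : ℕ} (l t : ℕ) (hl : l < L) (ht : t + 1 < T) : GridArc L T :=
  ⟨((⟨l, hl⟩, ⟨t, Nat.lt_of_succ_lt ht⟩), (⟨l, hl⟩, ⟨t + 1, ht⟩)), Or.inr ⟨rfl, rfl⟩⟩

/-- The downward arc with tail in row `l` and column `t`. -/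
def GridArc.downward {L T : ℕ} (l t : ℕ) (hl : l + 1 < L) (ht : t < T) : GridArc L T :=
  ⟨((⟨l, Nat.lt_of_succ_lt hl⟩, ⟨t, ht⟩), (⟨l + 1, hl⟩, ⟨t, ht⟩)), Or.inl ⟨rfl, rfl⟩⟩

/-- An instance of the problem, with all arc capacities infinite. The cost functions are real
functions that are concave on the range `[0, ∞)` of possible flow values; in particular a fixed
charge at `0` is allowed. -/
structure UMFG (L T : ℕ) : Type where
  /-- supplies -/
  b : GridVertex L T → ℤ
  /-- arc costs -/
  c : GridArc L T → ℝ → ℝ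
  sum_b : ∑ v, b v = 0
  concave_c : ∀ a, ConcaveOn ℝ (Set.Ici 0) (c a)

namespace UMFG

variable {L T : ℕ}

/-- Feasible flows: nonnegative, with outflow minus inflow equal to the supply at each vertex. -/
def IsFeasibleFlow (I : UMFG L T) (x : GridArc L T → ℝ) : Prop :=
  (∀ v : GridVertex L T,
    ∑ a : GridArc L T with a.1.1 = v, x a - ∑ a : GridArc L T with a.1.2 = v, x a = (I.b v : ℝ)) ∧
  ∀ a, 0 ≤ x a

/-- Total cost of a flow. -/
def totalCost (I : UMFG L T) (x : GridArc L T → ℝ) : ℝ := ∑ a, I.c a (x a)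

/-- Optimal flows. -/
def IsOptimalFlow (I : UMFG L T) (x : GridArc L T → ℝ) : Prop :=
  I.IsFeasibleFlow x ∧ ∀ y, I.IsFeasibleFlow y → I.totalCost x ≤ I.totalCost y

/-- All sources (vertices of positive supply) lie in one row. -/
def SourcesInOneRow (I : UMFG L T) : Prop :=
  ∃ r : Fin L, ∀ v : GridVertex L T, 0 < I.b v → v.1 = r

/-- The cost oracle of the instance (queries that name no arc are answered by `0`). -/
def oracle (I : UMFG L T) : RealRAM.Oracle
  | .forward, l, t, x =>
      if h : l < L ∧ t + 1 < T then I.c (GridArc.forward l t h.1 h.2) x else 0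
  | .downward, l, t, x =>
      if h : l + 1 < L ∧ t < T then I.c (GridArc.downward l t h.1 h.2) x else 0

/-- Input format: index registers `0` and `1` hold `L` and `T`; the real register `l * T + t` holds
the supply of the vertex in row `l` and column `t`; all other registers hold `0`. -/
def initState (I : UMFG L T) : RealRAM.State where
  idx := fun i => if i = 0 then L else if i = 1 then T else 0
  real := fun i =>
    if h : i < L * T then
      (I.b (⟨i / T, Nat.div_lt_of_lt_mul (Nat.mul_comm L T ▸ h)⟩,
        ⟨i % T, Nat.mod_lt i (Nat.pos_of_mul_pos_left (Nat.zero_lt_of_lt h))⟩) : ℝ)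
    else 0

end UMFG

/-- Output format: the flow on an arc with tail in row `l` and column `t` is read off from the real
register `l * T + t` if the arc is a forward arc, and from the real register `L * T + l * T + t` if
it is a downward arc. -/
def RealRAM.State.outputFlow (L T : ℕ) (s : RealRAM.State) (a : GridArc L T) : ℝ :=
  if a.1.1.1 = a.1.2.1 then s.real ((a.1.1.1 : ℕ) * T + (a.1.1.2 : ℕ))
  else s.real (L * T + (a.1.1.1 : ℕ) * T + (a.1.1.2 : ℕ))

/-! Concavity allows a restriction to flows whose support is a forest: along a cycle of the support
the flow can be shifted either way until an arc becomes empty, and one of the two shifts does not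
raise the cost (`exists_forest_flow`). In such a flow every used arc `a` is a bridge, so its value
is the total supply of any set X that contains the tail, misses the head and is closed under the
steps of the support without `a`.

Planarity makes X simple. All flow starts in the row of the sources and runs down or forward.
Disjoint directed paths keep their order, and components whose vertices are all reached from the
source row do not cross other components. Hence the sources on the side of the tail can be taken to
be those in an interval of the source row, or those outside one (`exists_top_interval`). In every
row, the vertices reached from these sources, from the other sources, or only from the head of `a`
are then arranged so that the supply of X in the row is a sum over a cyclic interval minus a sum
over an interval (`exists_cut`). The second interval is empty in rows above the head. A forward arc
outside the top row is therefore described by L + (L - 1) = 2L - 1 intervals, with T² choices each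
for T ≥ 2 (`UMFG.IsFeasibleFlow.forward_value`).

A state lists these intervals for the L - 1 forward arcs below the top row that cross a column cut,
so for T ≥ 2 there are M = T^(2(L - 1)(2L - 1)) states. The top row and the downward arcs follow
from conservation. A dynamic program over the T columns examines M² transitions per column, each in
O(L) steps; the total O(L T M²) is the claim, since 4(L - 1)(2L - 1) + 1 = 8L² - 12L + 5. States
that come from no forest flow do no harm: every chain of states that passes the sign tests is a
feasible flow of the same cost (`IsStateChain.isFeasibleFlow`). The program is verified by loop
invariants that also bound the number of steps. -/

/-! ## Reduction to flows whose support is a forest -/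

section Forest

variable {V E : Type*} [Fintype E] [DecidableEq V]

/-- Net outflow of `z` at the vertex `v`. -/
def netOut (tl hd : E → V) (z : E → ℝ) (v : V) : ℝ :=
  ∑ e with tl e = v, z e - ∑ e with hd e = v, z e

theorem netOut_eq_sum (tl hd : E → V) (z : E → ℝ) (v : V) :
    netOut tl hd z v = ∑ e, z e * ((if tl e = v then 1 else 0) - (if hd e = v then 1 else 0)) := by
  simp only [netOut, Finset.sum_filter, ← Finset.sum_sub_distrib]
  refine Finset.sum_congr rfl fun e _ => ?_
  split_ifs <;> ring

theorem netOut_add_mul (tl hd : E → V) (x z : E → ℝ) (c : ℝ) (v : V) :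
    netOut tl hd (fun e => x e + c * z e) v = netOut tl hd x v + c * netOut tl hd z v := by
  simp only [netOut_eq_sum, Finset.mul_sum, ← Finset.sum_add_distrib]
  exact Finset.sum_congr rfl fun e _ => by ring

/-- The weighted sum of net outflows over all vertices. -/
theorem sum_mul_netOut [Fintype V] (tl hd : E → V) (z : E → ℝ) (φ : V → ℝ) :
    ∑ v, φ v * netOut tl hd z v = ∑ e, z e * (φ (tl e) - φ (hd e)) := by
  simp only [netOut_eq_sum, Finset.mul_sum]
  rw [Finset.sum_comm]
  refine Finset.sum_congr rfl fun e _ => ?_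
  have : ∀ v, φ v * (z e * ((if tl e = v then 1 else 0) - if hd e = v then 1 else 0)) =
      (if tl e = v then z e * φ v else 0) - (if hd e = v then z e * φ v else 0) := by
    intro v; split_ifs <;> ring
  simp only [this, Finset.sum_sub_distrib, Finset.sum_ite_eq, Finset.mem_univ, if_true]
  ring

/-- Two vertices are joined by an arc of positive flow other than `a`. -/
def SupportStep (tl hd : E → V) (x : E → ℝ) (a : E) (u v : V) : Prop :=
  ∃ e, e ≠ a ∧ 0 < x e ∧ tl e = u ∧ hd e = v

/-- A walk in the support, read without regard to direction, carries one unit from `u` to `v` if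
arcs traversed backwards count negatively. The result lives on the support and avoids `a`, so that
`a` can close it to a circulation. -/
theorem exists_transport (tl hd : E → V) (x : E → ℝ) (a : E) {u v : V}
    (h : Relation.EqvGen (SupportStep tl hd x a) u v) :
    ∃ d : E → ℝ, (∀ w, netOut tl hd d w = (if u = w then 1 else 0) - (if v = w then 1 else 0)) ∧
      d a = 0 ∧ ∀ e, ¬ 0 < x e → d e = 0 := by
  classical
  induction h with
  | rel u v h =>
    obtain ⟨e, hea, hxe, rfl, rfl⟩ := h
    refine ⟨fun e' => if e' = e then 1 else 0, fun w => ?_, ?_, ?_⟩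
    · simp [netOut_eq_sum]
    · simp [hea.symm]
    · intro e' he'
      have : e' ≠ e := by rintro rfl; exact he' hxe
      simp [this]
  | refl u => exact ⟨fun _ => 0, by simp [netOut_eq_sum], rfl, fun _ _ => rfl⟩
  | symm u v _ ih =>
    obtain ⟨d, h1, h2, h3⟩ := ih
    refine ⟨fun e => 0 + (-1) * d e, fun w => ?_, by simp [h2], fun e he => by simp [h3 e he]⟩
    have h0 : netOut tl hd (fun _ => (0 : ℝ)) w = 0 := by simp [netOut_eq_sum]
    rw [netOut_add_mul tl hd (fun _ => 0), h1, h0]; ring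
  | trans u v w _ _ ih1 ih2 =>
    obtain ⟨d, h1, h2, h3⟩ := ih1
    obtain ⟨d', h1', h2', h3'⟩ := ih2
    refine ⟨fun e => d e + 1 * d' e, fun w => ?_, by simp [h2, h2'],
      fun e he => by simp [h3 e he, h3' e he]⟩
    rw [netOut_add_mul, h1, h1']; ring

/-- Moving along a direction with a negative entry until the first arc of the support is empty. -/
theorem exists_ratio_step (x z : E → ℝ) (hx : ∀ e, 0 ≤ x e) (hz : ∀ e, ¬ 0 < x e → z e = 0)
    (hneg : ∃ e, z e < 0) :
    ∃ c : ℝ, 0 < c ∧ (∀ e, 0 ≤ x e + c * z e) ∧ ∃ e, 0 < x e ∧ x e + c * z e = 0 := by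
  classical
  obtain ⟨e0, he0⟩ := hneg
  obtain ⟨e, he, hmin⟩ := Finset.exists_min_image (Finset.univ.filter fun e => z e < 0)
    (fun e => x e / (- z e)) ⟨e0, by simp [he0]⟩
  simp only [Finset.mem_filter, Finset.mem_univ, true_and] at he hmin
  have hxe : 0 < x e := by
    by_contra h; rw [hz e h] at he; exact lt_irrefl _ he
  refine ⟨x e / (- z e), div_pos hxe (by linarith), fun e' => ?_, e, hxe, ?_⟩
  · rcases lt_or_ge (z e') 0 with h | h
    · have := hmin e' h
      rw [le_div_iff₀ (by linarith)] at this
      linarith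
    · have : 0 ≤ x e / (- z e) * z e' := mul_nonneg (div_pos hxe (by linarith)).le h
      linarith [hx e']
  · have : z e ≠ 0 := he.ne
    field_simp
    ring

/-- A flow with a cycle in its support can be replaced, at no greater cost, by one with smaller
support. -/
theorem exists_smaller_support [Fintype V] (tl hd : E → V) (φ : V → ℝ)
    (hφ : ∀ e, φ (tl e) < φ (hd e)) (c : E → ℝ → ℝ) (hc : ∀ e, ConcaveOn ℝ (Set.Ici 0) (c e))
    (x : E → ℝ) (hx : ∀ e, 0 ≤ x e) (a : E) (ha : 0 < x a)
    (hcyc : Relation.EqvGen (SupportStep tl hd x a) (tl a) (hd a)) :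
    ∃ y : E → ℝ, (∀ e, 0 ≤ y e) ∧ (∀ v, netOut tl hd y v = netOut tl hd x v) ∧
      ∑ e, c e (y e) ≤ ∑ e, c e (x e) ∧
      (Finset.univ.filter fun e => 0 < y e) ⊂ Finset.univ.filter fun e => 0 < x e := by
  classical
  obtain ⟨d, hd1, hd2, hd3⟩ := exists_transport tl hd x a hcyc
  -- One unit on `a` minus a transport of one unit from its tail to its head: a circulation on the
  -- support with value `1` on `a`.
  set z : E → ℝ := fun e => (if e = a then 1 else 0) + (-1) * d e with hzdef
  have hz0 : ∀ v, netOut tl hd z v = 0 := by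
    intro v
    rw [hzdef, netOut_add_mul, hd1, netOut_eq_sum]
    simp
  have hza : z a = 1 := by simp [hzdef, hd2]
  have hzs : ∀ e, ¬ 0 < x e → z e = 0 := by
    intro e he
    have : e ≠ a := by rintro rfl; exact he ha
    simp [hzdef, this, hd3 e he]
  have hsum : ∑ e, z e * (φ (tl e) - φ (hd e)) = 0 := by
    rw [← sum_mul_netOut]; simp [hz0]
  -- Since `φ` increases along every arc there is no directed cycle, so a circulation that is
  -- positive on `a` is negative somewhere. Hence each of the two opposite shifts is stopped by an
  -- arc that becomes empty.
  have hneg : ∃ e, z e < 0 := by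
    by_contra h
    push Not at h
    have h1 : ∀ e ∈ Finset.univ, z e * (φ (tl e) - φ (hd e)) ≤ 0 := fun e _ =>
      mul_nonpos_of_nonneg_of_nonpos (h e) (by linarith [hφ e])
    have := (Finset.sum_eq_zero_iff_of_nonpos h1).1 hsum a (Finset.mem_univ a)
    rw [hza] at this
    linarith [hφ a]
  obtain ⟨p, hp, hp1, e1, he1, he1'⟩ := exists_ratio_step x z hx hzs hneg
  obtain ⟨q, hq, hq1, e2, he2, he2'⟩ := exists_ratio_step x (fun e => - z e) hx
    (fun e he => by simp [hzs e he]) ⟨a, by simp [hza]⟩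
  have hsub : ∀ (r : ℝ) (e0 : E), 0 < x e0 → x e0 + r * z e0 = 0 →
      (Finset.univ.filter fun e => 0 < x e + r * z e) ⊂ Finset.univ.filter fun e => 0 < x e := by
    intro r e0 h0 h1
    refine (Finset.ssubset_iff_of_subset ?_).2 ⟨e0, by simp [h0], by simp [h1]⟩
    intro e he
    simp only [Finset.mem_filter, Finset.mem_univ, true_and] at he ⊢
    by_contra h
    rw [hzs e h] at he
    exact h (by simpa using he)
  have hq' : ∀ e, x e + q * -z e = x e + (-q) * z e := fun e => by ring
  simp only [hq'] at hq1 he2'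
  -- `x` is the convex combination of the two shifted flows with these weights, so they cannot both
  -- cost more than `x`.
  have hconc : ∀ e, q / (p + q) * c e (x e + p * z e) + p / (p + q) * c e (x e + (-q) * z e)
      ≤ c e (x e) := by
    intro e
    have h := (hc e).2 (Set.mem_Ici.2 (hp1 e)) (Set.mem_Ici.2 (hq1 e))
      (show 0 ≤ q / (p + q) by positivity) (show 0 ≤ p / (p + q) by positivity)
      (by field_simp; ring)
    simp only [smul_eq_mul] at h
    have h2 : q / (p + q) * (x e + p * z e) + p / (p + q) * (x e + -q * z e) = x e := by
      field_simp; ring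
    rwa [h2] at h
  have hs := Finset.sum_le_sum fun e (_ : e ∈ Finset.univ) => hconc e
  rw [Finset.sum_add_distrib, ← Finset.mul_sum, ← Finset.mul_sum] at hs
  by_cases hcase : ∑ e, c e (x e + p * z e) ≤ ∑ e, c e (x e)
  · exact ⟨fun e => x e + p * z e, hp1, fun v => by rw [netOut_add_mul, hz0]; ring, hcase,
      hsub p e1 he1 he1'⟩
  · refine ⟨fun e => x e + (-q) * z e, hq1, fun v => by rw [netOut_add_mul, hz0]; ring, ?_,
      hsub (-q) e2 he2 he2'⟩
    push Not at hcase
    by_contra hcase2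
    push Not at hcase2
    have e1 : 0 < q / (p + q) := by positivity
    have e2 : 0 < p / (p + q) := by positivity
    have e3 : q / (p + q) + p / (p + q) = 1 := by field_simp; ring
    have h1 := mul_lt_mul_of_pos_left hcase e1
    have h2 := mul_lt_mul_of_pos_left hcase2 e2
    have h3 : ∑ e, c e (x e) = q / (p + q) * ∑ e, c e (x e) + p / (p + q) * ∑ e, c e (x e) := by
      rw [← add_mul, e3, one_mul]
    linarith

/-- Every flow is dominated by a flow in whose support every arc is a bridge. -/
theorem exists_forest_flow [Fintype V] (tl hd : E → V) (φ : V → ℝ)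
    (hφ : ∀ e, φ (tl e) < φ (hd e)) (c : E → ℝ → ℝ) (hc : ∀ e, ConcaveOn ℝ (Set.Ici 0) (c e))
    (x : E → ℝ) (hx : ∀ e, 0 ≤ x e) :
    ∃ y : E → ℝ, (∀ e, 0 ≤ y e) ∧ (∀ v, netOut tl hd y v = netOut tl hd x v) ∧
      ∑ e, c e (y e) ≤ ∑ e, c e (x e) ∧
      ∀ a, 0 < y a → ¬ Relation.EqvGen (SupportStep tl hd y a) (tl a) (hd a) := by
  induction hn : (Finset.univ.filter fun e => 0 < x e).card using Nat.strong_induction_on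
    generalizing x with
  | _ n ih =>
    by_cases h : ∀ a, 0 < x a → ¬ Relation.EqvGen (SupportStep tl hd x a) (tl a) (hd a)
    · exact ⟨x, hx, fun _ => rfl, le_rfl, h⟩
    · push Not at h
      obtain ⟨a, ha, hcyc⟩ := h
      obtain ⟨y, hy, hyn, hyc, hys⟩ := exists_smaller_support tl hd φ hφ c hc x hx a ha hcyc
      obtain ⟨w, hw, hwn, hwc, hwf⟩ := ih _ (hn ▸ Finset.card_lt_card hys) y hy rfl
      exact ⟨w, hw, fun v => (hwn v).trans (hyn v), hwc.trans hyc, hwf⟩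

end Forest

/-! ## Directed lattice paths in the plane -/

section Lattice

open Relation

/-- The steps of the relation go one row down or one column forward. -/
def IsLatticeRel (E : ℕ × ℕ → ℕ × ℕ → Prop) : Prop :=
  ∀ z w, E z w → w = (z.1 + 1, z.2) ∨ w = (z.1, z.2 + 1)

/-- The columns visited by a down-right lattice path form the interval `[lo ρ, hi ρ]` in each row
`ρ` between `r` and `k`. -/
structure IsLatticePath (r k : ℕ) (lo hi : ℕ → ℕ) : Prop where
  le : ∀ ρ, r ≤ ρ → ρ ≤ k → lo ρ ≤ hi ρ
  link : ∀ ρ, r ≤ ρ → ρ < k → hi ρ = lo (ρ + 1)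

/-- The point lies on the path. -/
def OnPath (r k : ℕ) (lo hi : ℕ → ℕ) (z : ℕ × ℕ) : Prop :=
  r ≤ z.1 ∧ z.1 ≤ k ∧ lo z.1 ≤ z.2 ∧ z.2 ≤ hi z.1

/-- A forward step cannot jump over the nonempty interval of its row. A downward step from the left
stays left because `lo (ρ + 1) = hi ρ ≥ lo ρ`; conversely, a point above a left one is left of `hi
ρ`, and being off the path it is left of `lo ρ`. -/
theorem IsLatticePath.left_step {r k : ℕ} {lo hi : ℕ → ℕ} (h : IsLatticePath r k lo hi)
    {z w : ℕ × ℕ} (hzw : w = (z.1 + 1, z.2) ∨ w = (z.1, z.2 + 1)) (hz : r ≤ z.1) (hw : w.1 ≤ k)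
    (nz : ¬ OnPath r k lo hi z) (nw : ¬ OnPath r k lo hi w) :
    z.2 < lo z.1 ↔ w.2 < lo w.1 := by
  obtain ⟨a, b⟩ := z
  have e1 := h.le a
  unfold OnPath at nz nw
  rcases hzw with rfl | rfl
  · have e2 := h.le (a + 1)
    have e3 := h.link a
    simp only at *
    omega
  · simp only at *
    omega

theorem IsLatticePath.right_step {r k : ℕ} {lo hi : ℕ → ℕ} (h : IsLatticePath r k lo hi)
    {z w : ℕ × ℕ} (hzw : w = (z.1 + 1, z.2) ∨ w = (z.1, z.2 + 1)) (hz : r ≤ z.1) (hw : w.1 ≤ k)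
    (nz : ¬ OnPath r k lo hi z) (nw : ¬ OnPath r k lo hi w) :
    hi z.1 < z.2 ↔ hi w.1 < w.2 := by
  obtain ⟨a, b⟩ := z
  have e1 := h.le a
  unfold OnPath at nz nw
  rcases hzw with rfl | rfl
  · have e2 := h.le (a + 1)
    have e3 := h.link a
    simp only at *
    omega
  · simp only at *
    omega

variable {E : ℕ × ℕ → ℕ × ℕ → Prop}

theorem IsLatticeRel.row_le (hE : IsLatticeRel E) {z w : ℕ × ℕ} (h : ReflTransGen E z w) :
    z.1 ≤ w.1 := by
  induction h with
  | refl => exact le_rfl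
  | tail _ h ih => rcases hE _ _ h with rfl | rfl <;> simp only at * <;> omega

theorem IsLatticeRel.col_le (hE : IsLatticeRel E) {z w : ℕ × ℕ} (h : ReflTransGen E z w) :
    z.2 ≤ w.2 := by
  induction h with
  | refl => exact le_rfl
  | tail _ h ih => rcases hE _ _ h with rfl | rfl <;> simp only at * <;> omega

/-- Besides the shape of the path, the conclusion records that each of its points is reached from
the start and reaches the end. This is the form in which paths serve as barriers below. -/
theorem IsLatticeRel.exists_path (hE : IsLatticeRel E) {r c : ℕ} {w : ℕ × ℕ}
    (h : ReflTransGen E (r, c) w) :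
    ∃ lo hi : ℕ → ℕ, IsLatticePath r w.1 lo hi ∧ lo r = c ∧ hi w.1 = w.2 ∧
      ∀ z, OnPath r w.1 lo hi z → ReflTransGen E (r, c) z ∧ ReflTransGen E z w := by
  induction h with
  | refl =>
    refine ⟨fun _ => c, fun _ => c, ⟨fun _ _ _ => le_rfl, fun _ _ _ => rfl⟩, rfl, rfl, ?_⟩
    rintro ⟨a, b⟩ ⟨h1, h2, h3, h4⟩
    simp only at *
    obtain rfl : a = r := by omega
    obtain rfl : b = c := by omega
    exact ⟨.refl, .refl⟩
  | @tail y w hy hyw ih =>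
    obtain ⟨lo, hi, hp, h1, h2, h3⟩ := ih
    have hr := hE.row_le hy
    obtain ⟨a, b⟩ := y
    simp only at hr h2 hp h3
    rcases hE _ _ hyw with rfl | rfl
    · refine ⟨fun ρ => if ρ = a + 1 then b else lo ρ, fun ρ => if ρ = a + 1 then b else hi ρ,
        ⟨fun ρ hρ hρ' => ?_, fun ρ hρ hρ' => ?_⟩, ?_, by simp, ?_⟩
      · have := hp.le ρ
        simp only at *
        split_ifs <;> omega
      · have := hp.link ρ
        simp only at *
        by_cases e : ρ = a
        · subst e; simp [h2]
        · rw [if_neg (by omega), if_neg (by omega)]; exact this hρ (by omega)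
      · simp only [show r ≠ a + 1 by omega, if_false]; exact h1
      · rintro ⟨a', b'⟩ ⟨h5, h6, h7, h8⟩
        simp only at *
        by_cases e : a' = a + 1
        · subst e
          simp only [if_true] at h7 h8
          obtain rfl : b' = b := by omega
          exact ⟨hy.tail hyw, .refl⟩
        · simp only [e, if_false] at h7 h8
          have := h3 (a', b') ⟨h5, by simp only; omega, h7, h8⟩
          exact ⟨this.1, this.2.tail hyw⟩
    · refine ⟨lo, fun ρ => if ρ = a then b + 1 else hi ρ,
        ⟨fun ρ hρ hρ' => ?_, fun ρ hρ hρ' => ?_⟩, h1, by simp, ?_⟩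
      · have := hp.le ρ
        simp only at *
        split_ifs with e
        · subst e; have := this hρ hρ'; omega
        · omega
      · have := hp.link ρ
        simp only at *
        rw [if_neg (by omega)]; exact this hρ (by omega)
      · rintro ⟨a', b'⟩ ⟨h5, h6, h7, h8⟩
        simp only at *
        by_cases e : a' = a ∧ b' = b + 1
        · obtain ⟨rfl, rfl⟩ := e
          exact ⟨hy.tail hyw, .refl⟩
        · have := h3 (a', b') ⟨h5, h6, h7, by simp only; split_ifs at h8 <;> [(subst_vars; omega); omega]⟩
          exact ⟨this.1, this.2.tail hyw⟩

/-- A vertex of the walk on the path would be a path vertex that reaches `w`, against `hn`. So the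
walk avoids the path and `left_step` applies to each step. -/
theorem IsLatticeRel.left_reach (hE : IsLatticeRel E) {r k : ℕ} {lo hi : ℕ → ℕ}
    (hp : IsLatticePath r k lo hi) {z w : ℕ × ℕ} (h : ReflTransGen E z w)
    (hw : w.1 ≤ k) (hn : ∀ y, OnPath r k lo hi y → ¬ ReflTransGen E y w) (hz : r ≤ z.1)
    (hl : z.2 < lo z.1) : w.2 < lo w.1 := by
  induction h using ReflTransGen.head_induction_on with
  | refl => exact hl
  | @head y y' h h' ih =>
    have h0 := hE _ _ h
    have h1 := hE.row_le h'
    have h2 : r ≤ y'.1 := by rcases h0 with e | e <;> simp only [e] <;> omega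
    exact ih h2 ((hp.left_step h0 hz (by omega) (fun hy => hn _ hy (h'.head h))
      (fun hy => hn _ hy h')).1 hl)

theorem IsLatticeRel.right_reach (hE : IsLatticeRel E) {r k : ℕ} {lo hi : ℕ → ℕ}
    (hp : IsLatticePath r k lo hi) {z w : ℕ × ℕ} (h : ReflTransGen E z w)
    (hw : w.1 ≤ k) (hn : ∀ y, OnPath r k lo hi y → ¬ ReflTransGen E y w) (hz : r ≤ z.1)
    (hl : hi z.1 < z.2) : hi w.1 < w.2 := by
  induction h using ReflTransGen.head_induction_on with
  | refl => exact hl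
  | @head y y' h h' ih =>
    have h0 := hE _ _ h
    have h1 := hE.row_le h'
    have h2 : r ≤ y'.1 := by rcases h0 with e | e <;> simp only [e] <;> omega
    exact ih h2 ((hp.right_step h0 hz (by omega) (fun hy => hn _ hy (h'.head h))
      (fun hy => hn _ hy h')).1 hl)

/-- Disjoint paths from one row to another keep their order. -/
theorem IsLatticeRel.order_of_disjoint (hE : IsLatticeRel E) {r c c' k d d' : ℕ} (hc : c < c')
    (h : ReflTransGen E (r, c) (k, d)) (h' : ReflTransGen E (r, c') (k, d'))
    (hn : ∀ y, ReflTransGen E (r, c) y → ¬ ReflTransGen E (r, c') y) : d < d' := by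
  obtain ⟨lo, hi, hp, h1, h2, h3⟩ := hE.exists_path h'
  simp only at *
  -- The path from the right column is the barrier; if one of its vertices reached `(k, d)`, both
  -- starting points would reach this point.
  have := hE.left_reach hp h le_rfl (fun y hy hy' => ?_) le_rfl (by simp only; omega)
  · simp only at this
    have := hp.le k (hE.row_le h) le_rfl
    omega
  · exact hn (k, d) h (((h3 y hy).1).trans hy')

/-- A point outside a path all of whose descendants in a row avoid the path stays on one side of
it. -/
theorem IsLatticeRel.not_between (hE : IsLatticeRel E) {r c k d d₁ d₂ : ℕ} {v : ℕ × ℕ}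
    (hv : r ≤ v.1) (h : ReflTransGen E (r, c) (k, d)) (h₁ : ReflTransGen E v (k, d₁))
    (h₂ : ReflTransGen E v (k, d₂)) (n₁ : ¬ ReflTransGen E (r, c) (k, d₁))
    (n₂ : ¬ ReflTransGen E (r, c) (k, d₂)) : ¬ (d₁ < d ∧ d < d₂) := by
  rintro ⟨hd₁, hd₂⟩
  obtain ⟨lo, hi, hp, e1, e2, e3⟩ := hE.exists_path h
  simp only at *
  have hvk : v.1 ≤ k := hE.row_le h₁
  have hnv : ¬ OnPath r k lo hi v := fun hy => n₁ ((e3 v hy).1.trans h₁)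
  have hle := hp.le k (hE.row_le h) le_rfl
  -- `v` is off the path: from its left side `d₂` is out of reach, from its right side `d₁`.
  rcases lt_or_ge v.2 (lo v.1) with hl | hl
  · have := hE.left_reach hp h₂ le_rfl (fun y hy hy' => n₂ ((e3 y hy).1.trans hy')) hv hl
    simp only at this
    omega
  · have hr : hi v.1 < v.2 := by
      by_contra hcon
      exact hnv ⟨hv, hvk, hl, by omega⟩
    have := hE.right_reach hp h₁ le_rfl (fun y hy hy' => n₁ ((e3 y hy).1.trans hy')) hv hr
    simp only at this
    omega

theorem eqvGen_of_reflTransGen {α : Type*} {R : α → α → Prop} {a b : α} (h : ReflTransGen R a b) :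
    EqvGen R a b := by
  induction h with
  | refl => exact .refl _
  | tail _ h ih => exact ih.trans _ _ _ (.rel _ _ h)

/-- A predicate that is preserved by the steps within the equivalence class of `a` is constant on
this class. -/
theorem iff_of_eqvGen {α : Type*} {R : α → α → Prop} {P : α → Prop} {a b : α} (h : EqvGen R a b)
    (hP : ∀ x y, R x y → EqvGen R a x → (P x ↔ P y)) : P a ↔ P b := by
  suffices H : ∀ x y, EqvGen R x y → EqvGen R a x → (P x ↔ P y) from H a b h (.refl _)
  intro x y hxy
  induction hxy with
  | rel x y h => exact hP x y h
  | refl => exact fun _ => Iff.rfl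
  | symm x y h ih => exact fun h' => (ih (h'.trans _ _ _ (h.symm _ _))).symm
  | trans x y z h _ ih1 ih2 => exact fun h' => (ih1 h').trans (ih2 (h'.trans _ _ _ h))

/-- Two paths from the top row `r` with a common end enclose a region that other components cannot
leave. -/
theorem IsLatticeRel.not_eqvGen_of_enclosed (hE : IsLatticeRel E) {r : ℕ}
    (hr : ∀ z w, E z w → r ≤ z.1) {i k c c' : ℕ} {m : ℕ × ℕ} (hi : ReflTransGen E (r, i) m)
    (hk : ReflTransGen E (r, k) m) (hc : i < c) (hck : c < k) (hc' : c' < i ∨ k < c')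
    (hcc : EqvGen E (r, c) (r, c')) : EqvGen E (r, c) m := by
  by_contra hcm
  obtain ⟨lo, hi, hp, e1, e2, e3⟩ := hE.exists_path hi
  obtain ⟨lo', hi', hp', e1', e2', e3'⟩ := hE.exists_path hk
  have hn : ∀ y, EqvGen E (r, c) y → ¬ OnPath r m.1 lo hi y := fun y hy hy' =>
    hcm (hy.trans _ _ _ (eqvGen_of_reflTransGen (e3 y hy').2))
  have hn' : ∀ y, EqvGen E (r, c) y → ¬ OnPath r m.1 lo' hi' y := fun y hy hy' =>
    hcm (hy.trans _ _ _ (eqvGen_of_reflTransGen (e3' y hy').2))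
  have hrm := hE.row_le hk
  simp only at hrm
  -- The enclosed region lies strictly between the two paths, in rows up to that of `m`. The
  -- component meets neither path, as both lead to `m`, and in the row of `m` nothing lies between
  -- them, so there is no exit at the bottom either.
  have key := iff_of_eqvGen (P := fun z => z.1 ≤ m.1 ∧ hi z.1 < z.2 ∧ z.2 < lo' z.1) hcc ?_
  · simp only at key
    have hin : hi r < c := by
      by_contra h
      exact hn _ (.refl _) ⟨le_rfl, hrm, by simp only; omega, by simp only; omega⟩
    have := hp.le r le_rfl hrm
    omega
  · intro x y hxy hx
    have hy := hx.trans _ _ _ (.rel _ _ hxy)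
    have h0 := hE _ _ hxy
    have hrx := hr _ _ hxy
    have hle := hp'.le m.1 hrm le_rfl
    by_cases hym : y.1 ≤ m.1
    · have h1 := hp.right_step h0 hrx hym (hn x hx) (hn y hy)
      have h2 := hp'.left_step h0 hrx hym (hn' x hx) (hn' y hy)
      have h3 : x.1 ≤ m.1 := by rcases h0 with e | e <;> rw [e] at hym <;> simp only at hym <;> omega
      simp only [h1, h2, h3, hym]
    · refine ⟨fun h => ?_, fun h => absurd h.1 hym⟩
      have hx1 : x.1 = m.1 := by
        rcases h0 with e | e <;> rw [e] at hym <;> simp only at hym <;> omega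
      rw [hx1] at h
      omega

end Lattice

/-! ### Noncrossing components and the shape of a cut in each row -/

section Cut

open Relation

variable {E : ℕ × ℕ → ℕ × ℕ → Prop}

/-- A component in which every vertex can be reached from the top row does not cross another
component. -/
theorem IsLatticeRel.noncrossing (hE : IsLatticeRel E) {r : ℕ} (hr : ∀ z w, E z w → r ≤ z.1)
    {Top : Set ℕ} {z₀ : ℕ × ℕ}
    (hK : ∀ z, EqvGen E z₀ z → ∃ c ∈ Top, ReflTransGen E (r, c) z) {c₁ c₂ k₁ k₂ : ℕ}
    (hcc : EqvGen E (r, c₁) (r, c₂)) (hc : ¬ EqvGen E z₀ (r, c₁))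
    (hk₁ : EqvGen E z₀ (r, k₁)) (hk₂ : EqvGen E z₀ (r, k₂)) (h₁ : c₁ < k₁) (h₂ : k₁ < c₂)
    (h₃ : k₂ < c₁ ∨ c₂ < k₂) : False := by
  have hc' : ¬ EqvGen E z₀ (r, c₂) := fun h => hc (h.trans _ _ _ (hcc.symm _ _))
  -- If `z` were reached both from inside and from outside the range between `c₁` and `c₂`, the two
  -- paths to `z` would enclose exactly one of `c₁` and `c₂`.
  have main : ∀ z, EqvGen E z₀ z → ∀ c c', ReflTransGen E (r, c) z → ReflTransGen E (r, c') z →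
      c₁ < c → c < c₂ → c₁ < c' ∧ c' < c₂ := by
    intro z hz c c' hcz hcz' hl hu
    have hne : ∀ d, ReflTransGen E (r, d) z → d ≠ c₁ ∧ d ≠ c₂ := fun d hd =>
      ⟨by rintro rfl; exact hc (hz.trans _ _ _ ((eqvGen_of_reflTransGen hd).symm _ _)),
        by rintro rfl; exact hc' (hz.trans _ _ _ ((eqvGen_of_reflTransGen hd).symm _ _))⟩
    have := hne c' hcz'
    by_contra hcon
    rcases lt_or_ge c' c₁ with h | h
    · exact hc (hz.trans _ _ _ ((hE.not_eqvGen_of_enclosed hr hcz' hcz h hl (Or.inr hu)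
        hcc).symm _ _))
    · have h5 : c₂ < c' := by omega
      exact hc' (hz.trans _ _ _ ((hE.not_eqvGen_of_enclosed hr hcz hcz' hu h5 (Or.inl hl)
        (hcc.symm _ _)).symm _ _))
  -- Being reached from between `c₁` and `c₂` is thus constant on the component of `z₀`; it holds at
  -- `k₁` and fails at `k₂`.
  have key := iff_of_eqvGen (P := fun z => ∃ c, ReflTransGen E (r, c) z ∧ c₁ < c ∧ c < c₂)
    ((hk₁.symm _ _).trans _ _ _ hk₂) ?_
  · obtain ⟨c, h4, h5, h6⟩ := key.1 ⟨k₁, .refl, h₁, h₂⟩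
    have := main _ hk₂ c k₂ h4 .refl h5 h6
    omega
  · intro x y hxy hx
    have hx' := hk₁.trans _ _ _ hx
    refine ⟨fun ⟨c, h4, h5⟩ => ⟨c, h4.tail hxy, h5⟩, fun ⟨c, h4, h5, h6⟩ => ?_⟩
    obtain ⟨c', -, hc'⟩ := hK x hx'
    exact ⟨c', hc', main y (hx'.trans _ _ _ (.rel _ _ hxy)) c c' h4 (hc'.tail hxy) h5 h6⟩

/-- Members of a nontrivial class are ends of steps; the reachability hypothesis `htr` below speaks
only of such points. -/
theorem eq_or_step_of_eqvGen {α : Type*} {R : α → α → Prop} {a b : α} (h : EqvGen R a b) :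
    a = b ∨ ((∃ w, R a w ∨ R w a) ∧ ∃ w, R b w ∨ R w b) := by
  induction h with
  | rel x y h => exact Or.inr ⟨⟨y, Or.inl h⟩, ⟨x, Or.inr h⟩⟩
  | refl => exact Or.inl rfl
  | symm x y _ ih => exact ih.imp Eq.symm And.symm
  | trans x y z _ _ ih1 ih2 =>
    rcases ih1 with rfl | ih1
    · exact ih2
    · rcases ih2 with rfl | ih2
      · exact Or.inr ih1
      · exact Or.inr ⟨ih1.1, ih2.2⟩

/-- If `u` and `v` lie in different components then the top row can be divided by an interval
that separates the two components and is compatible with all others. -/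
theorem IsLatticeRel.exists_top_interval (hE : IsLatticeRel E) {r : ℕ}
    (hr : ∀ z w, E z w → r ≤ z.1) {Top : Set ℕ} (hfin : Top.Finite) {u v : ℕ × ℕ}
    (huv : ¬ EqvGen E u v)
    (htr : ∀ z, (∃ w, E z w ∨ E w z) → (∃ c ∈ Top, ReflTransGen E (r, c) z) ∨ ReflTransGen E v z)
    (hu : ∃ c ∈ Top, ReflTransGen E (r, c) u) :
    ∃ S : ℕ → Prop, (∀ c ∈ Top, EqvGen E u (r, c) → S c) ∧
      (∀ c ∈ Top, EqvGen E v (r, c) → ¬ S c) ∧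
      (∀ c ∈ Top, ∀ c' ∈ Top, EqvGen E (r, c) (r, c') → (S c ↔ S c')) ∧
      ∃ lo hi, (∀ c, S c ↔ lo ≤ c ∧ c ≤ hi) ∨ (∀ c, S c ↔ ¬ (lo ≤ c ∧ c ≤ hi)) := by
  -- Only the component of `v` may contain vertices that the top row does not reach, so
  -- `noncrossing` is available for the components of all other top columns and of `u`.
  have hreach : ∀ z₀, ¬ EqvGen E z₀ v → (∃ c ∈ Top, ReflTransGen E (r, c) z₀) →
      ∀ z, EqvGen E z₀ z → ∃ c ∈ Top, ReflTransGen E (r, c) z := by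
    intro z₀ h0 h1 z hz
    rcases eq_or_step_of_eqvGen hz with rfl | ⟨-, h⟩
    · exact h1
    · rcases htr z h with h | h
      · exact h
      · exact absurd (hz.trans _ _ _ ((eqvGen_of_reflTransGen h).symm _ _)) h0
  have hA := hreach u huv hu
  set A : Set ℕ := {c | c ∈ Top ∧ EqvGen E u (r, c)} with hAdef
  set B : Set ℕ := {c | c ∈ Top ∧ EqvGen E v (r, c)} with hBdef
  have hAB : ∀ c, EqvGen E u (r, c) → ¬ EqvGen E v (r, c) := fun c h1 h2 =>
    huv (h1.trans _ _ _ (h2.symm _ _))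
  have hAfin : A.Finite := hfin.subset fun c h => h.1
  have hBfin : B.Finite := hfin.subset fun c h => h.1
  obtain ⟨a0, ha0, ha0'⟩ := hu
  have hAne : A.Nonempty := ⟨a0, ha0, (eqvGen_of_reflTransGen ha0').symm _ _⟩
  obtain ⟨α, hα, hαmin⟩ := Set.exists_min_image A id hAfin hAne
  obtain ⟨α', hα', hαmax⟩ := Set.exists_max_image A id hAfin hAne
  simp only [id] at hαmin hαmax
  -- If `B` meets the hull of `A`, noncrossing keeps `A` out of the hull of `B`, and `S` is the
  -- complement of that hull. Otherwise the hull of `A` itself separates.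
  by_cases hcase : ∃ b ∈ B, α ≤ b ∧ b ≤ α'
  · obtain ⟨b0, hb0, hb1, hb2⟩ := hcase
    obtain ⟨β, hβ, hβmin⟩ := Set.exists_min_image B id hBfin ⟨b0, hb0⟩
    obtain ⟨β', hβ', hβmax⟩ := Set.exists_max_image B id hBfin ⟨b0, hb0⟩
    simp only [id] at hβmin hβmax
    have hbA : ∀ a ∈ A, ∀ b ∈ B, a ≠ b := by
      rintro a ha b hb rfl; exact hAB a ha.2 hb.2
    have hBB : ∀ b ∈ B, ∀ b' ∈ B, EqvGen E (r, b) (r, b') := fun b hb b' hb' =>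
      (hb.2.symm _ _).trans _ _ _ hb'.2
    refine ⟨fun c => ¬ (β ≤ c ∧ c ≤ β'), ?_, ?_, ?_, β, β', Or.inr fun c => Iff.rfl⟩
    · rintro c hc huc ⟨h1, h2⟩
      have hcA : c ∈ A := ⟨hc, huc⟩
      have e1 := hbA c hcA β hβ
      have e2 := hbA c hcA β' hβ'
      have e3 := hbA c hcA b0 hb0
      have e4 := hbA α hα b0 hb0
      have e5 := hbA α' hα' b0 hb0
      rcases lt_or_gt_of_ne e3 with h | h
      · exact hE.noncrossing hr hA (hBB β hβ b0 hb0) (fun h => hAB _ h hβ.2) huc hα'.2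
          (by omega) h (Or.inr (by omega))
      · exact hE.noncrossing hr hA (hBB b0 hb0 β' hβ') (fun h => hAB _ h hb0.2) huc hα.2
          h (by omega) (Or.inl (by omega))
    · exact fun c hc hvc h => h ⟨hβmin c ⟨hc, hvc⟩, hβmax c ⟨hc, hvc⟩⟩
    · have key : ∀ c ∈ Top, ∀ c' ∈ Top, EqvGen E (r, c) (r, c') → (β ≤ c ∧ c ≤ β') →
          (β ≤ c' ∧ c' ≤ β') := by
        rintro c hc c' hc' hcc ⟨h1, h2⟩
        by_cases hvc : EqvGen E v (r, c)
        · have : c' ∈ B := ⟨hc', hvc.trans _ _ _ hcc⟩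
          exact ⟨hβmin _ this, hβmax _ this⟩
        · by_contra hcon
          have hcv : ¬ EqvGen E (r, c) v := fun h => hvc (h.symm _ _)
          have n1 : c ≠ β := by rintro rfl; exact hvc hβ.2
          have n2 : c ≠ β' := by rintro rfl; exact hvc hβ'.2
          exact hE.noncrossing hr (hreach (r, c) hcv ⟨c, hc, .refl⟩) (hBB β hβ β' hβ')
            (fun h => hcv (h.trans _ _ _ (hβ.2.symm _ _))) (.refl _) hcc (by omega) (by omega)
            (by omega)
      exact fun c hc c' hc' hcc => not_congr ⟨key c hc c' hc' hcc, key c' hc' c hc (hcc.symm _ _)⟩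
  · refine ⟨fun c => α ≤ c ∧ c ≤ α', ?_, ?_, ?_, α, α', Or.inl fun c => Iff.rfl⟩
    · exact fun c hc huc => ⟨hαmin c ⟨hc, huc⟩, hαmax c ⟨hc, huc⟩⟩
    · exact fun c hc hvc h => hcase ⟨c, ⟨hc, hvc⟩, h⟩
    · have key : ∀ c ∈ Top, ∀ c' ∈ Top, EqvGen E (r, c) (r, c') → (α ≤ c ∧ c ≤ α') →
          (α ≤ c' ∧ c' ≤ α') := by
        rintro c hc c' hc' hcc ⟨h1, h2⟩
        by_cases huc : EqvGen E u (r, c)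
        · have : c' ∈ A := ⟨hc', huc.trans _ _ _ hcc⟩
          exact ⟨hαmin _ this, hαmax _ this⟩
        · by_contra hcon
          have n1 : c ≠ α := by rintro rfl; exact huc hα.2
          have n2 : c ≠ α' := by rintro rfl; exact huc hα'.2
          rcases lt_or_ge c' α with h | h
          · exact hE.noncrossing hr hA (hcc.symm _ _)
              (fun h => huc (h.trans _ _ _ (hcc.symm _ _))) hα.2 hα'.2
              h (by omega) (Or.inr (by omega))
          · exact hE.noncrossing hr hA hcc huc hα'.2 hα.2 (by omega) (by omega)
              (Or.inl (by omega))
      exact fun c hc c' hc' hcc => ⟨key c hc c' hc' hcc, key c' hc' c hc (hcc.symm _ _)⟩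

/-- The hull of a set of columns. -/
theorem exists_hull (T : ℕ) (X : ℕ → Prop) :
    ∃ p q, p ≤ q ∧ q ≤ T ∧ (∀ c, c < T → X c → p ≤ c ∧ c < q) ∧
      (∀ c, p ≤ c → c < q → ∃ x₁ x₂, X x₁ ∧ X x₂ ∧ x₁ ≤ c ∧ c ≤ x₂) ∧
      ((∀ c, ¬ X c) → p = q) := by
  classical
  by_cases h : ∃ c, c < T ∧ X c
  · obtain ⟨c, hc⟩ := h
    have hne : ((Finset.range T).filter X).Nonempty := ⟨c, by simpa using hc⟩
    obtain ⟨α, hα, hαmin⟩ := Finset.exists_min_image _ id hne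
    obtain ⟨β, hβ, hβmax⟩ := Finset.exists_max_image _ id hne
    simp only [Finset.mem_filter, Finset.mem_range, id] at *
    refine ⟨α, β + 1, ?_, by omega, fun c h1 h2 => ?_, fun c h1 h2 => ?_, fun h => ?_⟩
    · have := hαmin _ hβ; omega
    · have := hαmin _ ⟨h1, h2⟩
      have := hβmax _ ⟨h1, h2⟩
      omega
    · exact ⟨α, β, hα.2, hβ.2, h1, by omega⟩
    · exact absurd hc.2 (h c)
  · push Not at h
    exact ⟨0, 0, le_rfl, Nat.zero_le _, fun c h1 h2 => absurd h2 (h c h1),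
      fun c _ h2 => absurd h2 (by omega), fun _ => rfl⟩

open Classical in
theorem sum_Ico_eq_sum_range_ite (T : ℕ) (b : ℕ → ℝ) {p q : ℕ} (hq : q ≤ T) :
    ∑ c ∈ Finset.Ico p q, b c = ∑ c ∈ Finset.range T, if p ≤ c ∧ c < q then b c else 0 := by
  rw [← Finset.sum_filter]
  congr 1
  ext c
  simp only [Finset.mem_Ico, Finset.mem_filter, Finset.mem_range]
  omega

open Classical in
/-- Supply of the part `X` of a row in which `X` is not separated by `Y`, and `Z` is not separated
by either. -/
theorem row_sum_of_convex (T : ℕ) (b : ℕ → ℝ) (X Y Z : ℕ → Prop) (hXY : ∀ c, X c → ¬ Y c)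
    (hXZ : ∀ c, X c → ¬ Z c) (hYZ : ∀ c, Y c → ¬ Z c)
    (h0 : ∀ c, b c ≠ 0 → X c ∨ Y c ∨ Z c)
    (hZ : ∀ z₁ c z₂, Z z₁ → Z z₂ → z₁ < c → c < z₂ → ¬ X c ∧ ¬ Y c)
    (hX : ∀ x₁ c x₂, X x₁ → X x₂ → x₁ < c → c < x₂ → ¬ Y c) :
    ∃ p q p' q', p ≤ q ∧ q ≤ T ∧ p' ≤ q' ∧ q' ≤ T ∧ ((∀ c, ¬ Z c) → p' = q') ∧
      (∑ c ∈ Finset.range T, if X c then b c else 0) =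
        ∑ c ∈ Finset.Ico p q, b c - ∑ c ∈ Finset.Ico p' q', b c := by
  obtain ⟨p, q, h1, h2, h3, h4, -⟩ := exists_hull T X
  -- The hull of `X` contains no supply of `Y` but may contain some of `Z`; the hull of that part of
  -- `Z` is subtracted.
  obtain ⟨p', q', h1', h2', h3', h4', h5'⟩ := exists_hull T fun c => Z c ∧ p ≤ c ∧ c < q
  refine ⟨p, q, p', q', h1, h2, h1', h2', fun h => h5' fun c hc => h c hc.1, ?_⟩
  rw [sum_Ico_eq_sum_range_ite T b h2, sum_Ico_eq_sum_range_ite T b h2',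
    ← Finset.sum_sub_distrib]
  refine Finset.sum_congr rfl fun c hc => ?_
  have hcT : c < T := Finset.mem_range.1 hc
  by_cases hb : b c = 0
  · simp [hb]
  have hnJ : X c ∨ Y c → ¬ (p' ≤ c ∧ c < q') := by
    rintro hxy ⟨e1, e2⟩
    obtain ⟨z₁, z₂, hz₁, hz₂, e3, e4⟩ := h4' c e1 e2
    have n1 : z₁ ≠ c := by
      rintro rfl; exact hxy.elim (fun h => hXZ _ h hz₁.1) fun h => hYZ _ h hz₁.1
    have n2 : c ≠ z₂ := by
      rintro rfl; exact hxy.elim (fun h => hXZ _ h hz₂.1) fun h => hYZ _ h hz₂.1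
    have := hZ z₁ c z₂ hz₁.1 hz₂.1 (by omega) (by omega)
    tauto
  rcases h0 c hb with h | h | h
  · rw [if_pos h, if_pos (h3 c hcT h), if_neg (hnJ (Or.inl h)), sub_zero]
  · have hx : ¬ X c := fun hx => hXY c hx h
    have hI : ¬ (p ≤ c ∧ c < q) := by
      rintro ⟨e1, e2⟩
      obtain ⟨x₁, x₂, hx₁, hx₂, e3, e4⟩ := h4 c e1 e2
      have n1 : x₁ ≠ c := by rintro rfl; exact hx hx₁
      have n2 : c ≠ x₂ := by rintro rfl; exact hx hx₂
      exact hX x₁ c x₂ hx₁ hx₂ (by omega) (by omega) h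
    rw [if_neg hx, if_neg hI, if_neg (hnJ (Or.inr h)), sub_zero]
  · have hx : ¬ X c := fun hx => hXZ c hx h
    by_cases hI : p ≤ c ∧ c < q
    · rw [if_neg hx, if_pos hI, if_pos (h3' c hcT ⟨h, hI⟩), sub_self]
    · have hJ : ¬ (p' ≤ c ∧ c < q') := by
        rintro ⟨e1, e2⟩
        obtain ⟨z₁, z₂, hz₁, hz₂, e3, e4⟩ := h4' c e1 e2
        omega
      rw [if_neg hx, if_neg hI, if_neg hJ, sub_zero]

open Classical in
/-- Supply of the part `X` of a row in which `Y` is not separated by `X`, and `Z` is not separated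
by either. -/
theorem row_sum_of_convex_compl (T : ℕ) (b : ℕ → ℝ) (X Y Z : ℕ → Prop) (hXY : ∀ c, X c → ¬ Y c)
    (hXZ : ∀ c, X c → ¬ Z c) (hYZ : ∀ c, Y c → ¬ Z c)
    (h0 : ∀ c, b c ≠ 0 → X c ∨ Y c ∨ Z c)
    (hZ : ∀ z₁ c z₂, Z z₁ → Z z₂ → z₁ < c → c < z₂ → ¬ X c ∧ ¬ Y c)
    (hY : ∀ y₁ c y₂, Y y₁ → Y y₂ → y₁ < c → c < y₂ → ¬ X c) :
    ∃ p q p' q', p ≤ q ∧ q ≤ T ∧ p' ≤ q' ∧ q' ≤ T ∧ ((∀ c, ¬ Z c) → p' = q') ∧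
      (∑ c ∈ Finset.range T, if X c then b c else 0) =
        ∑ c ∈ Finset.range T, b c - ∑ c ∈ Finset.Ico p q, b c - ∑ c ∈ Finset.Ico p' q', b c := by
  obtain ⟨p, q, h1, h2, h3, h4, -⟩ := exists_hull T Y
  -- Dually, the hull of `Y` is removed from the whole row, and then the hull of the part of `Z`
  -- outside it.
  obtain ⟨p', q', h1', h2', h3', h4', h5'⟩ := exists_hull T fun c => Z c ∧ ¬ (p ≤ c ∧ c < q)
  refine ⟨p, q, p', q', h1, h2, h1', h2', fun h => h5' fun c hc => h c hc.1, ?_⟩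
  rw [sum_Ico_eq_sum_range_ite T b h2, sum_Ico_eq_sum_range_ite T b h2',
    ← Finset.sum_sub_distrib, ← Finset.sum_sub_distrib]
  refine Finset.sum_congr rfl fun c hc => ?_
  have hcT : c < T := Finset.mem_range.1 hc
  by_cases hb : b c = 0
  · simp [hb]
  have hnJ : X c ∨ Y c → ¬ (p' ≤ c ∧ c < q') := by
    rintro hxy ⟨e1, e2⟩
    obtain ⟨z₁, z₂, hz₁, hz₂, e3, e4⟩ := h4' c e1 e2
    have n1 : z₁ ≠ c := by
      rintro rfl; exact hxy.elim (fun h => hXZ _ h hz₁.1) fun h => hYZ _ h hz₁.1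
    have n2 : c ≠ z₂ := by
      rintro rfl; exact hxy.elim (fun h => hXZ _ h hz₂.1) fun h => hYZ _ h hz₂.1
    have := hZ z₁ c z₂ hz₁.1 hz₂.1 (by omega) (by omega)
    tauto
  rcases h0 c hb with h | h | h
  · have hI : ¬ (p ≤ c ∧ c < q) := by
      rintro ⟨e1, e2⟩
      obtain ⟨y₁, y₂, hy₁, hy₂, e3, e4⟩ := h4 c e1 e2
      have n1 : y₁ ≠ c := by rintro rfl; exact hXY _ h hy₁
      have n2 : c ≠ y₂ := by rintro rfl; exact hXY _ h hy₂
      exact hY y₁ c y₂ hy₁ hy₂ (by omega) (by omega) h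
    rw [if_pos h, if_neg hI, if_neg (hnJ (Or.inl h))]; ring
  · have hx : ¬ X c := fun hx => hXY c hx h
    rw [if_neg hx, if_pos (h3 c hcT h), if_neg (hnJ (Or.inr h))]; ring
  · have hx : ¬ X c := fun hx => hXZ c hx h
    by_cases hI : p ≤ c ∧ c < q
    -- Otherwise two columns of `Z` on either side of the hull of `Y` would have a column of `Y`
    -- between them.
    · have hJ : ¬ (p' ≤ c ∧ c < q') := by
        rintro ⟨e1, e2⟩
        obtain ⟨z₁, z₂, ⟨hz₁, hz₁'⟩, ⟨hz₂, hz₂'⟩, e3, e4⟩ := h4' c e1 e2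
        obtain ⟨y₁, y₂, hy₁, hy₂, e5, e6⟩ := h4 c hI.1 hI.2
        have n1 : y₁ ≠ c := by rintro rfl; exact hYZ _ hy₁ h
        have hy := h3 y₁ (by omega) hy₁
        exact (hZ z₁ y₁ z₂ hz₁ hz₂ (by omega) (by omega)).2 hy₁
      rw [if_neg hx, if_pos hI, if_neg hJ]; ring
    · rw [if_neg hx, if_neg hI, if_pos (h3' c hcT ⟨h, hI⟩)]; ring

open Classical in
/-- If `u` and `v` lie in different components then there is a union of components that contains
`u` but not `v`, and whose supply in each row is given by two intervals. -/
theorem IsLatticeRel.exists_cut (hE : IsLatticeRel E) {r T : ℕ}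
    (hr : ∀ z w, E z w → r ≤ z.1) {Top : Set ℕ} (hfin : Top.Finite) {u v : ℕ × ℕ} (hrv : r ≤ v.1)
    (huv : ¬ EqvGen E u v)
    (htr : ∀ z, (∃ w, E z w ∨ E w z) → (∃ c ∈ Top, ReflTransGen E (r, c) z) ∨ ReflTransGen E v z)
    (hu : ∃ c ∈ Top, ReflTransGen E (r, c) u) (b : ℕ → ℕ → ℝ)
    (hb : ∀ k c, b k c ≠ 0 →
      (∃ c' ∈ Top, ReflTransGen E (r, c') (k, c)) ∨ ReflTransGen E v (k, c)) :
    ∃ X : ℕ × ℕ → Prop, (∀ z w, E z w → (X z ↔ X w)) ∧ X u ∧ ¬ X v ∧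
      ∀ k, ∃ p q p' q', p ≤ q ∧ q ≤ T ∧ p' ≤ q' ∧ q' ≤ T ∧ (k < v.1 → p' = q') ∧
        ((∑ c ∈ Finset.range T, if X (k, c) then b k c else 0) =
          ∑ c ∈ Finset.Ico p q, b k c - ∑ c ∈ Finset.Ico p' q', b k c ∨
        (∑ c ∈ Finset.range T, if X (k, c) then b k c else 0) =
          ∑ c ∈ Finset.range T, b k c - ∑ c ∈ Finset.Ico p q, b k c -
            ∑ c ∈ Finset.Ico p' q', b k c) := by
  obtain ⟨S, hSu, hSv, hScl, lo, hi, hSint⟩ := hE.exists_top_interval hr hfin huv htr hu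
  -- `X` is what the chosen top columns reach, `Y` what the other top columns reach, and `Z` what
  -- only `v` reaches. The three are disjoint and cover all points with a step or a supply.
  set X : ℕ × ℕ → Prop := fun z => ∃ c ∈ Top, S c ∧ ReflTransGen E (r, c) z with hXdef
  set Y : ℕ × ℕ → Prop := fun z => ∃ c ∈ Top, ¬ S c ∧ ReflTransGen E (r, c) z with hYdef
  set Z : ℕ × ℕ → Prop := fun z =>
    ReflTransGen E v z ∧ ∀ c ∈ Top, ¬ ReflTransGen E (r, c) z with hZdef
  have hcommon : ∀ c ∈ Top, ∀ c' ∈ Top, ∀ z, ReflTransGen E (r, c) z → ReflTransGen E (r, c') z →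
      (S c ↔ S c') := fun c hc c' hc' z h h' => hScl c hc c' hc'
    ((eqvGen_of_reflTransGen h).trans _ _ _ ((eqvGen_of_reflTransGen h').symm _ _))
  have hXY : ∀ z, X z → ¬ Y z := by
    rintro z ⟨c, hc, hs, hz⟩ ⟨c', hc', hs', hz'⟩
    exact hs' ((hcommon c hc c' hc' z hz hz').1 hs)
  have hXZ : ∀ z, X z → ¬ Z z := by
    rintro z ⟨c, hc, hs, hz⟩ ⟨-, h⟩; exact h c hc hz
  have hYZ : ∀ z, Y z → ¬ Z z := by
    rintro z ⟨c, hc, hs, hz⟩ ⟨-, h⟩; exact h c hc hz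
  have hcover : ∀ z, ((∃ c ∈ Top, ReflTransGen E (r, c) z) ∨ ReflTransGen E v z) →
      X z ∨ Y z ∨ Z z := by
    intro z hz
    by_cases h : ∃ c ∈ Top, ReflTransGen E (r, c) z
    · obtain ⟨c, hc, hcz⟩ := h
      by_cases hs : S c
      · exact Or.inl ⟨c, hc, hs, hcz⟩
      · exact Or.inr (Or.inl ⟨c, hc, hs, hcz⟩)
    · refine Or.inr (Or.inr ⟨hz.resolve_left h, fun c hc hcz => h ⟨c, hc, hcz⟩⟩)
  -- With `P` an interval of top columns and `Q` outside it, disjoint paths keep their order, so in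
  -- row `k` nothing reached from `Q` separates two points reached from `P`. This is used for `S` or
  -- for its complement, whichever is an interval.
  have hord : ∀ (P Q : ℕ → Prop) (k : ℕ), (∀ c, P c ↔ lo ≤ c ∧ c ≤ hi) → (∀ c, Q c → ¬ P c) →
      (∀ c ∈ Top, ∀ c' ∈ Top, P c → Q c' → ∀ z, ReflTransGen E (r, c) z →
        ¬ ReflTransGen E (r, c') z) →
      ∀ x₁ y x₂, (∃ c ∈ Top, P c ∧ ReflTransGen E (r, c) (k, x₁)) →
        (∃ c ∈ Top, P c ∧ ReflTransGen E (r, c) (k, x₂)) → x₁ < y → y < x₂ →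
        ¬ ∃ c ∈ Top, Q c ∧ ReflTransGen E (r, c) (k, y) := by
    rintro P Q k hP hQ hdis x₁ y x₂ ⟨c₁, hc₁, hp₁, h₁⟩ ⟨c₂, hc₂, hp₂, h₂⟩ hxy hyx ⟨c, hc, hq, h⟩
    have e1 := (hP c₁).1 hp₁
    have e2 := (hP c₂).1 hp₂
    have e3 : ¬ (lo ≤ c ∧ c ≤ hi) := fun h => hQ c hq ((hP c).2 h)
    rcases lt_or_ge c lo with hl | hl
    · have := hE.order_of_disjoint (show c < c₁ by omega) h h₁
        fun z hz hz' => hdis c₁ hc₁ c hc hp₁ hq z hz' hz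
      omega
    · have := hE.order_of_disjoint (show c₂ < c by omega) h₂ h
        fun z hz hz' => hdis c₂ hc₂ c hc hp₂ hq z hz hz'
      omega
  have hZbetween : ∀ k z₁ c z₂, Z (k, z₁) → Z (k, z₂) → z₁ < c → c < z₂ →
      ∀ c' ∈ Top, ¬ ReflTransGen E (r, c') (k, c) := fun k z₁ c z₂ h1 h2 h3 h4 c' hc' h =>
    hE.not_between hrv h h1.1 h2.1 (h1.2 c' hc') (h2.2 c' hc') ⟨h3, h4⟩
  -- This spares the second interval in the rows above `v`.
  have hZrow : ∀ k, k < v.1 → ∀ c, ¬ Z (k, c) := by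
    rintro k hk c ⟨h, -⟩
    have := hE.row_le h
    simp only at this
    omega
  refine ⟨X, ?_, ?_, ?_, fun k => ?_⟩
  · intro z w hzw
    refine ⟨fun ⟨c, hc, hs, h⟩ => ⟨c, hc, hs, h.tail hzw⟩, fun ⟨c, hc, hs, h⟩ => ?_⟩
    rcases htr z ⟨w, Or.inl hzw⟩ with ⟨c', hc', h'⟩ | h'
    · exact ⟨c', hc', (hcommon c hc c' hc' w h (h'.tail hzw)).1 hs, h'⟩
    · exact absurd hs (hSv c hc ((eqvGen_of_reflTransGen (h'.tail hzw)).trans _ _ _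
        ((eqvGen_of_reflTransGen h).symm _ _)))
  · obtain ⟨c, hc, h⟩ := hu
    exact ⟨c, hc, hSu c hc ((eqvGen_of_reflTransGen h).symm _ _), h⟩
  · rintro ⟨c, hc, hs, h⟩
    exact hSv c hc ((eqvGen_of_reflTransGen h).symm _ _) hs
  · have hZ' : ∀ z₁ c z₂, Z (k, z₁) → Z (k, z₂) → z₁ < c → c < z₂ → ¬ X (k, c) ∧ ¬ Y (k, c) :=
      fun z₁ c z₂ h1 h2 h3 h4 =>
        ⟨fun ⟨c', hc', _, h⟩ => hZbetween k z₁ c z₂ h1 h2 h3 h4 c' hc' h,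
          fun ⟨c', hc', _, h⟩ => hZbetween k z₁ c z₂ h1 h2 h3 h4 c' hc' h⟩
    rcases hSint with hS | hS
    · obtain ⟨p, q, p', q', h1, h2, h3, h4, h5, h6⟩ := row_sum_of_convex T (b k)
        (fun c => X (k, c)) (fun c => Y (k, c)) (fun c => Z (k, c)) (fun c => hXY _)
        (fun c => hXZ _) (fun c => hYZ _) (fun c h => hcover _ (hb k c h)) hZ'
        (fun x₁ c x₂ a1 a2 a3 a4 => hord S (fun c => ¬ S c) k hS (fun _ h => h)
          (fun c hc c' hc' hs hs' z hz hz' => hs' ((hcommon c hc c' hc' z hz hz').1 hs))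
          x₁ c x₂ a1 a2 a3 a4)
      exact ⟨p, q, p', q', h1, h2, h3, h4, fun h => h5 (hZrow k h), Or.inl h6⟩
    · obtain ⟨p, q, p', q', h1, h2, h3, h4, h5, h6⟩ := row_sum_of_convex_compl T (b k)
        (fun c => X (k, c)) (fun c => Y (k, c)) (fun c => Z (k, c)) (fun c => hXY _)
        (fun c => hXZ _) (fun c => hYZ _) (fun c h => hcover _ (hb k c h)) hZ'
        (fun x₁ c x₂ a1 a2 a3 a4 => hord (fun c => ¬ S c) S k
          (fun c => by rw [hS c, not_not]) (fun _ h h' => h' h)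
          (fun c hc c' hc' hs hs' z hz hz' => hs ((hcommon c hc c' hc' z hz hz').2 hs'))
          x₁ c x₂ a1 a2 a3 a4)
      exact ⟨p, q, p', q', h1, h2, h3, h4, fun h => h5 (hZrow k h), Or.inr h6⟩

end Cut

/-! ## Flow values of forest flows in the grid -/

section GridFlow

open Relation

variable {L T : ℕ}

/-- The pair of row and column number of a vertex. -/
def GridVertex.pt (v : GridVertex L T) : ℕ × ℕ := ((v.1 : ℕ), (v.2 : ℕ))

theorem GridVertex.pt_injective : Function.Injective (GridVertex.pt (L := L) (T := T)) := by
  rintro ⟨a, b⟩ ⟨c, d⟩ h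
  simp only [GridVertex.pt, Prod.mk.injEq, Fin.val_inj] at h
  exact Prod.ext h.1 h.2

/-- The supplies, indexed by natural numbers and extended by `0`. -/
def UMFG.supply (I : UMFG L T) (l t : ℕ) : ℝ :=
  if h : l < L ∧ t < T then (I.b (⟨l, h.1⟩, ⟨t, h.2⟩) : ℝ) else 0

theorem UMFG.supply_pt (I : UMFG L T) (v : GridVertex L T) :
    I.supply v.1 v.2 = (I.b v : ℝ) := by
  simp [UMFG.supply]

/-- The flow `x` is positive on an arc other than `a` that joins the two points. -/
def ptStep (x : GridArc L T → ℝ) (P : GridArc L T → Prop) (z w : ℕ × ℕ) : Prop :=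
  ∃ e : GridArc L T, P e ∧ 0 < x e ∧ GridVertex.pt e.1.1 = z ∧ GridVertex.pt e.1.2 = w

theorem isLatticeRel_ptStep (x : GridArc L T → ℝ) (P : GridArc L T → Prop) :
    IsLatticeRel (ptStep x P) := by
  rintro z w ⟨⟨⟨⟨a, b⟩, c, d⟩, h⟩, -, -, rfl, rfl⟩
  rcases h with ⟨h1, h2⟩ | ⟨h1, h2⟩
  · left; simp only at h1 h2; subst h2; simp [GridVertex.pt, h1]
  · right; simp only at h1 h2; subst h1; simp [GridVertex.pt, h2]

/-- Carries the bridge property from grid vertices over to points of `ℕ × ℕ`, where the path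
geometry takes place. The case `z = w` absorbs points outside the grid. -/
theorem eqvGen_of_eqvGen_ptStep (x : GridArc L T → ℝ) (a : GridArc L T) {z w : ℕ × ℕ}
    (h : EqvGen (ptStep x (· ≠ a)) z w) :
    z = w ∨ ∃ u v : GridVertex L T, u.pt = z ∧ v.pt = w ∧
      EqvGen (SupportStep (fun e : GridArc L T => e.1.1) (fun e => e.1.2) x a) u v := by
  induction h with
  | rel z w h =>
    obtain ⟨e, h1, h2, h3, h4⟩ := h
    exact Or.inr ⟨_, _, h3, h4, .rel _ _ ⟨e, h1, h2, rfl, rfl⟩⟩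
  | refl => exact Or.inl rfl
  | symm _ _ _ ih =>
    exact ih.imp Eq.symm fun ⟨u, v, h1, h2, h3⟩ => ⟨v, u, h2, h1, h3.symm _ _⟩
  | trans z y w _ _ ih1 ih2 =>
    rcases ih1 with rfl | ⟨u, v, h1, h2, h3⟩
    · exact ih2
    · rcases ih2 with rfl | ⟨u', v', h1', h2', h3'⟩
      · exact Or.inr ⟨u, v, h1, h2, h3⟩
      · obtain rfl : v = u' := GridVertex.pt_injective (h2.trans h1'.symm)
        exact Or.inr ⟨u, v', h1, h2', h3.trans _ _ _ h3'⟩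

/-- In a feasible flow every vertex with flow or supply is reached from a source. -/
theorem UMFG.IsFeasibleFlow.exists_source {I : UMFG L T} {x : GridArc L T → ℝ}
    (hx : I.IsFeasibleFlow x) {r : Fin L} (hr : ∀ v : GridVertex L T, 0 < I.b v → v.1 = r)
    (v : GridVertex L T)
    (hv : (∃ e : GridArc L T, 0 < x e ∧ (e.1.1 = v ∨ e.1.2 = v)) ∨ I.b v ≠ 0) :
    ∃ c ∈ {c : ℕ | ∃ h : c < T, 0 < I.b (r, ⟨c, h⟩)},
      ReflTransGen (ptStep x fun _ => True) ((r : ℕ), c) v.pt := by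
  -- The flow is traced backwards; each arc raises row plus column by one, and a vertex with flow or
  -- supply but without inflow must be a source.
  induction hn : (v.1 : ℕ) + (v.2 : ℕ) using Nat.strong_induction_on generalizing v with
  | _ n ih =>
    by_cases hin : ∃ e : GridArc L T, 0 < x e ∧ e.1.2 = v
    · obtain ⟨e, he, rfl⟩ := hin
      have hlt : (e.1.1.1 : ℕ) + (e.1.1.2 : ℕ) < n := by
        rcases e.2 with ⟨h1, h2⟩ | ⟨h1, h2⟩
        · rw [h2] at hn; omega
        · rw [h1] at hn; omega
      obtain ⟨c, hc, h⟩ := ih _ hlt e.1.1 (Or.inl ⟨e, he, Or.inl rfl⟩) rfl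
      exact ⟨c, hc, h.tail ⟨e, trivial, he, rfl, rfl⟩⟩
    · push Not at hin
      have hcons := hx.1 v
      have h0 : ∑ a : GridArc L T with a.1.2 = v, x a = 0 := by
        refine Finset.sum_eq_zero fun e he => ?_
        simp only [Finset.mem_filter, Finset.mem_univ, true_and] at he
        by_contra hne
        exact hin e (lt_of_le_of_ne (hx.2 e) (Ne.symm hne)) he
      rw [h0, sub_zero] at hcons
      rcases lt_or_ge 0 (I.b v) with hb | hb
      · have hvr := hr v hb
        refine ⟨v.2, ⟨v.2.2, ?_⟩, ?_⟩
        · rw [← hvr]; exact hb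
        · rw [← hvr]; exact .refl
      · have hb' : (I.b v : ℝ) ≤ 0 := by exact_mod_cast hb
        have hs : 0 ≤ ∑ a : GridArc L T with a.1.1 = v, x a :=
          Finset.sum_nonneg fun e _ => hx.2 e
        have hs0 : ∑ a : GridArc L T with a.1.1 = v, x a = 0 := by linarith
        have hb0 : I.b v = 0 := by
          have : (I.b v : ℝ) = 0 := by linarith
          exact_mod_cast this
        rcases hv with ⟨e, he, h | h⟩ | h
        · have := (Finset.sum_eq_zero_iff_of_nonneg fun e _ => hx.2 e).1 hs0 e (by simp [h])
          linarith
        · exact absurd h (hin e he)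
        · exact absurd hb0 h

/-- The value of a forest flow on a forward arc is determined by two intervals in each row. -/
theorem UMFG.IsFeasibleFlow.forward_value {I : UMFG L T} {x : GridArc L T → ℝ}
    (hx : I.IsFeasibleFlow x) {r : Fin L} (hr : ∀ v : GridVertex L T, 0 < I.b v → v.1 = r)
    {l t : ℕ} (hl : l < L) (ht : t + 1 < T) (ha : 0 < x (GridArc.forward l t hl ht))
    (hbridge : ¬ EqvGen (SupportStep (fun e : GridArc L T => e.1.1) (fun e => e.1.2) x
      (GridArc.forward l t hl ht)) (GridArc.forward l t hl ht).1.1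
      (GridArc.forward l t hl ht).1.2) :
    ∃ w : ℕ → ℝ, x (GridArc.forward l t hl ht) = ∑ k ∈ Finset.range L, w k ∧
      ∀ k, ∃ p q p' q', p ≤ q ∧ q ≤ T ∧ p' ≤ q' ∧ q' ≤ T ∧ (k < l → p' = q') ∧
        (w k = ∑ c ∈ Finset.Ico p q, I.supply k c - ∑ c ∈ Finset.Ico p' q', I.supply k c ∨
        w k = ∑ c ∈ Finset.range T, I.supply k c - ∑ c ∈ Finset.Ico p q, I.supply k c -
            ∑ c ∈ Finset.Ico p' q', I.supply k c) := by
  classical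
  set a := GridArc.forward l t hl ht with hadef
  set E := ptStep x (· ≠ a) with hEdef
  have hE : IsLatticeRel E := isLatticeRel_ptStep _ _
  set Top : Set ℕ := {c : ℕ | ∃ h : c < T, 0 < I.b (r, ⟨c, h⟩)} with hTop
  have hfin : Top.Finite := (Set.finite_lt_nat T).subset fun c hc => hc.1
  have hau : GridVertex.pt a.1.1 = (l, t) := rfl
  have hav : GridVertex.pt a.1.2 = (l, t + 1) := rfl
  -- A path from a source either avoids `a`, or what follows its last use of `a` is a path from the
  -- head of `a`.
  have hsplit : ∀ c z, ReflTransGen (ptStep x fun _ => True) ((r : ℕ), c) z →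
      ReflTransGen E ((r : ℕ), c) z ∨ ReflTransGen E (l, t + 1) z := by
    intro c z h
    induction h with
    | refl => exact Or.inl .refl
    | tail _ h ih =>
      obtain ⟨e, -, he, h1, h2⟩ := h
      by_cases hea : e = a
      · right; rw [← h2, hea, hav]
      · have : E _ _ := ⟨e, hea, he, h1, h2⟩
        exact ih.imp (fun h => h.tail this) fun h => h.tail this
  have htrace : ∀ v : GridVertex L T,
      ((∃ e : GridArc L T, 0 < x e ∧ (e.1.1 = v ∨ e.1.2 = v)) ∨ I.b v ≠ 0) →
      (∃ c ∈ Top, ReflTransGen E ((r : ℕ), c) v.pt) ∨ ReflTransGen E (l, t + 1) v.pt := by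
    intro v hv
    obtain ⟨c, hc, h⟩ := hx.exists_source hr v hv
    exact (hsplit c _ h).imp (fun h => ⟨c, hc, h⟩) id
  have hrow : ∀ e : GridArc L T, 0 < x e → (r : ℕ) ≤ e.1.1.1 := by
    intro e he
    obtain ⟨c, hc, h⟩ := hx.exists_source hr e.1.1 (Or.inl ⟨e, he, Or.inl rfl⟩)
    exact (isLatticeRel_ptStep x fun _ => True).row_le h
  -- The head lies one column after the tail and cannot reach it, so the tail is reached from a
  -- source without `a`.
  have hu : ∃ c ∈ Top, ReflTransGen E ((r : ℕ), c) (l, t) := by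
    refine (htrace a.1.1 (Or.inl ⟨a, ha, Or.inl rfl⟩)).resolve_right fun h => ?_
    have := hE.col_le h
    rw [hau] at this
    simp only at this
    omega
  have huv : ¬ EqvGen E (l, t) (l, t + 1) := by
    intro h
    rcases eqvGen_of_eqvGen_ptStep x a h with h | ⟨u, v, h1, h2, h3⟩
    · simp at h
    · obtain rfl : u = a.1.1 := GridVertex.pt_injective (h1.trans hau.symm)
      obtain rfl : v = a.1.2 := GridVertex.pt_injective (h2.trans hav.symm)
      exact hbridge h3
  obtain ⟨X, hX, hXu, hXv, hrows⟩ := hE.exists_cut (T := T) (r := r)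
    (by rintro z w ⟨e, -, he, rfl, rfl⟩; exact hrow e he) hfin (u := (l, t)) (v := (l, t + 1))
    (hrow a ha) huv
    (by
      rintro z ⟨w, ⟨e, -, he, rfl, rfl⟩ | ⟨e, -, he, rfl, rfl⟩⟩
      · exact htrace _ (Or.inl ⟨e, he, Or.inl rfl⟩)
      · exact htrace _ (Or.inl ⟨e, he, Or.inr rfl⟩))
    hu I.supply
    (by
      intro k c hkc
      by_cases h : k < L ∧ c < T
      · refine htrace (⟨k, h.1⟩, ⟨c, h.2⟩) (Or.inr fun h0 => hkc ?_)
        simp [UMFG.supply, h, h0]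
      · exact absurd (by simp [UMFG.supply, h]) hkc)
  refine ⟨fun k => ∑ c ∈ Finset.range T, if X (k, c) then I.supply k c else 0, ?_, hrows⟩
  -- Summing the net outflow over `X` leaves the arcs that cross its boundary, and `a` is the only
  -- one of them with flow.
  have h1 := sum_mul_netOut (fun e : GridArc L T => e.1.1) (fun e => e.1.2) x
    fun v => if X v.pt then 1 else 0
  have h2 : ∑ e : GridArc L T, x e * ((if X (GridVertex.pt e.1.1) then 1 else 0) -
      if X (GridVertex.pt e.1.2) then 1 else 0) = x a := by
    rw [Finset.sum_eq_single a]
    · rw [hau, hav, if_pos hXu, if_neg hXv]; ring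
    · intro e _ hea
      rcases (hx.2 e).eq_or_lt with h | h
      · rw [← h, zero_mul]
      · have := hX _ _ ⟨e, hea, h, rfl, rfl⟩
        simp [this]
    · simp
  rw [h2] at h1
  rw [← h1, Fintype.sum_prod_type, Finset.sum_range]
  refine Finset.sum_congr rfl fun k _ => ?_
  rw [Finset.sum_range]
  refine Finset.sum_congr rfl fun c _ => ?_
  have h3 : netOut (fun e : GridArc L T => e.1.1) (fun e => e.1.2) x (k, c) = (I.b (k, c) : ℝ) :=
    hx.1 (k, c)
  rw [h3, ← I.supply_pt]
  by_cases h : X ((k : ℕ), (c : ℕ)) <;> simp [GridVertex.pt, h]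

end GridFlow

/-! ### Sums over arcs, feasibility and cost in terms of row and column numbers -/

section GridSums

variable {L T : ℕ}

/-- A function of the forward arcs, extended by `0`. -/
def atForward (f : GridArc L T → ℝ) (l t : ℕ) : ℝ :=
  if h : l < L ∧ t + 1 < T then f (GridArc.forward l t h.1 h.2) else 0

/-- A function of the downward arcs, extended by `0`. -/
def atDownward (f : GridArc L T → ℝ) (l t : ℕ) : ℝ :=
  if h : l + 1 < L ∧ t < T then f (GridArc.downward l t h.1 h.2) else 0

theorem GridArc.eq_forward_or_downward (e : GridArc L T) :
    (∃ l t hl ht, e = GridArc.forward l t hl ht) ∨ ∃ l t hl ht, e = GridArc.downward l t hl ht := by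
  obtain ⟨⟨⟨⟨a, ha⟩, ⟨b, hb⟩⟩, ⟨c, hc⟩, ⟨d, hd⟩⟩, h⟩ := e
  rcases h with ⟨h1, h2⟩ | ⟨h1, h2⟩
  · obtain rfl : c = a + 1 := h1
    obtain rfl : d = b := congrArg Fin.val h2
    exact Or.inr ⟨a, d, hc, hb, rfl⟩
  · obtain rfl : d = b + 1 := h2
    obtain rfl : c = a := congrArg Fin.val h1
    exact Or.inl ⟨c, b, ha, hd, rfl⟩

theorem GridArc.forward_ne_downward {l t l' t' : ℕ} (hl : l < L) (ht : t + 1 < T)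
    (hl' : l' + 1 < L) (ht' : t' < T) :
    GridArc.forward l t hl ht ≠ GridArc.downward l' t' hl' ht' := by
  intro h
  have h1 : l = l' := congrArg (fun e : GridArc L T => (e.1.1.1 : ℕ)) h
  have h2 : l = l' + 1 := congrArg (fun e : GridArc L T => (e.1.2.1 : ℕ)) h
  omega

/-- A sum over the arcs is a sum over their tails. -/
theorem sum_arcs (f : GridArc L T → ℝ) : ∑ e, f e =
    ∑ l ∈ Finset.range L, ∑ t ∈ Finset.range T, (atForward f l t + atDownward f l t) := by
  classical
  have hL : ∀ g : GridArc L T → ℝ, (∀ e, (∃ l t hl ht, e = GridArc.downward l t hl ht) → g e = 0) →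
      ∑ e, g e = ∑ l ∈ Finset.range L, ∑ t ∈ Finset.range T, atForward g l t := by
    intro g hg
    rw [← Finset.sum_product']
    refine (Finset.sum_bij_ne_zero (fun p hp hne => if h : p.1 < L ∧ p.2 + 1 < T then
      GridArc.forward p.1 p.2 h.1 h.2 else absurd (by simp [atForward, h]) hne) ?_ ?_ ?_ ?_).symm
    · intro _ _ _; exact Finset.mem_univ _
    · rintro ⟨l, t⟩ h1 h2 ⟨l', t'⟩ h1' h2' h
      have e1 : l < L ∧ t + 1 < T := by
        by_contra hc; exact h2 (by simp only [atForward, hc, dite_false])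
      have e2 : l' < L ∧ t' + 1 < T := by
        by_contra hc; exact h2' (by simp only [atForward, hc, dite_false])
      simp only [e1, e2, and_self, dite_true] at h
      exact Prod.ext (congrArg (fun e : GridArc L T => (e.1.1.1 : ℕ)) h)
        (congrArg (fun e : GridArc L T => (e.1.1.2 : ℕ)) h)
    · intro e _ hne
      rcases e.eq_forward_or_downward with ⟨l, t, hl, ht, rfl⟩ | h
      · refine ⟨(l, t), by simp; omega, ?_, ?_⟩
        · simp only [atForward, hl, ht, and_self, dite_true]; exact hne
        · simp [hl, ht]
      · exact absurd (hg e h) hne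
    · rintro ⟨l, t⟩ h1 h2
      have e1 : l < L ∧ t + 1 < T := by
        by_contra hc; exact h2 (by simp only [atForward, hc, dite_false])
      simp [e1, atForward]
  have hD : ∀ g : GridArc L T → ℝ, (∀ e, (∃ l t hl ht, e = GridArc.forward l t hl ht) → g e = 0) →
      ∑ e, g e = ∑ l ∈ Finset.range L, ∑ t ∈ Finset.range T, atDownward g l t := by
    intro g hg
    rw [← Finset.sum_product']
    refine (Finset.sum_bij_ne_zero (fun p hp hne => if h : p.1 + 1 < L ∧ p.2 < T then
      GridArc.downward p.1 p.2 h.1 h.2 else absurd (by simp [atDownward, h]) hne) ?_ ?_ ?_ ?_).symm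
    · intro _ _ _; exact Finset.mem_univ _
    · rintro ⟨l, t⟩ h1 h2 ⟨l', t'⟩ h1' h2' h
      have e1 : l + 1 < L ∧ t < T := by
        by_contra hc; exact h2 (by simp only [atDownward, hc, dite_false])
      have e2 : l' + 1 < L ∧ t' < T := by
        by_contra hc; exact h2' (by simp only [atDownward, hc, dite_false])
      simp only [e1, e2, and_self, dite_true] at h
      exact Prod.ext (congrArg (fun e : GridArc L T => (e.1.1.1 : ℕ)) h)
        (congrArg (fun e : GridArc L T => (e.1.1.2 : ℕ)) h)
    · intro e _ hne
      rcases e.eq_forward_or_downward with h | ⟨l, t, hl, ht, rfl⟩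
      · exact absurd (hg e h) hne
      · refine ⟨(l, t), by simp; omega, ?_, ?_⟩
        · simp only [atDownward, hl, ht, and_self, dite_true]; exact hne
        · simp [hl, ht]
    · rintro ⟨l, t⟩ h1 h2
      have e1 : l + 1 < L ∧ t < T := by
        by_contra hc; exact h2 (by simp only [atDownward, hc, dite_false])
      simp [e1, atDownward]
  set P : GridArc L T → Prop := fun e => ∃ l t hl ht, e = GridArc.forward l t hl ht with hP
  have h1 : ∀ e, f e = (if P e then f e else 0) + (if P e then 0 else f e) := by
    intro e; split_ifs <;> simp
  rw [Finset.sum_congr rfl fun e _ => h1 e, Finset.sum_add_distrib, hL, hD,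
    ← Finset.sum_add_distrib]
  · refine Finset.sum_congr rfl fun l _ => ?_
    rw [← Finset.sum_add_distrib]
    refine Finset.sum_congr rfl fun t _ => ?_
    congr 1
    · unfold atForward
      by_cases h : l < L ∧ t + 1 < T
      · rw [dif_pos h, dif_pos h]
        exact if_pos ⟨_, _, _, _, rfl⟩
      · rw [dif_neg h, dif_neg h]
    · unfold atDownward
      by_cases h : l + 1 < L ∧ t < T
      · rw [dif_pos h, dif_pos h]
        refine if_neg ?_
        rintro ⟨l', t', hl', ht', h'⟩
        exact GridArc.forward_ne_downward _ _ _ _ h'.symm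
      · rw [dif_neg h, dif_neg h]
  · intro e he; simp [hP, he]
  · rintro e ⟨l, t, hl, ht, rfl⟩
    refine if_neg ?_
    rintro ⟨l', t', hl', ht', h⟩
    exact GridArc.forward_ne_downward _ _ _ _ h.symm

theorem sum_tail_eq (x : GridArc L T → ℝ) {l t : ℕ} (hl : l < L) (ht : t < T) :
    ∑ e : GridArc L T with e.1.1 = (⟨l, hl⟩, ⟨t, ht⟩), x e = atForward x l t + atDownward x l t := by
  rw [Finset.sum_filter, sum_arcs, Finset.sum_eq_single l, Finset.sum_eq_single t]
  · simp [atForward, atDownward, GridArc.forward, GridArc.downward]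
  · intro t' _ h
    simp [atForward, atDownward, GridArc.forward, GridArc.downward, h]
  · simp [ht]
  · intro l' _ h
    refine Finset.sum_eq_zero fun t' _ => ?_
    simp [atForward, atDownward, GridArc.forward, GridArc.downward, h]
  · simp [hl]

theorem sum_head_eq (x : GridArc L T → ℝ) {l t : ℕ} (hl : l < L) (ht : t < T) :
    ∑ e : GridArc L T with e.1.2 = (⟨l, hl⟩, ⟨t, ht⟩), x e =
      (if t = 0 then 0 else atForward x l (t - 1)) +
        (if l = 0 then 0 else atDownward x (l - 1) t) := by
  rw [Finset.sum_filter, sum_arcs]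
  simp only [Finset.sum_add_distrib]
  congr 1
  · rw [Finset.sum_eq_single l]
    · rcases Nat.eq_zero_or_pos t with rfl | h0
      · simp [atForward, GridArc.forward]
      · rw [Finset.sum_eq_single (t - 1)]
        · have e1 : t - 1 + 1 = t := by omega
          have e2 : t ≠ 0 := by omega
          simp [atForward, GridArc.forward, e1, e2]
        · intro t' _ h
          have : t' + 1 ≠ t := by omega
          simp [atForward, GridArc.forward, this]
        · simp; omega
    · intro l' _ h
      refine Finset.sum_eq_zero fun t' _ => ?_
      simp [atForward, GridArc.forward, h]
    · simp [hl]
  · rw [Finset.sum_comm, Finset.sum_eq_single t]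
    · rcases Nat.eq_zero_or_pos l with rfl | h0
      · simp [atDownward, GridArc.downward]
      · rw [Finset.sum_eq_single (l - 1)]
        · have e1 : l - 1 + 1 = l := by omega
          have e2 : l ≠ 0 := by omega
          simp [atDownward, GridArc.downward, e1, e2]
        · intro t' _ h
          have : t' + 1 ≠ l := by omega
          simp [atDownward, GridArc.downward, this]
        · simp; omega
    · intro l' _ h
      refine Finset.sum_eq_zero fun t' _ => ?_
      simp [atDownward, GridArc.downward, h]
    · simp [ht]

theorem UMFG.isFeasibleFlow_iff (I : UMFG L T) (x : GridArc L T → ℝ) :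
    I.IsFeasibleFlow x ↔ (∀ l < L, ∀ t < T, atForward x l t + atDownward x l t -
      ((if t = 0 then 0 else atForward x l (t - 1)) +
        (if l = 0 then 0 else atDownward x (l - 1) t)) = I.supply l t) ∧
      ∀ l t, 0 ≤ atForward x l t ∧ 0 ≤ atDownward x l t := by
  unfold UMFG.IsFeasibleFlow
  refine and_congr ?_ ?_
  · constructor
    · intro h l hl t ht
      have := h (⟨l, hl⟩, ⟨t, ht⟩)
      rw [sum_tail_eq, sum_head_eq] at this
      rw [this]
      simp [UMFG.supply, hl, ht]
    · rintro h ⟨⟨l, hl⟩, ⟨t, ht⟩⟩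
      rw [sum_tail_eq, sum_head_eq, h l hl t ht]
      simp [UMFG.supply, hl, ht]
  · constructor
    · intro h l t
      unfold atForward atDownward
      constructor <;> split_ifs <;> first | exact h _ | exact le_rfl
    · intro h e
      rcases e.eq_forward_or_downward with ⟨l, t, hl, ht, rfl⟩ | ⟨l, t, hl, ht, rfl⟩
      · simpa [atForward, hl, ht] using (h l t).1
      · simpa [atDownward, hl, ht] using (h l t).2

/-- The oracle answers `0` where there is no arc, so the sum may run over the full rectangle. -/
theorem UMFG.totalCost_eq (I : UMFG L T) (x : GridArc L T → ℝ) :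
    I.totalCost x = ∑ l ∈ Finset.range L, ∑ t ∈ Finset.range T,
      (I.oracle .forward l t (atForward x l t) + I.oracle .downward l t (atDownward x l t)) := by
  unfold UMFG.totalCost
  rw [sum_arcs]
  refine Finset.sum_congr rfl fun l _ => Finset.sum_congr rfl fun t _ => ?_
  unfold atForward atDownward UMFG.oracle
  congr 1 <;> simp only <;> split_ifs <;> rfl

end GridSums

/-! ## The dynamic program

A state `s` encodes the flows on the forward arcs across a column cut, except for the flow in the top
row, which is determined by the others. -/

section Model

/-- Prefix sums. -/
def prefixSum (β : ℕ → ℝ) (i : ℕ) : ℝ := ∑ m ∈ Finset.range i, β m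

/-- Sum over the cyclic interval from `p` to `q` in row `k`, where `G` are the prefix sums; the
interval is empty for `p = q = 0` and the whole row for `p = q ≠ 0`. -/
noncomputable def cyclicSum (T : ℕ) (G : ℕ → ℝ) (k p q : ℕ) : ℝ :=
  G (k * T + q) - G (k * T + p) + if q ≤ p ∧ 1 ≤ p then G (k * T + T) - G (k * T) else 0

/-- Contribution of the `j`-th interval of a state. -/
noncomputable def contrib (L T : ℕ) (G : ℕ → ℝ) (j p q : ℕ) : ℝ :=
  if j < L then cyclicSum T G j p q else - cyclicSum T G (j - (L - 1)) p q

/-- Number of intervals for each row. -/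
def numIntervals (L T : ℕ) : ℕ := (2 * L - 1) * (1 - (2 - T))

/-- Number of states. -/
def numStates (L T : ℕ) : ℕ := (T * T) ^ ((L - 1) * numIntervals L T)

/-- Contribution to the flow in row `l` of the `j`-th interval of the state `s`. -/
noncomputable def entryTerm (L T : ℕ) (G : ℕ → ℝ) (s l j : ℕ) : ℝ :=
  contrib L T G j ((s / (T * T) ^ ((l - 1) * numIntervals L T + j)) % T)
    ((s / ((T * T) ^ ((l - 1) * numIntervals L T + j) * T)) % T)

/-- Flow of the state `s` in row `l ≥ 1`. -/
noncomputable def entry (L T : ℕ) (G : ℕ → ℝ) (s l : ℕ) : ℝ :=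
  ∑ j ∈ Finset.range (numIntervals L T), entryTerm L T G s l j

/-- Flow from above into row `l` of column `t`, if the flows across the cuts before and after this
column are those of the states `s` and `s'`. -/
noncomputable def vertFlow (L T : ℕ) (G : ℕ → ℝ) (X : ℕ → ℕ → ℝ) (t s s' l : ℕ) : ℝ :=
  ∑ k ∈ Finset.Ico l L, (X s' k - X s k - (G (k * T + t + 1) - G (k * T + t)))

/-- Flow in the top row of the state `s` across the cut after the first `t` columns. -/
noncomputable def topFlow (L T : ℕ) (G : ℕ → ℝ) (X : ℕ → ℕ → ℝ) (t s : ℕ) : ℝ :=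
  G t - ∑ k ∈ Finset.Ico 1 L, (X s k - (G (k * T + t) - G (k * T)))

/-- The flows in column `t` are nonnegative. -/
def StepOK (L T : ℕ) (G : ℕ → ℝ) (X : ℕ → ℕ → ℝ) (t s s' : ℕ) : Prop :=
  (∀ l, 1 ≤ l → l < L → 0 ≤ X s' l ∧ 0 ≤ vertFlow L T G X t s s' l) ∧
    0 ≤ topFlow L T G X (t + 1) s'

/-- Cost of the arcs with tail in column `t`. -/
noncomputable def stepCost (L T : ℕ) (G : ℕ → ℝ) (X : ℕ → ℕ → ℝ) (O : RealRAM.Oracle)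
    (t s s' : ℕ) : ℝ :=
  ∑ l ∈ Finset.Ico 1 L, (O .forward l t (X s' l) + O .downward (l - 1) t
    (vertFlow L T G X t s s' l)) + O .forward 0 t (topFlow L T G X (t + 1) s')

/-- Sequences of states that describe feasible flows. -/
structure IsStateChain (L T : ℕ) (G : ℕ → ℝ) (X : ℕ → ℕ → ℝ) (M : ℕ) (σ : ℕ → ℕ) : Prop where
  zero : σ 0 = 0
  last : σ T = 0
  lt : ∀ t, t ≤ T → σ t < M
  ok : ∀ t, t < T → StepOK L T G X t (σ t) (σ (t + 1))

theorem vertFlow_of_lt {L T : ℕ} (G : ℕ → ℝ) (X : ℕ → ℕ → ℝ) (t s s' : ℕ) {l : ℕ} (hl : l < L) :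
    vertFlow L T G X t s s' l = vertFlow L T G X t s s' (l + 1) +
      (X s' l - X s l - (G (l * T + t + 1) - G (l * T + t))) := by
  unfold vertFlow
  rw [Finset.sum_eq_sum_Ico_succ_bot hl, add_comm]

theorem vertFlow_last (L T : ℕ) (G : ℕ → ℝ) (X : ℕ → ℕ → ℝ) (t s s' : ℕ) :
    vertFlow L T G X t s s' L = 0 := by
  simp [vertFlow]

/-- Conservation in the top row. It holds identically, because the top flow is defined as the supply
so far minus the flow in the other rows. -/
theorem topFlow_succ (L T : ℕ) (G : ℕ → ℝ) (X : ℕ → ℕ → ℝ) (t s s' : ℕ) :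
    topFlow L T G X (t + 1) s' + vertFlow L T G X t s s' 1 - topFlow L T G X t s =
      G (t + 1) - G t := by
  unfold topFlow vertFlow
  have : (∑ k ∈ Finset.Ico 1 L, (X s' k - X s k -
      (G (k * T + t + 1) - G (k * T + t)))) =
      (∑ k ∈ Finset.Ico 1 L, (X s' k - (G (k * T + (t + 1)) - G (k * T)))) -
      ∑ k ∈ Finset.Ico 1 L, (X s k - (G (k * T + t) - G (k * T))) := by
    rw [← Finset.sum_sub_distrib]
    refine Finset.sum_congr rfl fun k _ => ?_
    rw [← add_assoc]; ring
  rw [this]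
  ring

/-- Forward flows of a chain of states. -/
noncomputable def chainForward (L T : ℕ) (G : ℕ → ℝ) (X : ℕ → ℕ → ℝ) (σ : ℕ → ℕ) (l t : ℕ) : ℝ :=
  if l = 0 then topFlow L T G X (t + 1) (σ (t + 1)) else X (σ (t + 1)) l

/-- Downward flows of a chain of states. -/
noncomputable def chainDownward (L T : ℕ) (G : ℕ → ℝ) (X : ℕ → ℕ → ℝ) (σ : ℕ → ℕ) (l t : ℕ) : ℝ :=
  vertFlow L T G X t (σ t) (σ (t + 1)) (l + 1)

/-- In the state `0` all intervals are empty. It thus describes the cuts before the first and after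
the last column. -/
theorem entry_zero (L T : ℕ) (G : ℕ → ℝ) (l : ℕ) : entry L T G 0 l = 0 := by
  refine Finset.sum_eq_zero fun j _ => ?_
  simp [entryTerm, contrib, cyclicSum]

theorem prefixSum_sub (β : ℕ → ℝ) (a : ℕ) {p q : ℕ} (h : p ≤ q) :
    prefixSum β (a + q) - prefixSum β (a + p) = ∑ c ∈ Finset.Ico p q, β (a + c) := by
  unfold prefixSum
  rw [← Finset.sum_Ico_eq_sub _ (by omega : a + p ≤ a + q), Finset.sum_Ico_add]
  simp only [add_comm]

/-- Both ends are kept below `T`, so that an interval costs exactly `T * T` choices: an end at `T`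
wraps around to `0`, and a proper nonempty interval is complemented by exchanging its ends. The
whole row is coded by the pair `1, 1`, which requires `2 ≤ T`. -/
theorem exists_cyclicSum {T : ℕ} (hT : 2 ≤ T) (β : ℕ → ℝ) (k : ℕ) {p q : ℕ} (hpq : p ≤ q)
    (hq : q ≤ T) :
    (∃ p₀ < T, ∃ q₀ < T, cyclicSum T (prefixSum β) k p₀ q₀ = ∑ c ∈ Finset.Ico p q, β (k * T + c)) ∧
    ∃ p₀ < T, ∃ q₀ < T, cyclicSum T (prefixSum β) k p₀ q₀ =
      ∑ c ∈ Finset.range T, β (k * T + c) - ∑ c ∈ Finset.Ico p q, β (k * T + c) := by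
  rw [← prefixSum_sub β (k * T) hpq]
  have hR : ∑ c ∈ Finset.range T, β (k * T + c) =
      prefixSum β (k * T + T) - prefixSum β (k * T) := by
    have := prefixSum_sub β (k * T) (Nat.zero_le T)
    rw [Finset.range_eq_Ico, ← this, add_zero]
  rw [hR]
  have hfull : cyclicSum T (prefixSum β) k 1 1 =
      prefixSum β (k * T + T) - prefixSum β (k * T) := by simp [cyclicSum]
  have hempty : cyclicSum T (prefixSum β) k 0 0 = 0 := by simp [cyclicSum]
  rcases hpq.eq_or_lt with rfl | hlt
  · refine ⟨⟨0, by omega, 0, by omega, by rw [hempty, sub_self]⟩, 1, by omega, 1, by omega, ?_⟩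
    rw [hfull]; ring
  · constructor
    · rcases hq.eq_or_lt with rfl | hqT
      · rcases Nat.eq_zero_or_pos p with rfl | hp
        · exact ⟨1, by omega, 1, by omega, by rw [hfull, add_zero]⟩
        · refine ⟨p, hlt, 0, by omega, ?_⟩
          rw [cyclicSum, if_pos ⟨Nat.zero_le _, hp⟩, add_zero]; ring
      · refine ⟨p, by omega, q, hqT, ?_⟩
        rw [cyclicSum, if_neg (by omega), add_zero]
    · rcases hq.eq_or_lt with rfl | hqT
      · refine ⟨0, by omega, p, hlt, ?_⟩
        rw [cyclicSum, if_neg (by omega)]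
        simp only [add_zero]
        ring
      · refine ⟨q, hqT, p, by omega, ?_⟩
        rw [cyclicSum, if_pos ⟨hlt.le, by omega⟩]; ring

/-- Numbers with prescribed digits. -/
theorem exists_digits {T : ℕ} (e : ℕ → ℕ) (he : ∀ i, e i < T) (n : ℕ) :
    ∃ s < T ^ n, ∀ i < n, (s / T ^ i) % T = e i := by
  have hT : 0 < T := lt_of_le_of_lt (Nat.zero_le _) (he 0)
  induction n with
  | zero => exact ⟨0, by simp, fun i hi => absurd hi (by omega)⟩
  | succ n ih =>
    obtain ⟨s, hs, h⟩ := ih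
    have hpos : 0 < T ^ n := Nat.pow_pos hT
    refine ⟨s + T ^ n * e n, ?_, fun i hi => ?_⟩
    · have : T ^ n * e n + T ^ n ≤ T ^ n * T := by
        rw [← Nat.mul_succ]; exact Nat.mul_le_mul_left _ (he n)
      rw [pow_succ]; omega
    · rcases Nat.lt_succ_iff_lt_or_eq.1 hi with hi | rfl
      · rw [← h i hi]
        have e1 : T ^ n * e n = T ^ i * (T * (T ^ (n - i - 1) * e n)) := by
          rw [← mul_assoc, ← mul_assoc, ← pow_succ, ← pow_add]; congr 2; omega
        rw [e1, Nat.add_mul_div_left _ _ (Nat.pow_pos hT), Nat.add_mul_mod_self_left]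
      · rw [Nat.add_mul_div_left _ _ hpos, Nat.div_eq_of_lt hs, zero_add, Nat.mod_eq_of_lt (he i)]

/-- All combinations of intervals are encoded by states. -/
theorem exists_entry {L T : ℕ} (hT : 2 ≤ T) (G : ℕ → ℝ) (f : ℕ → ℝ)
    (hf : ∀ l, 1 ≤ l → l < L → ∃ p q : ℕ → ℕ, (∀ j, p j < T ∧ q j < T) ∧
      f l = ∑ j ∈ Finset.range (2 * L - 1), contrib L T G j (p j) (q j)) :
    ∃ s < numStates L T, ∀ l, 1 ≤ l → l < L → entry L T G s l = f l := by
  have hJ : numIntervals L T = 2 * L - 1 := by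
    unfold numIntervals; rw [show 1 - (2 - T) = 1 by omega, mul_one]
  have hf' : ∀ l, ∃ p q : ℕ → ℕ, (∀ j, p j < T ∧ q j < T) ∧ (1 ≤ l → l < L →
      f l = ∑ j ∈ Finset.range (2 * L - 1), contrib L T G j (p j) (q j)) := by
    intro l
    by_cases h : 1 ≤ l ∧ l < L
    · obtain ⟨p, q, h1, h2⟩ := hf l h.1 h.2
      exact ⟨p, q, h1, fun _ _ => h2⟩
    · exact ⟨fun _ => 0, fun _ => 0, fun _ => ⟨show 0 < T by omega, show 0 < T by omega⟩, fun h1 h2 => absurd ⟨h1, h2⟩ h⟩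
  choose p q hpq hval using hf'
  set J := 2 * L - 1 with hJdef
  -- The base-`T` digits come in pairs: pair number `(l - 1) * J + j` holds the start (even place)
  -- and the end (odd place) of the `j`-th interval for row `l`.
  obtain ⟨s, hs, hdig⟩ := exists_digits (T := T) (fun i => if i % 2 = 0 then
      p (i / 2 / J + 1) (i / 2 % J) else q (i / 2 / J + 1) (i / 2 % J))
    (fun i => by split_ifs <;> [exact (hpq _ _).1; exact (hpq _ _).2])
    (2 * ((L - 1) * J))
  refine ⟨s, ?_, fun l h1 h2 => ?_⟩
  · rw [numStates, hJ, ← pow_two, ← pow_mul]; exact hs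
  · rw [hval l h1 h2, entry, hJ]
    refine Finset.sum_congr rfl fun j hj => ?_
    have hj' : j < J := Finset.mem_range.1 hj
    have hlt : (l - 1) * J + j < (L - 1) * J := by
      have : (l - 1 + 1) * J ≤ (L - 1) * J := Nat.mul_le_mul_right _ (by omega)
      rw [Nat.succ_mul] at this
      omega
    have hdiv : ((l - 1) * J + j) / J = l - 1 := by
      rw [Nat.mul_comm, Nat.mul_add_div (by omega), Nat.div_eq_of_lt hj', add_zero]
    have hmod : ((l - 1) * J + j) % J = j := by
      rw [Nat.mul_comm, Nat.mul_add_mod, Nat.mod_eq_of_lt hj']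
    have d1 := hdig (2 * ((l - 1) * J + j)) (by omega)
    have d2 := hdig (2 * ((l - 1) * J + j) + 1) (by omega)
    rw [if_pos (by omega)] at d1
    rw [if_neg (by omega)] at d2
    rw [show 2 * ((l - 1) * J + j) / 2 = (l - 1) * J + j by omega, hdiv, hmod,
      show l - 1 + 1 = l by omega] at d1
    rw [show (2 * ((l - 1) * J + j) + 1) / 2 = (l - 1) * J + j by omega, hdiv, hmod,
      show l - 1 + 1 = l by omega] at d2
    unfold entryTerm
    rw [hJ, ← pow_two, ← pow_mul, d1, ← pow_succ, d2]

end Model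

/-! ### Chains of states and feasible flows -/

section ModelFlow

variable {L T : ℕ}

theorem UMFG.initState_real (I : UMFG L T) {k t : ℕ} (hk : k < L) (ht : t < T) :
    I.initState.real (k * T + t) = I.supply k t := by
  have hlt : k * T + t < L * T := by
    have : (k + 1) * T ≤ L * T := Nat.mul_le_mul_right _ hk
    rw [Nat.succ_mul] at this
    omega
  have h1 : (k * T + t) / T = k := by
    rw [Nat.mul_comm, Nat.mul_add_div (by omega), Nat.div_eq_of_lt ht, add_zero]
  have h2 : (k * T + t) % T = t := by rw [Nat.mul_comm, Nat.mul_add_mod, Nat.mod_eq_of_lt ht]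
  simp only [UMFG.initState, hlt, dite_true, UMFG.supply, hk, ht, and_self, h1, h2]

/-- Prefix sums of the supplies. -/
noncomputable def UMFG.prefixSupply (I : UMFG L T) : ℕ → ℝ := prefixSum I.initState.real

theorem UMFG.prefixSupply_step (I : UMFG L T) {k t : ℕ} (hk : k < L) (ht : t < T) :
    I.prefixSupply (k * T + t + 1) - I.prefixSupply (k * T + t) = I.supply k t := by
  rw [← I.initState_real hk ht]
  simp [UMFG.prefixSupply, prefixSum, Finset.sum_range_succ]

theorem UMFG.prefixSupply_row (I : UMFG L T) {k t : ℕ} (hk : k < L) (ht : t ≤ T) :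
    I.prefixSupply (k * T + t) - I.prefixSupply (k * T) =
      ∑ c ∈ Finset.range t, I.supply k c := by
  have := prefixSum_sub I.initState.real (k * T) (Nat.zero_le t)
  rw [add_zero, ← Finset.range_eq_Ico] at this
  rw [UMFG.prefixSupply, this]
  exact Finset.sum_congr rfl fun c hc =>
    I.initState_real hk (lt_of_lt_of_le (Finset.mem_range.1 hc) ht)

theorem UMFG.topFlow_eq (I : UMFG L T) (hL : 1 ≤ L) (X : ℕ → ℕ → ℝ) {t : ℕ} (ht : t ≤ T) (s : ℕ) :
    topFlow L T I.prefixSupply X t s =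
      ∑ k ∈ Finset.range L, ∑ c ∈ Finset.range t, I.supply k c - ∑ k ∈ Finset.Ico 1 L, X s k := by
  unfold topFlow
  rw [Finset.sum_sub_distrib, Finset.range_eq_Ico, Finset.sum_eq_sum_Ico_succ_bot hL]
  have h0 := I.prefixSupply_row (k := 0) hL ht
  rw [zero_mul, zero_add] at h0
  have h00 : I.prefixSupply 0 = 0 := by simp [UMFG.prefixSupply, prefixSum]
  have : ∑ k ∈ Finset.Ico 1 L, (I.prefixSupply (k * T + t) - I.prefixSupply (k * T)) =
      ∑ k ∈ Finset.Ico (0 + 1) L, ∑ c ∈ Finset.range t, I.supply k c :=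
    Finset.sum_congr rfl fun k hk => I.prefixSupply_row (Finset.mem_Ico.1 hk).2 ht
  rw [this]
  linarith

theorem UMFG.sum_supply (I : UMFG L T) :
    ∑ k ∈ Finset.range L, ∑ c ∈ Finset.range T, I.supply k c = 0 := by
  have h := I.sum_b
  rw [Fintype.sum_prod_type] at h
  have h' : ∑ k : Fin L, ∑ c : Fin T, (I.b (k, c) : ℝ) = 0 := by exact_mod_cast h
  rw [← h', Finset.sum_range]
  refine Finset.sum_congr rfl fun k _ => ?_
  rw [Finset.sum_range]
  exact Finset.sum_congr rfl fun c _ => I.supply_pt (k, c)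

/-- A chain of states describes a feasible flow. -/
theorem IsStateChain.isFeasibleFlow {I : UMFG L T} (hL : 1 ≤ L) {X : ℕ → ℕ → ℝ}
    (hX : ∀ l, X 0 l = 0) {M : ℕ} {σ : ℕ → ℕ} (hσ : IsStateChain L T I.prefixSupply X M σ)
    {x : GridArc L T → ℝ}
    (hf : ∀ l t, l < L → t + 1 < T → atForward x l t = chainForward L T I.prefixSupply X σ l t)
    (hd : ∀ l t, l + 1 < L → t < T → atDownward x l t = chainDownward L T I.prefixSupply X σ l t) :
    I.IsFeasibleFlow x ∧
      I.totalCost x = ∑ t ∈ Finset.range T,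
        stepCost L T I.prefixSupply X I.oracle t (σ t) (σ (t + 1)) := by
  -- The formula extends to the last column, which no forward arc leaves: the total supply is `0`,
  -- and so are the flows of the state `0`.
  have hf' : ∀ l t, l < L → t < T → atForward x l t = chainForward L T I.prefixSupply X σ l t := by
    intro l t hl ht
    by_cases h : t + 1 < T
    · exact hf l t hl h
    · have hT : t + 1 = T := by omega
      rw [atForward, dif_neg (by omega), chainForward, hT, hσ.last, I.topFlow_eq hL X le_rfl,
        I.sum_supply]
      simp [hX]
  have hd' : ∀ l t, l < L → t < T → atDownward x l t =
      chainDownward L T I.prefixSupply X σ l t := by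
    intro l t hl ht
    by_cases h : l + 1 < L
    · exact hd l t h ht
    · rw [atDownward, dif_neg (by omega), chainDownward, show l + 1 = L by omega, vertFlow_last]
  constructor
  · rw [I.isFeasibleFlow_iff]
    constructor
    · intro l hl t ht
      rw [hf' l t hl ht, hd' l t hl ht]
      have hprev : ∀ l < L, (if t = 0 then 0 else atForward x l (t - 1)) =
          if l = 0 then topFlow L T I.prefixSupply X t (σ t) else X (σ t) l := by
        intro l hl
        rcases Nat.eq_zero_or_pos t with rfl | h
        · rw [if_pos rfl, hσ.zero, I.topFlow_eq hL X (Nat.zero_le _)]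
          simp [hX]
        · rw [if_neg (by omega), hf' l (t - 1) hl (by omega), chainForward,
            show t - 1 + 1 = t by omega]
      rw [hprev l hl]
      rcases Nat.eq_zero_or_pos l with rfl | h
      · have h1 := topFlow_succ L T I.prefixSupply X t (σ t) (σ (t + 1))
        have h2 := I.prefixSupply_step hl ht
        rw [zero_mul, zero_add] at h2
        simp only [chainForward, chainDownward, if_true, zero_add, add_zero]
        rw [← h2]
        linarith
      · have h0 : l ≠ 0 := by omega
        have h1 := hd' (l - 1) t (by omega) ht
        rw [chainDownward, show l - 1 + 1 = l by omega, vertFlow_of_lt _ _ _ _ _ hl,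
          I.prefixSupply_step hl ht] at h1
        simp only [if_neg h0, chainForward, chainDownward]
        rw [h1]
        ring
    · intro l t
      constructor
      · by_cases h : l < L ∧ t + 1 < T
        · rw [hf l t h.1 h.2, chainForward]
          have := hσ.ok t (by omega)
          split_ifs
          · exact this.2
          · exact (this.1 l (by omega) h.1).1
        · rw [atForward, dif_neg h]
      · by_cases h : l + 1 < L ∧ t < T
        · rw [hd l t h.1 h.2]
          exact ((hσ.ok t h.2).1 (l + 1) (by omega) h.1).2
        · rw [atDownward, dif_neg h]
  · rw [I.totalCost_eq, Finset.sum_comm]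
    refine Finset.sum_congr rfl fun t ht => ?_
    have ht' := Finset.mem_range.1 ht
    rw [Finset.sum_add_distrib, stepCost, Finset.sum_add_distrib]
    have h1 : ∑ l ∈ Finset.range L, I.oracle .forward l t (atForward x l t) =
        I.oracle .forward 0 t (topFlow L T I.prefixSupply X (t + 1) (σ (t + 1))) +
        ∑ l ∈ Finset.Ico 1 L, I.oracle .forward l t (X (σ (t + 1)) l) := by
      rw [Finset.range_eq_Ico, Finset.sum_eq_sum_Ico_succ_bot hL, hf' 0 t hL ht']
      congr 1
      refine Finset.sum_congr rfl fun l hl => ?_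
      have := Finset.mem_Ico.1 hl
      rw [hf' l t this.2 ht', chainForward, if_neg (by omega)]
    have h2 : ∑ l ∈ Finset.range L, I.oracle .downward l t (atDownward x l t) =
        ∑ l ∈ Finset.Ico 1 L, I.oracle .downward (l - 1) t
          (vertFlow L T I.prefixSupply X t (σ t) (σ (t + 1)) l) := by
      obtain ⟨K, rfl⟩ : ∃ K, L = K + 1 := ⟨L - 1, by omega⟩
      rw [Finset.sum_range_succ, Finset.sum_Ico_eq_sum_range]
      have : I.oracle .downward K t (atDownward x K t) = 0 := by simp [UMFG.oracle]
      rw [this, add_zero]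
      refine Finset.sum_congr rfl fun l hl => ?_
      have := Finset.mem_range.1 hl
      rw [hd' l t (by omega) ht', chainDownward, show 1 + l - 1 = l by omega, add_comm 1 l]
    rw [h1, h2]
    ring

theorem sum_Ico_sub_succ (f : ℕ → ℝ) {a b : ℕ} (h : a ≤ b) :
    ∑ k ∈ Finset.Ico a b, (f k - f (k + 1)) = f a - f b := by
  induction b, h using Nat.le_induction with
  | base => simp
  | succ n hn ih => rw [Finset.sum_Ico_succ_top hn, ih]; ring

/-- A feasible flow whose forward flows outside the top row are encoded by states comes from a
chain of states. -/
theorem UMFG.IsFeasibleFlow.isStateChain {I : UMFG L T} (hL : 1 ≤ L) {X : ℕ → ℕ → ℝ}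
    {x : GridArc L T → ℝ} (hx : I.IsFeasibleFlow x) {M : ℕ} {σ : ℕ → ℕ} (h0 : σ 0 = 0)
    (hT : σ T = 0) (hM : ∀ t, t ≤ T → σ t < M) (hX : ∀ l, X 0 l = 0)
    (hσ : ∀ t l, 1 ≤ l → l < L → t + 1 < T → X (σ (t + 1)) l = atForward x l t) :
    IsStateChain L T I.prefixSupply X M σ ∧
      (∀ l t, l < L → t + 1 < T → atForward x l t = chainForward L T I.prefixSupply X σ l t) ∧
      ∀ l t, l + 1 < L → t < T → atDownward x l t =
        chainDownward L T I.prefixSupply X σ l t := by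
  rw [I.isFeasibleFlow_iff] at hx
  obtain ⟨hcons, hpos⟩ := hx
  set prev : ℕ → ℕ → ℝ := fun l t => if t = 0 then 0 else atForward x l (t - 1) with hprev
  have hXp : ∀ l, 1 ≤ l → l < L → ∀ t ≤ T, X (σ t) l = prev l t := by
    intro l h1 h2 t ht
    rcases Nat.eq_zero_or_pos t with rfl | h
    · simp [hprev, h0, hX]
    · rcases ht.eq_or_lt with rfl | h'
      · rw [hT, hX, hprev]
        simp only
        rw [if_neg (by omega), atForward, dif_neg (by omega)]
      · have := hσ (t - 1) l h1 h2 (by omega)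
        rw [show t - 1 + 1 = t by omega] at this
        simp only [hprev]
        rw [if_neg (by omega), this]
  -- Conservation summed over the rows from `l` on telescopes to the downward flow that enters row
  -- `l`.
  have hcol : ∀ t < T, ∀ l ≤ L, ∑ k ∈ Finset.Ico l L, (atForward x k t - prev k t - I.supply k t) =
      if l = 0 then 0 else atDownward x (l - 1) t := by
    intro t ht l hl
    have h1 := sum_Ico_sub_succ (fun k => if k = 0 then 0 else atDownward x (k - 1) t) hl
    have h2 : (if L = 0 then 0 else atDownward x (L - 1) t) = 0 := by
      rw [if_neg (by omega), atDownward, dif_neg (by omega)]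
    simp only [h2, sub_zero] at h1
    rw [← h1]
    refine Finset.sum_congr rfl fun k hk => ?_
    have := hcons k (Finset.mem_Ico.1 hk).2 t ht
    simp only [hprev, Nat.add_sub_cancel, if_neg (Nat.succ_ne_zero k)]
    linarith
  have hvert : ∀ l t, 1 ≤ l → l ≤ L → t < T →
      vertFlow L T I.prefixSupply X t (σ t) (σ (t + 1)) l = atDownward x (l - 1) t := by
    intro l t h1 h2 ht
    have := hcol t ht l h2
    rw [if_neg (by omega)] at this
    rw [← this, vertFlow]
    refine Finset.sum_congr rfl fun k hk => ?_
    have hk' := Finset.mem_Ico.1 hk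
    rw [hXp k (by omega) hk'.2 t ht.le, hXp k (by omega) hk'.2 (t + 1) ht,
      I.prefixSupply_step hk'.2 ht]
    simp [hprev]
  have htop : ∀ t ≤ T, ∑ k ∈ Finset.range L, prev k t =
      ∑ k ∈ Finset.range L, ∑ c ∈ Finset.range t, I.supply k c := by
    intro t
    induction t with
    | zero => intro _; simp [hprev]
    | succ t ih =>
      intro ht
      have h1 := hcol t ht 0 (Nat.zero_le _)
      rw [if_pos rfl, ← Finset.range_eq_Ico, Finset.sum_sub_distrib, Finset.sum_sub_distrib,
        ih (by omega)] at h1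
      simp only [Finset.sum_range_succ, Finset.sum_add_distrib]
      have h2 : ∑ k ∈ Finset.range L, prev k (t + 1) = ∑ k ∈ Finset.range L, atForward x k t := by
        simp [hprev]
      rw [h2]
      linarith
  have htop' : ∀ t < T, topFlow L T I.prefixSupply X (t + 1) (σ (t + 1)) = atForward x 0 t := by
    intro t ht
    have h1 := htop (t + 1) ht
    rw [I.topFlow_eq hL X ht, ← h1, Finset.range_eq_Ico, Finset.sum_eq_sum_Ico_succ_bot hL]
    have : ∑ k ∈ Finset.Ico 1 L, X (σ (t + 1)) k = ∑ k ∈ Finset.Ico (0 + 1) L, prev k (t + 1) :=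
      Finset.sum_congr rfl fun k hk => hXp k (Finset.mem_Ico.1 hk).1 (Finset.mem_Ico.1 hk).2 _ ht
    rw [this]
    simp [hprev]
  refine ⟨⟨h0, hT, hM, fun t ht => ⟨fun l h1 h2 => ⟨?_, ?_⟩, ?_⟩⟩, ?_, ?_⟩
  · rw [hXp l h1 h2 (t + 1) ht]
    simpa [hprev] using (hpos l t).1
  · rw [hvert l t h1 h2.le ht]; exact (hpos _ _).2
  · rw [htop' t ht]; exact (hpos _ _).1
  · intro l t hl ht
    unfold chainForward
    split_ifs with h
    · rw [htop' t (by omega), h]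
    · rw [hσ t l (by omega) hl ht]
  · intro l t hl ht
    rw [chainDownward, hvert (l + 1) t (by omega) hl.le ht, Nat.add_sub_cancel]

/-- Forward flows of forest flows outside the top row are encoded by states. -/
theorem UMFG.IsFeasibleFlow.exists_state {I : UMFG L T} {x : GridArc L T → ℝ}
    (hx : I.IsFeasibleFlow x) (hI : I.SourcesInOneRow)
    (hforest : ∀ a, 0 < x a → ¬ Relation.EqvGen (SupportStep (fun e : GridArc L T => e.1.1)
      (fun e => e.1.2) x a) a.1.1 a.1.2) {t : ℕ} (ht : t + 1 < T) :
    ∃ s < numStates L T, ∀ l, 1 ≤ l → l < L →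
      entry L T I.prefixSupply s l = atForward x l t := by
  refine exists_entry (by omega) I.prefixSupply (fun l => atForward x l t) fun l h1 h2 => ?_
  obtain ⟨r, hr⟩ := hI
  have hcontrib0 : ∀ j, contrib L T I.prefixSupply j 0 0 = 0 := by
    intro j; simp [contrib, cyclicSum]
  rcases (hx.2 (GridArc.forward l t h2 ht)).eq_or_lt with h | h
  -- The cut argument needs positive flow; an arc without flow is coded by empty intervals.
  · refine ⟨fun _ => 0, fun _ => 0, fun _ => ⟨show 0 < T by omega, show 0 < T by omega⟩, ?_⟩
    simp [hcontrib0, atForward, h2, ht, ← h]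
  · obtain ⟨w, hw, hrows⟩ := hx.forward_value hr h2 ht h (hforest _ h)
    have hrow : ∀ k, ∃ p q p' q', p < T ∧ q < T ∧ p' < T ∧ q' < T ∧ (k < L →
        w k = cyclicSum T I.prefixSupply k p q -
          if k = 0 then 0 else cyclicSum T I.prefixSupply k p' q') := by
      intro k
      by_cases hk : k < L
      swap
      · exact ⟨0, 0, 0, 0, by omega, by omega, by omega, by omega, fun h => absurd h hk⟩
      obtain ⟨p, q, p', q', a1, a2, a3, a4, a5, a6⟩ := hrows k
      have hs : ∀ p q, q ≤ T → ∑ c ∈ Finset.Ico p q, I.initState.real (k * T + c) =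
          ∑ c ∈ Finset.Ico p q, I.supply k c := fun p q hq => Finset.sum_congr rfl fun c hc =>
        I.initState_real hk (lt_of_lt_of_le (Finset.mem_Ico.1 hc).2 hq)
      have hs' : ∑ c ∈ Finset.range T, I.initState.real (k * T + c) =
          ∑ c ∈ Finset.range T, I.supply k c := Finset.sum_congr rfl fun c hc =>
        I.initState_real hk (Finset.mem_range.1 hc)
      obtain ⟨⟨p₀, hp₀, q₀, hq₀, e₀⟩, p₁, hp₁, q₁, hq₁, e₁⟩ :=
        exists_cyclicSum (by omega) I.initState.real k a1 a2
      obtain ⟨⟨p₂, hp₂, q₂, hq₂, e₂⟩, -⟩ :=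
        exists_cyclicSum (by omega) I.initState.real k a3 a4
      rw [hs _ _ a2] at e₀ e₁
      rw [hs'] at e₁
      rw [hs _ _ a4] at e₂
      -- Since `1 ≤ l`, row `0` lies above the head of the arc and has no second interval.
      have hJ : (if k = 0 then 0 else cyclicSum T I.prefixSupply k p₂ q₂) =
          ∑ c ∈ Finset.Ico p' q', I.supply k c := by
        split_ifs with h0
        · rw [a5 (by omega)]; simp
        · exact e₂
      rcases a6 with a6 | a6
      · exact ⟨p₀, q₀, p₂, q₂, hp₀, hq₀, hp₂, hq₂, fun _ => by rw [hJ, a6, ← e₀]; rfl⟩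
      · exact ⟨p₁, q₁, p₂, q₂, hp₁, hq₁, hp₂, hq₂, fun _ => by rw [hJ, a6, ← e₁]; rfl⟩
    choose p q p' q' b1 b2 b3 b4 b5 using hrow
    -- Indices below `L` are the first intervals of the rows `0, …, L - 1`; the indices `L, …, 2L -
    -- 2` are the second intervals of the rows `1, …, L - 1`.
    refine ⟨fun j => if j < L then p j else p' (j - (L - 1)),
      fun j => if j < L then q j else q' (j - (L - 1)), fun j => ?_, ?_⟩
    · constructor <;> simp only <;> split_ifs <;> solve_by_elim
    · have hx' : atForward x l t = x (GridArc.forward l t h2 ht) := by simp [atForward, h2, ht]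
      simp only
      rw [hx', hw, Finset.sum_congr rfl fun k hk => b5 k (Finset.mem_range.1 hk),
        Finset.sum_sub_distrib, show 2 * L - 1 = L + (L - 1) by omega, Finset.sum_range_add,
        sub_eq_add_neg]
      congr 1
      · refine Finset.sum_congr rfl fun j hj => ?_
        have := Finset.mem_range.1 hj
        simp only [contrib, this, if_true]
      · obtain ⟨K, rfl⟩ : ∃ K, L = K + 1 := ⟨L - 1, by omega⟩
        rw [Finset.sum_range_succ', if_pos rfl, add_zero, ← Finset.sum_neg_distrib]
        refine Finset.sum_congr rfl fun j hj => ?_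
        have e1 : ¬ K + 1 + j < K + 1 := by omega
        have e2 : K + 1 + j - (K + 1 - 1) = j + 1 := by omega
        simp only [contrib, if_neg e1, e2, if_neg (Nat.succ_ne_zero j)]

/-- Every feasible flow is dominated by a chain of states. -/
theorem UMFG.IsFeasibleFlow.exists_stateChain {I : UMFG L T} (hL : 1 ≤ L) (hI : I.SourcesInOneRow)
    {y : GridArc L T → ℝ} (hy : I.IsFeasibleFlow y) (hM : 0 < numStates L T) :
    ∃ σ, IsStateChain L T I.prefixSupply (entry L T I.prefixSupply) (numStates L T) σ ∧
      ∑ t ∈ Finset.range T, stepCost L T I.prefixSupply (entry L T I.prefixSupply) I.oracle t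
        (σ t) (σ (t + 1)) ≤ I.totalCost y := by
  obtain ⟨x, hx0, hxn, hxc, hxf⟩ := exists_forest_flow (fun e : GridArc L T => e.1.1)
    (fun e => e.1.2) (fun v => ((v.1 : ℕ) : ℝ) + ((v.2 : ℕ) : ℝ))
    (by
      intro e
      rcases e.2 with ⟨h1, h2⟩ | ⟨h1, h2⟩
      · simp [h1, h2]
      · simp [h1, h2])
    I.c I.concave_c y hy.2
  have hx : I.IsFeasibleFlow x := ⟨fun v => (hxn v).trans (hy.1 v), hx0⟩
  have hst : ∀ t, ∃ s < numStates L T, t + 1 < T → ∀ l, 1 ≤ l → l < L →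
      entry L T I.prefixSupply s l = atForward x l t := by
    intro t
    by_cases ht : t + 1 < T
    · obtain ⟨s, hs, h⟩ := hx.exists_state hI hxf ht
      exact ⟨s, hs, fun _ => h⟩
    · exact ⟨0, hM, fun h => absurd h ht⟩
  choose τ hτ hτ' using hst
  obtain ⟨h1, h2, h3⟩ := hx.isStateChain hL (M := numStates L T)
    (X := entry L T I.prefixSupply)
    (σ := fun t => if t = 0 ∨ t = T then 0 else τ (t - 1)) (by simp) (by simp)
    (fun t _ => by split_ifs <;> [exact hM; exact hτ _]) (entry_zero L T _)
    (fun t l h1 h2 ht => by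
      rw [if_neg (by omega)]
      exact hτ' t ht l h1 h2)
  refine ⟨_, h1, ?_⟩
  rw [← (h1.isFeasibleFlow hL (entry_zero L T _) h2 h3).2]
  exact hxc

end ModelFlow

/-! ## Reasoning about programs -/

namespace RealRAM

/-- The program, started in `s`, halts within `n` steps in a state with property `Q`. -/
def Runs (O : Oracle) (p : Prog) (n : ℕ) (s : State) (Q : State → Prop) : Prop :=
  ∃ s' m, Exec O p s s' m ∧ m ≤ n ∧ Q s'

variable {O : Oracle}

theorem Runs.mono {p : Prog} {n n' : ℕ} {s : State} {Q Q' : State → Prop}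
    (h : Runs O p n s Q) (hn : n ≤ n') (hQ : ∀ s', Q s' → Q' s') : Runs O p n' s Q' := by
  obtain ⟨s', m, h1, h2, h3⟩ := h
  exact ⟨s', m, h1, h2.trans hn, hQ _ h3⟩

theorem Runs.skip {s : State} {Q : State → Prop} (h : Q s) : Runs O .skip 1 s Q :=
  ⟨s, 1, .skip s, le_rfl, h⟩

/-- The state after an assignment to an index register. -/
def State.putIdx (s : State) (a v : ℕ) : State := { s with idx := Function.update s.idx a v }

/-- The state after an assignment to a real register. -/
def State.putReal (s : State) (a : ℕ) (v : ℝ) : State :=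
  { s with real := Function.update s.real a v }

@[simp] theorem State.putIdx_idx (s : State) (a v i : ℕ) :
    (s.putIdx a v).idx i = if i = a then v else s.idx i := by
  simp [State.putIdx, Function.update_apply]

@[simp] theorem State.putIdx_real (s : State) (a v : ℕ) : (s.putIdx a v).real = s.real := rfl

@[simp] theorem State.putReal_real (s : State) (a : ℕ) (v : ℝ) (i : ℕ) :
    (s.putReal a v).real i = if i = a then v else s.real i := by
  simp [State.putReal, Function.update_apply]

@[simp] theorem State.putReal_idx (s : State) (a : ℕ) (v : ℝ) : (s.putReal a v).idx = s.idx := rfl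

theorem Runs.setIdx {a e : IExp} {s : State} {Q : State → Prop} {n : ℕ}
    (hn : 1 + a.cost + e.cost ≤ n) (h : Q (s.putIdx (a.eval s) (e.eval s))) :
    Runs O (.setIdx a e) n s Q :=
  ⟨_, _, .setIdx a e s, hn, h⟩

theorem Runs.setReal {a : IExp} {e : RExp} {s : State} {Q : State → Prop} {n : ℕ}
    (hn : 1 + a.cost + e.cost ≤ n) (h : Q (s.putReal (a.eval s) (e.eval O s))) :
    Runs O (.setReal a e) n s Q :=
  ⟨_, _, .setReal a e s, hn, h⟩

theorem Runs.seq {p q : Prog} {s : State} {Q : State → Prop} {m n : ℕ}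
    (h : Runs O p m s fun s' => Runs O q n s' Q) : Runs O (.seq p q) (m + n) s Q := by
  obtain ⟨s', k, h1, h2, s'', k', h3, h4, h5⟩ := h
  exact ⟨s'', _, .seq h1 h3, by omega, h5⟩

theorem Runs.ite {b : BExp} {p q : Prog} {s : State} {Q : State → Prop} {n : ℕ}
    (hp : b.eval O s → Runs O p n s Q) (hq : ¬ b.eval O s → Runs O q n s Q) :
    Runs O (.ite b p q) (1 + b.cost + n) s Q := by
  by_cases hb : b.eval O s
  · obtain ⟨s', m, h1, h2, h3⟩ := hp hb
    exact ⟨s', _, .iteTrue hb h1, by omega, h3⟩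
  · obtain ⟨s', m, h1, h2, h3⟩ := hq hb
    exact ⟨s', _, .iteFalse hb h1, by omega, h3⟩

/-- The number `N` of rounds is known beforehand. Indexing the invariant by the rounds done gives
halting and the time bound by one induction on the rounds that remain. -/
theorem Runs.while {b : BExp} {p : Prog} {c N : ℕ} (Inv : ℕ → State → Prop)
    (hb : ∀ k s, k < N → Inv k s → b.eval O s) (hN : ∀ s, Inv N s → ¬ b.eval O s)
    (hp : ∀ k s, k < N → Inv k s → Runs O p c s (Inv (k + 1))) {s : State} (h0 : Inv 0 s) :
    Runs O (.while b p) (N * (1 + b.cost + c) + (1 + b.cost)) s (Inv N) := by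
  suffices H : ∀ j k s, k + j = N → Inv k s →
      Runs O (.while b p) (j * (1 + b.cost + c) + (1 + b.cost)) s (Inv N) from
    H N 0 s (by omega) h0
  intro j
  induction j with
  | zero =>
    intro k s hk h
    obtain rfl : k = N := by omega
    exact ⟨s, _, .whileFalse (hN s h), by omega, h⟩
  | succ j ih =>
    intro k s hk h
    obtain ⟨s', m, h1, h2, h3⟩ := hp k s (by omega) h
    obtain ⟨s'', m', h1', h2', h3'⟩ := ih (k + 1) s' (by omega) h3
    refine ⟨s'', _, .whileTrue (hb k s (by omega) h) h1 h1', ?_, h3'⟩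
    rw [Nat.succ_mul]
    omega

/-- A loop with an explicit bound on its running time. -/
theorem Runs.while_le {b : BExp} {p : Prog} {c N n : ℕ} (Inv : ℕ → State → Prop)
    (hn : N * (1 + b.cost + c) + (1 + b.cost) ≤ n)
    (hb : ∀ k s, k < N → Inv k s → b.eval O s) (hN : ∀ s, Inv N s → ¬ b.eval O s)
    (hp : ∀ k s, k < N → Inv k s → Runs O p c s (Inv (k + 1))) {s : State} (h0 : Inv 0 s)
    {Q : State → Prop} (hQ : ∀ s', Inv N s' → Q s') :
    Runs O (.while b p) n s Q :=
  (Runs.while Inv hb hN hp h0).mono hn hQ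

/-! ### Notation for expressions, memory layout, and loop-free programs -/

instance : Add IExp := ⟨.add⟩
instance : Sub IExp := ⟨.sub⟩
instance : Mul IExp := ⟨.mul⟩
instance (n : ℕ) : OfNat IExp n := ⟨.const n⟩
instance : Add RExp := ⟨.add⟩
instance : Sub RExp := ⟨.sub⟩

@[simp] theorem IExp.eval_add (a b : IExp) (s : State) : (a + b).eval s = a.eval s + b.eval s := rfl
@[simp] theorem IExp.eval_sub (a b : IExp) (s : State) : (a - b).eval s = a.eval s - b.eval s := rfl
@[simp] theorem IExp.eval_mul (a b : IExp) (s : State) : (a * b).eval s = a.eval s * b.eval s := rfl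
@[simp] theorem IExp.eval_ofNat (n : ℕ) (s : State) : (ofNat(n) : IExp).eval s = n := rfl
@[simp] theorem IExp.eval_load (a : IExp) (s : State) : (IExp.load a).eval s = s.idx (a.eval s) := rfl
@[simp] theorem RExp.eval_add (a b : RExp) (s : State) :
    (a + b).eval O s = a.eval O s + b.eval O s := rfl
@[simp] theorem RExp.eval_sub (a b : RExp) (s : State) :
    (a - b).eval O s = a.eval O s - b.eval O s := rfl
@[simp] theorem RExp.eval_load (a : IExp) (s : State) :
    (RExp.load a).eval O s = s.real (a.eval s) := rfl
@[simp] theorem RExp.eval_const (z : ℤ) (s : State) : (RExp.const z).eval O s = z := rfl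
@[simp] theorem RExp.eval_query (d : Dir) (l t : IExp) (x : RExp) (s : State) :
    (RExp.query d l t x).eval O s = O d (l.eval s) (t.eval s) (x.eval O s) := rfl
@[simp] theorem BExp.eval_leIdx (a b : IExp) (s : State) :
    (BExp.leIdx a b).eval O s ↔ a.eval s ≤ b.eval s := Iff.rfl
@[simp] theorem BExp.eval_leReal (a b : RExp) (s : State) :
    (BExp.leReal a b).eval O s ↔ a.eval O s ≤ b.eval O s := Iff.rfl
@[simp] theorem BExp.eval_and (p q : BExp) (s : State) :
    (BExp.and p q).eval O s ↔ p.eval O s ∧ q.eval O s := Iff.rfl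

/-- The content of the index register `n`. -/
def reg (n : ℕ) : IExp := .load (.const n)

@[simp] theorem reg_eval (n : ℕ) (s : State) : (reg n).eval s = s.idx n := rfl

/-- Address of the `i`-th element of the real array number `a < 4`. The arrays are interleaved; they
begin after the registers of the output. -/
def slot (a : ℕ) (i : IExp) : IExp := 2 * reg 0 * reg 1 + 4 * i + .const a

-- Of array 0 only the first cell is used, as an accumulator. Array 1 holds the prefix sums, array 2
-- the flows of the states at `n * L + l`, array 3 the costs of the dynamic program at `t * M + m`.
-- Index registers 0, 1 and 3 hold `L`, `T` and the number of states; 2 is a counter; 4 to 10 and 16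
-- serve to build the flow table; 11 is the column, 12 and 13 the states after and before it, 14 the
-- row, 15 the feasibility flag. The predecessor table begins at 32.
@[simp] theorem slot_eval (a : ℕ) (i : IExp) (s : State) :
    (slot a i).eval s = 2 * s.idx 0 * s.idx 1 + 4 * i.eval s + a := rfl

/-- Running time of a program without loops. -/
def Prog.bound : Prog → ℕ
  | .skip => 1
  | .setIdx a e => 1 + a.cost + e.cost
  | .setReal a e => 1 + a.cost + e.cost
  | .seq p q => p.bound + q.bound
  | .ite b p q => 1 + b.cost + max p.bound q.bound
  | .while _ _ => 0

/-- The program halts within its bound. -/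
def RunsB (O : Oracle) (p : Prog) (s : State) (Q : State → Prop) : Prop := Runs O p p.bound s Q

/-- For a concrete loop-free program the bound is a closed numeral, so `hn` is settled by evaluation
and correctness proofs need no step counting. -/
theorem RunsB.le {p : Prog} {s : State} {Q : State → Prop} (h : RunsB O p s Q) {n : ℕ}
    (hn : p.bound ≤ n) : Runs O p n s Q := h.mono hn fun _ h => h

theorem RunsB.skip {s : State} {Q : State → Prop} (h : Q s) : RunsB O .skip s Q := Runs.skip h

theorem RunsB.setIdx {a e : IExp} {s : State} {Q : State → Prop}
    (h : Q (s.putIdx (a.eval s) (e.eval s))) : RunsB O (.setIdx a e) s Q := Runs.setIdx le_rfl h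

theorem RunsB.setReal {a : IExp} {e : RExp} {s : State} {Q : State → Prop}
    (h : Q (s.putReal (a.eval s) (e.eval O s))) : RunsB O (.setReal a e) s Q :=
  Runs.setReal le_rfl h

theorem RunsB.seq {p q : Prog} {s : State} {Q : State → Prop}
    (h : RunsB O p s fun s' => RunsB O q s' Q) : RunsB O (.seq p q) s Q := Runs.seq h

theorem RunsB.ite {b : BExp} {p q : Prog} {s : State} {Q : State → Prop}
    (hp : b.eval O s → RunsB O p s Q) (hq : ¬ b.eval O s → RunsB O q s Q) :
    RunsB O (.ite b p q) s Q :=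
  Runs.ite (fun h => (hp h).le (le_max_left _ _)) fun h => (hq h).le (le_max_right _ _)

theorem RunsB.mono {p : Prog} {s : State} {Q Q' : State → Prop}
    (h : RunsB O p s Q) (hQ : ∀ s', Q s' → Q' s') : RunsB O p s Q' := Runs.mono h le_rfl hQ

end RealRAM

namespace RealRAM

variable {O : Oracle}

/-! ### Prefix sums of the supplies -/

/-- Computes the prefix sums of the supplies. -/
def prefixProg : Prog :=
  .seq (.setIdx 2 0) (.while (.leIdx (reg 2 + 1) (reg 0 * reg 1))
    (.seq (.setReal (slot 1 (reg 2 + 1)) (.load (slot 1 (reg 2)) + .load (reg 2)))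
      (.setIdx 2 (reg 2 + 1))))

/-- The memory during the computation of the tables: the prefix sums `G` are known up to `k`, and
the tables of the dynamic program are empty. -/
structure Prepared (L T : ℕ) (G : ℕ → ℝ) (k : ℕ) (s : State) : Prop where
  rows : s.idx 0 = L
  cols : s.idx 1 = T
  pred : ∀ i, 32 ≤ i → s.idx i = 0
  sums : ∀ i, i ≤ k → s.real (2 * L * T + 4 * i + 1) = G i

/-- The table of flow values is empty. -/
def EmptyTable (L T : ℕ) (s : State) : Prop := ∀ i, s.real (2 * L * T + 4 * i + 2) = 0

/-- The supplies lie below `L * T` and the arrays begin at `2 * L * T`, so no supply is overwritten.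
The prefix sum `G 0 = 0` and the empty flow table are never written; they come from the zeros
granted by `hβ`. -/
theorem runs_prefixProg {L T : ℕ} {β : ℕ → ℝ} (hβ : ∀ i, L * T ≤ i → β i = 0) {s : State}
    (h0 : s.idx 0 = L) (h1 : s.idx 1 = T) (h2 : ∀ i, 2 ≤ i → s.idx i = 0) (h3 : s.real = β) :
    Runs O prefixProg (L * T * 60 + 60) s fun s' =>
      Prepared L T (prefixSum β) (L * T) s' ∧ EmptyTable L T s' := by
  refine (Runs.seq (m := 10) (n := L * T * 60 + 50) (Runs.setIdx (by decide) ?_)).mono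
    (by omega) fun _ h => h
  refine Runs.while_le (c := 45) (N := L * T) (fun k s' => (Prepared L T (prefixSum β) k s' ∧
    EmptyTable L T s') ∧ s'.idx 2 = k ∧ ∀ i < L * T, s'.real i = β i) ?_ ?_ ?_ ?_ ?_ ?_
  · have : (BExp.leIdx (reg 2 + 1) (reg 0 * reg 1)).cost = 10 := by decide
    rw [this]; omega
  · rintro k s hlt ⟨⟨h, -⟩, hk, -⟩
    simp [h.rows, h.cols, hk]; omega
  · rintro s ⟨⟨h, -⟩, hk, -⟩
    simp [h.rows, h.cols, hk]
  · rintro k s hk ⟨⟨h, he⟩, hi, hin⟩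
    refine RunsB.le ?_ (by decide)
    refine RunsB.seq (RunsB.setReal (RunsB.setIdx ?_))
    have hLT : 2 * L * T = L * T + L * T := by ring
    simp only [slot_eval, IExp.eval_add, reg_eval, IExp.eval_ofNat, RExp.eval_add, RExp.eval_load,
      h.rows, h.cols, hi, State.putReal_idx]
    refine ⟨⟨⟨by simp [h.rows], by simp [h.cols], fun i hi => ?_, fun i hik => ?_⟩, fun i => ?_⟩,
      by simp, fun i hi => ?_⟩
    · have : i ≠ 2 := by omega
      simp [this, h.pred i hi]
    · simp only [State.putIdx_real, State.putReal_real]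
      by_cases e : i = k + 1
      · subst e
        rw [if_pos rfl, h.sums k le_rfl, hin k hk, prefixSum, prefixSum, Finset.sum_range_succ]
      · rw [if_neg (by omega)]
        exact h.sums i (by omega)
    · simp only [State.putIdx_real, State.putReal_real]
      rw [if_neg (by omega)]
      exact he i
    · simp only [State.putIdx_real, State.putReal_real]
      rw [if_neg (by omega)]
      exact hin i hi
  · have hLT : 2 * L * T = L * T + L * T := by ring
    simp only [IExp.eval_ofNat]
    refine ⟨⟨⟨by simp [h0], by simp [h1], fun i hi => ?_, fun i hik => ?_⟩, fun i => ?_⟩,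
      by simp, fun i hi => by simp [h3]⟩
    · have : i ≠ 2 := by omega
      simp [this, h2 i (by omega)]
    · obtain rfl : i = 0 := by omega
      simp [h3, prefixSum, hβ (2 * L * T + 1) (by omega)]
    · simp [h3, hβ (2 * L * T + 4 * i + 2) (by omega)]
  · exact fun s h => h.1

/-! ### The number of states -/

/-- The number of intervals for each row. -/
def intervalExp : IExp := (2 * reg 0 - 1) * (1 - (2 - reg 1))

/-- Computes the number of states. -/
def statesProg : Prog :=
  .seq (.setIdx 3 1) (.seq (.setIdx 2 0) (.while (.leIdx (reg 2 + 1) ((reg 0 - 1) * intervalExp))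
    (.seq (.setIdx 3 (reg 3 * (reg 1 * reg 1))) (.setIdx 2 (reg 2 + 1)))))

theorem intervalExp_eval {L T : ℕ} {s : State} (h0 : s.idx 0 = L) (h1 : s.idx 1 = T) :
    intervalExp.eval s = numIntervals L T := by
  simp [intervalExp, numIntervals, h0, h1]

theorem runs_statesProg {L T : ℕ} {G : ℕ → ℝ} {k : ℕ} {s : State} (h : Prepared L T G k s)
    (he : EmptyTable L T s) :
    Runs O statesProg ((L - 1) * numIntervals L T * 60 + 60) s fun s' =>
      Prepared L T G k s' ∧ EmptyTable L T s' ∧ s'.idx 3 = numStates L T := by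
  refine (Runs.seq (m := 5) (n := (L - 1) * numIntervals L T * 60 + 55)
    (Runs.setIdx (by decide) ?_)).mono (by omega) fun _ h => h
  refine (Runs.seq (m := 5) (n := (L - 1) * numIntervals L T * 60 + 50)
    (Runs.setIdx (by decide) ?_)).mono (by omega) fun _ h => h
  refine Runs.while_le (c := 20) (N := (L - 1) * numIntervals L T) (fun i s' => Prepared L T G k s' ∧
    EmptyTable L T s' ∧ s'.idx 3 = (T * T) ^ i ∧ s'.idx 2 = i) ?_ ?_ ?_ ?_ ?_ ?_
  · have : (BExp.leIdx (reg 2 + 1) ((reg 0 - 1) * intervalExp)).cost = 23 := by decide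
    rw [this]; omega
  · rintro i s hi ⟨h, he, h3, h2⟩
    simp [h.rows, h2, intervalExp_eval h.rows h.cols]; omega
  · rintro s ⟨h, he, h3, h2⟩
    simp [h.rows, h2, intervalExp_eval h.rows h.cols]
  · rintro i s hi ⟨h, he, h3, h2⟩
    refine RunsB.le ?_ (by decide)
    refine RunsB.seq (RunsB.setIdx (RunsB.setIdx ?_))
    refine ⟨⟨by simp [h.rows], by simp [h.cols], fun j hj => ?_, by simpa using h.sums⟩,
      by simpa [EmptyTable] using he, by simp [h3, h.cols, pow_succ], by simp [h2]⟩
    have e1 : j ≠ 2 := by omega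
    have e2 : j ≠ 3 := by omega
    simp [e1, e2, h.pred j hj]
  · refine ⟨⟨by simp [h.rows], by simp [h.cols], fun j hj => ?_, by simpa using h.sums⟩,
      by simpa [EmptyTable] using he, by simp, by simp⟩
    have e1 : j ≠ 2 := by omega
    have e2 : j ≠ 3 := by omega
    simp [e1, e2, h.pred j hj]
  · rintro s ⟨h, he, h3, -⟩
    exact ⟨h, he, h3⟩

/-! ### The table of flow values -/

/-- Adds the contribution of the current interval to the current table entry. -/
def accumulateProg : Prog :=
  .seq (.setReal (slot 0 0) (.load (slot 1 (reg 16 * reg 1 + reg 9)) -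
      .load (slot 1 (reg 16 * reg 1 + reg 8))))
  (.seq (.ite (.and (.leIdx (reg 9) (reg 8)) (.leIdx 1 (reg 8)))
      (.setReal (slot 0 0) (.load (slot 0 0) + (.load (slot 1 (reg 16 * reg 1 + reg 1)) -
        .load (slot 1 (reg 16 * reg 1))))) .skip)
    (.ite (.leIdx (reg 5 + 1) (reg 0))
      (.setReal (slot 2 (reg 6 * reg 0 + reg 4))
        (.load (slot 2 (reg 6 * reg 0 + reg 4)) + .load (slot 0 0)))
      (.setReal (slot 2 (reg 6 * reg 0 + reg 4))
        (.load (slot 2 (reg 6 * reg 0 + reg 4)) - .load (slot 0 0)))))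

theorem runs_accumulateProg {L T : ℕ} {G : ℕ → ℝ} {s : State} (h : Prepared L T G (L * T) s)
    (hp : s.idx 8 < T) (hq : s.idx 9 < T) (hk : s.idx 16 < L)
    (hj : s.idx 16 = if s.idx 5 < L then s.idx 5 else s.idx 5 - (L - 1)) :
    RunsB O accumulateProg s fun s' => s'.idx = s.idx ∧
      (∀ i, s'.real (2 * L * T + 4 * i + 1) = s.real (2 * L * T + 4 * i + 1)) ∧
      ∀ i, s'.real (2 * L * T + 4 * i + 2) = s.real (2 * L * T + 4 * i + 2) +
        if i = s.idx 6 * L + s.idx 4 then contrib L T G (s.idx 5) (s.idx 8) (s.idx 9) else 0 := by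
  have hkT : s.idx 16 * T + T ≤ L * T := by
    rw [← Nat.succ_mul]; exact Nat.mul_le_mul_right _ hk
  have g1 := h.sums (s.idx 16 * T + s.idx 9) (by omega)
  have g2 := h.sums (s.idx 16 * T + s.idx 8) (by omega)
  have g3 := h.sums (s.idx 16 * T + T) (by omega)
  have g4 := h.sums (s.idx 16 * T) (by omega)
  refine RunsB.seq (RunsB.setReal (RunsB.seq ?_))
  refine RunsB.mono (Q := fun s' => s'.idx = s.idx ∧
      (∀ i a, 1 ≤ a → a ≤ 2 → s'.real (2 * L * T + 4 * i + a) = s.real (2 * L * T + 4 * i + a)) ∧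
      s'.real (2 * L * T) = cyclicSum T G (s.idx 16) (s.idx 8) (s.idx 9)) ?_ ?_
  · refine RunsB.ite (fun hb => RunsB.setReal ?_) fun hb => RunsB.skip ?_
    · simp at hb
      refine ⟨rfl, fun i a ha ha' => ?_, ?_⟩
      · have e : a ≠ 0 := by omega
        simp [h.rows, h.cols, add_assoc, e]
      · simp only [slot_eval, IExp.eval_add, IExp.eval_mul, reg_eval, IExp.eval_ofNat,
          RExp.eval_add, RExp.eval_sub, RExp.eval_load, h.rows, h.cols, State.putReal_idx,
          State.putReal_real, g1, g2, mul_zero, add_zero, if_true]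
        rw [if_neg (by omega), if_neg (by omega), g3, g4, cyclicSum, if_pos hb]
    · simp at hb
      refine ⟨rfl, fun i a ha ha' => ?_, ?_⟩
      · have e : a ≠ 0 := by omega
        simp [h.rows, h.cols, add_assoc, e]
      · simp only [slot_eval, IExp.eval_add, IExp.eval_mul, reg_eval, IExp.eval_ofNat,
          RExp.eval_sub, RExp.eval_load, h.rows, h.cols,
          State.putReal_real, g1, g2, mul_zero, add_zero, if_true]
        rw [cyclicSum, if_neg (by omega), add_zero]
  · rintro s' ⟨hi, hr, hD⟩
    have key : ∀ v : ℝ, v = contrib L T G (s.idx 5) (s.idx 8) (s.idx 9) →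
        (fun s' : State => s'.idx = s.idx ∧
      (∀ i, s'.real (2 * L * T + 4 * i + 1) = s.real (2 * L * T + 4 * i + 1)) ∧
      ∀ i, s'.real (2 * L * T + 4 * i + 2) = s.real (2 * L * T + 4 * i + 2) +
        if i = s.idx 6 * L + s.idx 4 then contrib L T G (s.idx 5) (s.idx 8) (s.idx 9) else 0)
        (s'.putReal (2 * L * T + 4 * (s.idx 6 * L + s.idx 4) + 2)
          (s.real (2 * L * T + 4 * (s.idx 6 * L + s.idx 4) + 2) + v)) := by
      rintro v rfl
      refine ⟨hi, fun i => ?_, fun i => ?_⟩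
      · rw [State.putReal_real, if_neg (by omega), hr i 1 le_rfl (by omega)]
      · rw [State.putReal_real]
        by_cases e : i = s.idx 6 * L + s.idx 4
        · subst e; rw [if_pos rfl, if_pos rfl]
        · rw [if_neg (by omega), if_neg e, add_zero, hr i 2 (by omega) le_rfl]
    have hX := hr (s.idx 6 * L + s.idx 4) 2 (by omega) le_rfl
    refine RunsB.ite (fun hb => RunsB.setReal ?_) fun hb => RunsB.setReal ?_
    · simp only [BExp.eval_leIdx, IExp.eval_add, reg_eval, IExp.eval_ofNat, hi, h.rows] at hb
      simp only [slot_eval, IExp.eval_add, IExp.eval_mul, reg_eval, IExp.eval_ofNat,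
        RExp.eval_add, RExp.eval_load, hi, h.rows, h.cols, hX, mul_zero, add_zero, hD]
      refine key _ ?_
      rw [contrib, if_pos (by omega), hj, if_pos (by omega)]
    · simp only [BExp.eval_leIdx, IExp.eval_add, reg_eval, IExp.eval_ofNat, hi, h.rows] at hb
      simp only [slot_eval, IExp.eval_add, IExp.eval_mul, reg_eval, IExp.eval_ofNat,
        RExp.eval_sub, RExp.eval_load, hi, h.rows, h.cols, hX, mul_zero, add_zero, hD,
        sub_eq_add_neg]
      refine key _ ?_
      rw [contrib, if_neg (by omega), hj, if_neg (by omega)]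

/-- Advances to the next state and updates its digits. -/
def advanceProg : Prog :=
  .seq (.setIdx 6 (reg 6 + 1)) (.seq (.setIdx 7 (reg 7 + 1)) (.ite (.leIdx (reg 10) (reg 7))
    (.seq (.setIdx 7 0) (.seq (.setIdx 8 (reg 8 + 1)) (.ite (.leIdx (reg 1) (reg 8))
      (.seq (.setIdx 8 0) (.seq (.setIdx 9 (reg 9 + 1)) (.ite (.leIdx (reg 1) (reg 9))
        (.setIdx 9 0) .skip))) .skip))) .skip))

/-- The machine cannot divide natural numbers. While the states are run through in order, the digits
of the current one are therefore maintained by carrying. -/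
theorem odometer {m : ℕ} (hm : 0 < m) (n : ℕ) :
    (m ≤ n % m + 1 → (n + 1) % m = 0 ∧ (n + 1) / m = n / m + 1) ∧
    (¬ m ≤ n % m + 1 → (n + 1) % m = n % m + 1 ∧ (n + 1) / m = n / m) := by
  have h1 := Nat.div_add_mod n m
  have h2 := Nat.mod_lt n hm
  constructor
  · intro h
    have : (n + 1) / m = n / m + 1 ∧ (n + 1) % m = 0 :=
      (Nat.div_mod_unique hm).2 ⟨by rw [Nat.mul_add]; omega, hm⟩
    exact this.symm
  · intro h
    have : (n + 1) / m = n / m ∧ (n + 1) % m = n % m + 1 :=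
      (Nat.div_mod_unique hm).2 ⟨by omega, by omega⟩
    exact this.symm

theorem runs_advanceProg {P T n : ℕ} (hP : 0 < P) (hT : 0 < T) {s : State} (h1 : s.idx 1 = T)
    (h10 : s.idx 10 = P) (h6 : s.idx 6 = n) (h7 : s.idx 7 = n % P) (h8 : s.idx 8 = n / P % T)
    (h9 : s.idx 9 = n / (P * T) % T) :
    RunsB O advanceProg s fun s' => s'.real = s.real ∧
      (∀ i, i ≠ 6 → i ≠ 7 → i ≠ 8 → i ≠ 9 → s'.idx i = s.idx i) ∧ s'.idx 6 = n + 1 ∧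
      s'.idx 7 = (n + 1) % P ∧ s'.idx 8 = (n + 1) / P % T ∧ s'.idx 9 = (n + 1) / (P * T) % T := by
  rw [← Nat.div_div_eq_div_mul] at h9 ⊢
  obtain ⟨o1, o1'⟩ := odometer hP n
  obtain ⟨o2, o2'⟩ := odometer hT (n / P)
  obtain ⟨o3, o3'⟩ := odometer hT (n / P / T)
  refine RunsB.seq (RunsB.setIdx (RunsB.seq (RunsB.setIdx (RunsB.ite (fun hb => ?_) fun hb => ?_))))
  · simp [h10, h7] at hb
    refine RunsB.seq (RunsB.setIdx (RunsB.seq (RunsB.setIdx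
      (RunsB.ite (fun hb' => ?_) fun hb' => ?_))))
    · simp [h1, h8] at hb'
      refine RunsB.seq (RunsB.setIdx (RunsB.seq (RunsB.setIdx
        (RunsB.ite (fun hb'' => ?_) fun hb'' => ?_))))
      · simp [h1, h9] at hb''
        refine RunsB.setIdx ⟨rfl, fun i a b c d => by simp [a, b, c, d], ?_⟩
        simp [h6, (o1 hb).1, (o1 hb).2, (o2 hb').1, (o2 hb').2, (o3 hb'').1]
      · simp only [BExp.eval_leIdx, not_le] at hb''
        simp [h1, h9] at hb''
        refine RunsB.skip ⟨rfl, fun i a b c d => by simp [a, b, c, d], ?_⟩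
        simp [h6, h9, (o1 hb).1, (o1 hb).2, (o2 hb').1, (o2 hb').2, (o3' (by omega)).1]
    · simp [h1, h8] at hb'
      refine RunsB.skip ⟨rfl, fun i a b c d => by simp [a, b, c], ?_⟩
      simp [h6, h8, h9, (o1 hb).1, (o1 hb).2, (o2' (by omega)).1, (o2' (by omega)).2]
  · simp [h10, h7] at hb
    refine RunsB.skip ⟨rfl, fun i a b c d => by simp [a, b], ?_⟩
    simp [h6, h7, h8, h9, (o1' (by omega)).1, (o1' (by omega)).2]

/-- Computes the table of flow values of the states. -/
def tableProg : Prog :=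
  .seq (.setIdx 10 1) (.seq (.setIdx 4 1) (.while (.leIdx (reg 4 + 1) (reg 0))
    (.seq (.seq (.setIdx 5 0) (.while (.leIdx (reg 5 + 1) intervalExp)
      (.seq (.setIdx 16 (reg 5 - (reg 0 - 1) * (1 - (reg 0 - reg 5))))
      (.seq (.setIdx 6 0) (.seq (.setIdx 7 0) (.seq (.setIdx 8 0) (.seq (.setIdx 9 0)
      (.seq (.while (.leIdx (reg 6 + 1) (reg 3)) (.seq accumulateProg advanceProg))
      (.seq (.setIdx 10 (reg 10 * (reg 1 * reg 1))) (.setIdx 5 (reg 5 + 1)))))))))))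
    (.setIdx 4 (reg 4 + 1)))))

/-- Address of a table entry. -/
theorem table_addr_inj {L s l s' l' : ℕ} (hl : l < L) (hl' : l' < L) :
    s * L + l = s' * L + l' ↔ s = s' ∧ l = l' := by
  refine ⟨fun h => ?_, fun h => by rw [h.1, h.2]⟩
  have h1 : (s * L + l) / L = s := by
    rw [Nat.mul_comm, Nat.mul_add_div (by omega), Nat.div_eq_of_lt hl, add_zero]
  have h2 : (s' * L + l') / L = s' := by
    rw [Nat.mul_comm, Nat.mul_add_div (by omega), Nat.div_eq_of_lt hl', add_zero]
  have : s = s' := by rw [← h1, ← h2, h]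
  subst this
  exact ⟨rfl, by omega⟩

/-- The table contains the first `N s` contributions in row `l`, all contributions in the rows before
`l` and none in the rows after it. -/
def PartialTable (L T : ℕ) (G : ℕ → ℝ) (l : ℕ) (N : ℕ → ℕ) (s : State) : Prop :=
  ∀ n < numStates L T, ∀ l', 1 ≤ l' → l' < L → s.real (2 * L * T + 4 * (n * L + l') + 2) =
    if l' < l then entry L T G n l'
    else if l' = l then ∑ j ∈ Finset.range (N n), entryTerm L T G n l' j else 0

theorem numIntervals_le (L T : ℕ) : numIntervals L T ≤ 2 * L - 1 := by
  unfold numIntervals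
  calc _ ≤ (2 * L - 1) * 1 := Nat.mul_le_mul_left _ (by omega)
    _ = _ := mul_one _

theorem Prepared.of_idx {L T : ℕ} {G : ℕ → ℝ} {k : ℕ} {s s' : State} (h : Prepared L T G k s)
    (h0 : s'.idx 0 = s.idx 0) (h1 : s'.idx 1 = s.idx 1) (h2 : ∀ i, 32 ≤ i → s'.idx i = s.idx i)
    (hr : ∀ i, s'.real (2 * L * T + 4 * i + 1) = s.real (2 * L * T + 4 * i + 1)) :
    Prepared L T G k s' :=
  ⟨h0.trans h.rows, h1.trans h.cols, fun i hi => (h2 i hi).trans (h.pred i hi),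
    fun i hi => (hr i).trans (h.sums i hi)⟩

theorem runs_table_column {L T : ℕ} (hT : 0 < T) {G : ℕ → ℝ} {l j : ℕ} (hl : 1 ≤ l) (hlL : l < L)
    (hj : j < numIntervals L T) {s : State} (h : Prepared L T G (L * T) s)
    (hM : s.idx 3 = numStates L T) (h4 : s.idx 4 = l) (h5 : s.idx 5 = j)
    (h10 : s.idx 10 = (T * T) ^ ((l - 1) * numIntervals L T + j))
    (h16 : s.idx 16 = if j < L then j else j - (L - 1))
    (h6 : s.idx 6 = 0) (h7 : s.idx 7 = 0) (h8 : s.idx 8 = 0) (h9 : s.idx 9 = 0)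
    (htab : PartialTable L T G l (fun _ => j) s) :
    Runs O (.while (.leIdx (reg 6 + 1) (reg 3)) (.seq accumulateProg advanceProg))
      (numStates L T * 400 + 10) s fun s' => Prepared L T G (L * T) s' ∧
        PartialTable L T G l (fun _ => j + 1) s' ∧
        ∀ i, i ≠ 6 → i ≠ 7 → i ≠ 8 → i ≠ 9 → s'.idx i = s.idx i := by
  set P := (T * T) ^ ((l - 1) * numIntervals L T + j) with hP
  have hPpos : 0 < P := Nat.pow_pos (Nat.mul_pos hT hT)
  -- After `n` rounds exactly the states below `n` have received their `j`-th contribution in row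
  -- `l`; registers 7, 8 and 9 hold the remainder modulo `P` and the two digits of the current
  -- interval.
  refine Runs.while_le (c := 390) (N := numStates L T) (fun n s' => (Prepared L T G (L * T) s' ∧
    PartialTable L T G l (fun m => if m < n then j + 1 else j) s' ∧
    ∀ i, i ≠ 6 → i ≠ 7 → i ≠ 8 → i ≠ 9 → s'.idx i = s.idx i) ∧ s'.idx 6 = n ∧ s'.idx 7 = n % P ∧
    s'.idx 8 = n / P % T ∧ s'.idx 9 = n / (P * T) % T) ?_ ?_ ?_ ?_ ?_ ?_
  · have : (BExp.leIdx (reg 6 + 1) (reg 3)).cost = 7 := by decide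
    rw [this]; omega
  · rintro n s' hn ⟨⟨-, -, hi⟩, h6, -⟩
    simp [h6, hi 3, hM]; omega
  · rintro s' ⟨⟨-, -, hi⟩, h6, -⟩
    simp [h6, hi 3, hM]
  · rintro n s₁ hn ⟨⟨hp, ht, hi⟩, e6, e7, e8, e9⟩
    refine RunsB.le ?_ (by decide)
    refine RunsB.seq ?_
    have e5 : s₁.idx 5 = j := by rw [hi 5 (by omega) (by omega) (by omega) (by omega), h5]
    have e4 : s₁.idx 4 = l := by rw [hi 4 (by omega) (by omega) (by omega) (by omega), h4]
    have e16 : s₁.idx 16 = if j < L then j else j - (L - 1) := by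
      rw [hi 16 (by omega) (by omega) (by omega) (by omega), h16]
    have e1 := hp.cols
    have e10 : s₁.idx 10 = P := by rw [hi 10 (by omega) (by omega) (by omega) (by omega), h10]
    have hJ := numIntervals_le L T
    refine (runs_accumulateProg hp (by rw [e8]; exact Nat.mod_lt _ hT)
      (by rw [e9]; exact Nat.mod_lt _ hT) (by rw [e16]; split_ifs <;> omega)
      (by rw [e5, e16])).mono ?_
    rintro s₂ ⟨hi₂, hr₁, hr₂⟩
    refine (runs_advanceProg (n := n) hPpos hT (by rw [hi₂, e1]) (by rw [hi₂, e10])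
      (by rw [hi₂, e6]) (by rw [hi₂, e7]) (by rw [hi₂, e8]) (by rw [hi₂, e9])).mono ?_
    rintro s₃ ⟨hr, hi₃, f6, f7, f8, f9⟩
    refine ⟨⟨hp.of_idx ?_ ?_ ?_ ?_, ?_, ?_⟩, f6, f7, f8, f9⟩
    · rw [hi₃ 0 (by omega) (by omega) (by omega) (by omega), hi₂]
    · rw [hi₃ 1 (by omega) (by omega) (by omega) (by omega), hi₂]
    · intro i hi'
      rw [hi₃ i (by omega) (by omega) (by omega) (by omega), hi₂]
    · intro i; rw [hr, hr₁]
    · intro m hm l' h1 h2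
      rw [hr, hr₂, ht m hm l' h1 h2, e6, e4, e5, e8, e9]
      by_cases c1 : l' < l
      · have : ¬ (m * L + l' = n * L + l) := by
          rw [table_addr_inj h2 hlL]; omega
        rw [if_pos c1, if_pos c1, if_neg this, add_zero]
      · by_cases c2 : l' = l
        · subst c2
          simp only [if_neg c1, if_true, table_addr_inj h2 h2, and_true]
          by_cases c3 : m = n
          · subst c3
            rw [if_pos rfl, if_neg (by omega), if_pos (by omega), Finset.sum_range_succ]
            rfl
          · rw [if_neg c3, add_zero]
            congr 2
            by_cases c4 : m < n
            · rw [if_pos c4, if_pos (by omega)]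
            · rw [if_neg c4, if_neg (by omega)]
        · have : ¬ (m * L + l' = n * L + l) := by
            rw [table_addr_inj h2 hlL]; omega
          rw [if_neg c1, if_neg c1, if_neg c2, if_neg c2, if_neg this, add_zero]
    · intro i a b c d
      rw [hi₃ i a b c d, hi₂, hi i a b c d]
  · refine ⟨⟨h, ?_, fun _ _ _ _ _ => rfl⟩, h6, by simp [h7], by simp [h8], by simp [h9]⟩
    simpa using htab
  · rintro s' ⟨⟨hp, ht, hi⟩, -⟩
    refine ⟨hp, fun m hm l' h1 h2 => ?_, hi⟩
    simpa [hm] using ht m hm l' h1 h2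

theorem runs_tableProg {L T : ℕ} (hL : 0 < L) (hT : 0 < T) {G : ℕ → ℝ} {s : State}
    (h : Prepared L T G (L * T) s) (he : EmptyTable L T s) (hM : s.idx 3 = numStates L T) :
    Runs O tableProg ((L - 1) * (numIntervals L T * (numStates L T * 400 + 150) + 50) + 50) s
      fun s' => Prepared L T G (L * T) s' ∧ s'.idx 3 = numStates L T ∧
        ∀ n < numStates L T, ∀ l, 1 ≤ l → l < L →
          s'.real (2 * L * T + 4 * (n * L + l) + 2) = entry L T G n l := by
  set J := numIntervals L T with hJ
  set M := numStates L T with hMdef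
  refine (Runs.seq (m := 5) (n := (L - 1) * (J * (M * 400 + 150) + 50) + 45)
    (Runs.setIdx (by decide) ?_)).mono (by omega) fun _ h => h
  refine (Runs.seq (m := 5) (n := (L - 1) * (J * (M * 400 + 150) + 50) + 40)
    (Runs.setIdx (by decide) ?_)).mono (by omega) fun _ h => h
  simp only [IExp.eval_ofNat]
  refine Runs.while_le (c := J * (M * 400 + 150) + 42) (N := L - 1)
    (fun k s' => (Prepared L T G (L * T) s' ∧ PartialTable L T G (k + 1) (fun _ => 0) s' ∧
      s'.idx 3 = M) ∧ s'.idx 4 = k + 1 ∧ s'.idx 10 = (T * T) ^ (k * J)) ?_ ?_ ?_ ?_ ?_ ?_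
  · have : (BExp.leIdx (reg 4 + 1) (reg 0)).cost = 7 := by decide
    rw [this, show 1 + 7 + (J * (M * 400 + 150) + 42) = J * (M * 400 + 150) + 50 by omega]
    omega
  · rintro k s' hk ⟨⟨hp, -, -⟩, h4, -⟩
    simp [hp.rows, h4]; omega
  · rintro s' ⟨⟨hp, -, -⟩, h4, -⟩
    simp [hp.rows, h4]; omega
  · rintro k s₁ hk ⟨⟨hp, ht, h3⟩, h4, h10⟩
    refine (Runs.seq (m := J * (M * 400 + 150) + 32) (n := 10) ?_).mono (by omega) fun _ h => h
    refine (Runs.seq (m := 5) (n := J * (M * 400 + 150) + 27)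
      (Runs.setIdx (by decide) ?_)).mono (by omega) fun _ h => h
    simp only [IExp.eval_ofNat]
    refine Runs.while_le (c := M * 400 + 128) (N := J)
      (fun j s' => (Prepared L T G (L * T) s' ∧ PartialTable L T G (k + 1) (fun _ => j) s' ∧
      s'.idx 3 = M) ∧ s'.idx 4 = k + 1 ∧ s'.idx 10 = (T * T) ^ (k * J + j) ∧ s'.idx 5 = j)
      ?_ ?_ ?_ ?_ ?_ ?_
    · have : (BExp.leIdx (reg 5 + 1) intervalExp).cost = 18 := by decide
      rw [this, show 1 + 18 + (M * 400 + 128) = M * 400 + 147 by omega]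
      exact Nat.add_le_add (Nat.mul_le_mul_left J (by omega)) (by decide)
    · rintro j s' hj ⟨⟨hp, -, -⟩, -, -, h5⟩
      simp [intervalExp_eval hp.rows hp.cols, h5, ← hJ]; omega
    · rintro s' ⟨⟨hp, -, -⟩, -, -, h5⟩
      simp [intervalExp_eval hp.rows hp.cols, h5, ← hJ]
    · rintro j s₂ hj ⟨⟨hp, ht, h3⟩, h4, h10, h5⟩
      have hJ' := numIntervals_le L T
      refine (Runs.seq (m := 25) (n := M * 400 + 100)
        (Runs.setIdx (by decide) ?_)).mono (by omega) fun _ h => h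
      refine (Runs.seq (m := 5) (n := M * 400 + 90)
        (Runs.setIdx (by decide) ?_)).mono (by omega) fun _ h => h
      refine (Runs.seq (m := 5) (n := M * 400 + 80)
        (Runs.setIdx (by decide) ?_)).mono (by omega) fun _ h => h
      refine (Runs.seq (m := 5) (n := M * 400 + 70)
        (Runs.setIdx (by decide) ?_)).mono (by omega) fun _ h => h
      refine (Runs.seq (m := 5) (n := M * 400 + 60)
        (Runs.setIdx (by decide) ?_)).mono (by omega) fun _ h => h
      refine (Runs.seq (m := M * 400 + 10) (n := 40) ?_).mono (by omega) fun _ h => h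
      simp only [IExp.eval_ofNat, IExp.eval_sub, IExp.eval_mul, reg_eval, hp.rows, h5]
      refine (runs_table_column hT (l := k + 1) (j := j) (by omega) (by omega) hj
        (hp.of_idx (by simp) (by simp) (fun i hi => ?_) (fun i => by simp)) (by simp [h3, hMdef])
        (by simp [h4]) (by simp [h5]) (by simp [h10, hJ]) ?_ (by simp) (by simp) (by simp)
        (by simp) (fun n hn l' h1 h2 => by simpa using ht n hn l' h1 h2)).mono le_rfl ?_
      · have e1 : i ≠ 6 := by omega
        have e2 : i ≠ 7 := by omega
        have e3 : i ≠ 8 := by omega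
        have e4 : i ≠ 9 := by omega
        have e5 : i ≠ 16 := by omega
        simp [e1, e2, e3, e4, e5]
      -- Truncated subtraction replaces a branch: `1 - (L - j)` is `0` for `j < L` and `1`
      -- otherwise.
      · simp only [State.putIdx_idx]
        norm_num
        split_ifs with c
        · rw [show 1 - (L - j) = 0 by omega]; simp
        · rw [show 1 - (L - j) = 1 by omega]; simp
      · rintro s₃ ⟨hp₃, ht₃, hi₃⟩
        simp only [State.putIdx_idx] at hi₃
        have f3 := hi₃ 3 (by omega) (by omega) (by omega) (by omega)
        have f4 := hi₃ 4 (by omega) (by omega) (by omega) (by omega)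
        have f5 := hi₃ 5 (by omega) (by omega) (by omega) (by omega)
        have f10 := hi₃ 10 (by omega) (by omega) (by omega) (by omega)
        norm_num at f3 f4 f5 f10
        refine RunsB.le ?_ (by decide)
        refine RunsB.seq (RunsB.setIdx (RunsB.setIdx ?_))
        refine ⟨⟨hp₃.of_idx (by simp) (by simp) (fun i hi => ?_) (fun i => by simp),
          fun n hn l' h1 h2 => by simpa using ht₃ n hn l' h1 h2, by simp [f3, h3]⟩,
          by simp [f4, h4], ?_, by simp [f5, h5]⟩
        · have e1 : i ≠ 5 := by omega
          have e2 : i ≠ 10 := by omega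
          simp [e1, e2]
        · simp [f10, h10, hp₃.cols]
          ring
    · refine ⟨⟨hp.of_idx (by simp) (by simp) (fun i hi => ?_) (fun i => by simp),
        fun n hn l' h1 h2 => by simpa using ht n hn l' h1 h2, by simp [h3]⟩, by simp [h4],
        by simp [h10], by simp⟩
      have e1 : i ≠ 5 := by omega
      simp [e1]
    · rintro s₃ ⟨⟨hp₃, ht₃, h3₃⟩, h4₃, h10₃, h5₃⟩
      refine Runs.setIdx (by decide) ?_
      refine ⟨⟨hp₃.of_idx (by simp) (by simp) (fun i hi => ?_) (fun i => by simp),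
        fun n hn l' h1 h2 => ?_, by simp [h3₃]⟩, by simp [h4₃], ?_⟩
      · have e1 : i ≠ 4 := by omega
        simp [e1]
      · rw [State.putIdx_real, ht₃ n hn l' h1 h2]
        by_cases c1 : l' < k + 1
        · rw [if_pos c1, if_pos (by omega)]
        · by_cases c2 : l' = k + 1
          · rw [if_neg c1, if_pos c2, if_pos (by omega), entry]
          · rw [if_neg c1, if_neg c2, if_neg (by omega), Finset.sum_range_zero]
            simp
      · simp [h10₃]; ring
  · refine ⟨⟨h.of_idx (by simp) (by simp) (fun i hi => ?_) (fun i => by simp),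
      fun n hn l' h1 h2 => ?_, by simp [hM]⟩, by simp, by simp⟩
    · have e1 : i ≠ 4 := by omega
      have e2 : i ≠ 10 := by omega
      simp [e1, e2]
    · rw [if_neg (by omega), Finset.sum_range_zero]
      simpa using he (n * L + l')
  · rintro s' ⟨⟨hp, ht, h3⟩, -⟩
    refine ⟨hp, h3, fun n hn l h1 h2 => ?_⟩
    rw [ht n hn l h1 h2, if_pos (by omega)]

end RealRAM

namespace RealRAM

variable {O : Oracle}

theorem RunsB.setReal_eq {a : IExp} {e : RExp} {s : State} {Q : State → Prop} {ad : ℕ} {v : ℝ}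
    (ha : a.eval s = ad) (hv : e.eval O s = v) (h : Q (s.putReal ad v)) :
    RunsB O (.setReal a e) s Q := RunsB.setReal (by rw [ha, hv]; exact h)

/-! ### Evaluation of a transition -/

/-- The tables used by the dynamic program. -/
structure Tables (L T M : ℕ) (G : ℕ → ℝ) (X : ℕ → ℕ → ℝ) (s : State) : Prop where
  rows : s.idx 0 = L
  cols : s.idx 1 = T
  states : s.idx 3 = M
  sums : ∀ i, i ≤ L * T → s.real (2 * L * T + 4 * i + 1) = G i
  flows : ∀ n < M, ∀ l, 1 ≤ l → l < L → s.real (2 * L * T + 4 * (n * L + l) + 2) = X n l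

/-- Only the output registers of column `t`, the scratch register and two index registers have
changed. -/
structure ColumnFrame (L T t : ℕ) (s s' : State) : Prop where
  idx : ∀ i, i ≠ 14 → i ≠ 15 → s'.idx i = s.idx i
  arrays : ∀ i a, 1 ≤ a → a ≤ 3 → s'.real (2 * L * T + 4 * i + a) = s.real (2 * L * T + 4 * i + a)
  columns : ∀ l t', l < 2 * L → t' < T → t' ≠ t → s'.real (l * T + t') = s.real (l * T + t')

theorem ColumnFrame.tables {L T M t : ℕ} {G : ℕ → ℝ} {X : ℕ → ℕ → ℝ} {s s' : State}
    (h : ColumnFrame L T t s s') (hs : Tables L T M G X s) : Tables L T M G X s' where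
  rows := (h.idx 0 (by omega) (by omega)).trans hs.rows
  cols := (h.idx 1 (by omega) (by omega)).trans hs.cols
  states := (h.idx 3 (by omega) (by omega)).trans hs.states
  sums i hi := (h.arrays i 1 (by omega) (by omega)).trans (hs.sums i hi)
  flows n hn l h1 h2 := (h.arrays _ 2 (by omega) (by omega)).trans (hs.flows n hn l h1 h2)

/-- The flow of the arcs of one row and column, as determined by the states before and after the
column. -/
def columnBody : Prog :=
  .seq (.setIdx 14 (reg 14 - 1))
  (.seq (.setReal (reg 14 * reg 1 + reg 11) (.load (slot 2 (reg 12 * reg 0 + reg 14))))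
  (.seq (.setReal ((reg 0 + reg 14 - 1) * reg 1 + reg 11)
    (.load ((reg 0 + reg 14) * reg 1 + reg 11) + (.load (slot 2 (reg 12 * reg 0 + reg 14)) -
      .load (slot 2 (reg 13 * reg 0 + reg 14)) - (.load (slot 1 (reg 14 * reg 1 + reg 11 + 1)) -
        .load (slot 1 (reg 14 * reg 1 + reg 11))))))
  (.seq (.setReal (reg 11) (.load (reg 11) - (.load (slot 2 (reg 12 * reg 0 + reg 14)) -
      (.load (slot 1 (reg 14 * reg 1 + (reg 11 + 1))) - .load (slot 1 (reg 14 * reg 1))))))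
  (.seq (.setReal (slot 0 0) (.load (slot 0 0) + (.query .forward (reg 14) (reg 11)
        (.load (reg 14 * reg 1 + reg 11)) + .query .downward (reg 14 - 1) (reg 11)
        (.load ((reg 0 + reg 14 - 1) * reg 1 + reg 11)))))
    (.ite (.and (.leReal (.const 0) (.load (reg 14 * reg 1 + reg 11)))
      (.leReal (.const 0) (.load ((reg 0 + reg 14 - 1) * reg 1 + reg 11)))) .skip
      (.setIdx 15 0))))))

/-- The flow in one column, its cost, and the test whether it is nonnegative. -/
def columnProg : Prog :=
  .seq (.seq (.setReal ((reg 0 + reg 0 - 1) * reg 1 + reg 11) (.const 0))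
    (.seq (.setReal (reg 11) (.load (slot 1 (reg 11 + 1))))
    (.seq (.setReal (slot 0 0) (.const 0)) (.seq (.setIdx 15 1) (.setIdx 14 (reg 0))))))
  (.seq (.while (.leIdx 2 (reg 14)) columnBody)
    (.seq (.setReal (slot 0 0) (.load (slot 0 0) + .query .forward 0 (reg 11) (.load (reg 11))))
      (.ite (.leReal (.const 0) (.load (reg 11))) .skip (.setIdx 15 0))))

/-- The flows of the rows from `l` on are known. -/
structure ColumnInv (L T : ℕ) (G : ℕ → ℝ) (X : ℕ → ℕ → ℝ) (O : Oracle) (t a a' l : ℕ)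
    (s s' : State) : Prop where
  frame : ColumnFrame L T t s s'
  row : s'.idx 14 = l
  fwd : ∀ k, l ≤ k → k < L → s'.real (k * T + t) = X a' k
  down : ∀ k, l ≤ k → k ≤ L → s'.real ((L + k - 1) * T + t) = vertFlow L T G X t a a' k
  top : s'.real t =
    G (t + 1) - ∑ k ∈ Finset.Ico l L, (X a' k - (G (k * T + (t + 1)) - G (k * T)))
  cost : s'.real (2 * L * T) = ∑ k ∈ Finset.Ico l L, (O .forward k t (X a' k) +
    O .downward (k - 1) t (vertFlow L T G X t a a' k))
  ok : s'.idx 15 = 1 ↔ ∀ k, l ≤ k → k < L → 0 ≤ X a' k ∧ 0 ≤ vertFlow L T G X t a a' k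

theorem row_addr_lt {L T t k : ℕ} (ht : t < T) (hk : k < L) : k * T + t < L * T := by
  have : (k + 1) * T ≤ L * T := Nat.mul_le_mul_right _ hk
  rw [Nat.succ_mul] at this
  omega

/-- Rows are processed from the bottom up, as the flow into row `l` from above is the flow into row
`l + 1` plus the local balance. Output registers serve as working memory: the flow into row `l` is
kept at `(L + l - 1) * T + t`, the register of the arc with tail in row `l - 1`. -/
theorem runs_columnBody {L T M : ℕ} {G : ℕ → ℝ} {X : ℕ → ℕ → ℝ} {s s' : State}
    (hs : Tables L T M G X s) {t a a' l : ℕ} (ht : t < T) (ha : a < M) (ha' : a' < M)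
    (h11 : s.idx 11 = t) (h12 : s.idx 12 = a') (h13 : s.idx 13 = a) (hl : 1 ≤ l) (hlL : l < L)
    (h : ColumnInv L T G X O t a a' (l + 1) s s') :
    RunsB O columnBody s' (ColumnInv L T G X O t a a' l s) := by
  have hT0 : T ≠ 0 := by omega
  have tb := h.frame.tables hs
  have e0 := tb.rows
  have e1 := tb.cols
  have e11 : s'.idx 11 = t := (h.frame.idx 11 (by omega) (by omega)).trans h11
  have e12 : s'.idx 12 = a' := (h.frame.idx 12 (by omega) (by omega)).trans h12
  have e13 : s'.idx 13 = a := (h.frame.idx 13 (by omega) (by omega)).trans h13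
  have e14 := h.row
  have hD : 2 * L * T = L * T + L * T := by ring
  have b1 := row_addr_lt ht hlL
  have b2 : (L + l - 1) * T + t < 2 * L * T := row_addr_lt ht (by omega)
  have b3 : L * T ≤ (L + l - 1) * T + t :=
    (Nat.mul_le_mul_right T (show L ≤ L + l - 1 by omega)).trans (Nat.le_add_right _ _)
  have b4 : (L + l) * T = (L + l - 1) * T + T := by
    rw [← Nat.succ_mul]; congr 1; omega
  have b5 : T ≤ l * T := Nat.le_mul_of_pos_left _ hl
  have n1 : ∀ i c, 2 * L * T + 4 * i + c ≠ l * T + t := fun i c => by omega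
  have n2 : ∀ i c, 2 * L * T + 4 * i + c ≠ (L + l - 1) * T + t := fun i c => by omega
  have n3 : ∀ i c, 2 * L * T + 4 * i + c ≠ t := fun i c => by omega
  have n1' : 2 * L * T ≠ l * T + t := by omega
  have n2' : 2 * L * T ≠ (L + l - 1) * T + t := by omega
  have n3' : 2 * L * T ≠ t := by omega
  have n4 : (L + l) * T + t ≠ l * T + t := by omega
  have n5 : t ≠ (L + l - 1) * T + t := by omega
  have n6 : t ≠ l * T + t := by omega
  have n7 : l * T + t ≠ (L + l - 1) * T + t := by omega
  have n8 : l * T + t ≠ t := by omega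
  have n9 : (L + l - 1) * T + t ≠ t := by omega
  have n10 : l * T + t ≠ 2 * L * T := n1'.symm
  have n11 : (L + l - 1) * T + t ≠ 2 * L * T := n2'.symm
  have x1 := tb.flows a' ha' l hl hlL
  have x2 := tb.flows a ha l hl hlL
  have g1 := tb.sums (l * T + t + 1) (by omega)
  have g2 := tb.sums (l * T + t) (by omega)
  have g3 := tb.sums (l * T) (by omega)
  have y1 : s'.real ((L + l) * T + t) = vertFlow L T G X t a a' (l + 1) := by
    have := h.down (l + 1) le_rfl hlL
    rwa [show L + (l + 1) - 1 = L + l by omega] at this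
  have z1 := h.top
  have c1 := h.cost
  refine RunsB.seq (RunsB.setIdx (RunsB.seq ?_))
  simp only [IExp.eval_ofNat, IExp.eval_sub, reg_eval, e14, Nat.add_sub_cancel]
  refine RunsB.setReal_eq (ad := l * T + t) (v := X a' l) (by simp [e1, e11])
    (by simp [e0, e1, e12, x1]) (RunsB.seq ?_)
  refine RunsB.setReal_eq (ad := (L + l - 1) * T + t) (v := vertFlow L T G X t a a' l)
    (by simp [e0, e1, e11]) ?_ (RunsB.seq ?_)
  · rw [vertFlow_of_lt _ _ _ _ _ hlL]
    simp [e0, e1, e11, e12, e13, n1, n4, x1, x2, y1, g1, g2, -mul_eq_mul_right_iff,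
      -Nat.add_right_cancel_iff, -add_left_inj]
  refine RunsB.setReal_eq (ad := t) (v := G (t + 1) - ∑ k ∈ Finset.Ico l L,
    (X a' k - (G (k * T + (t + 1)) - G (k * T)))) (by simp [e11]) ?_ (RunsB.seq ?_)
  · rw [Finset.sum_eq_sum_Ico_succ_bot hlL]
    set u := ((s'.putIdx 14 l).putReal (l * T + t) (X a' l)).putReal ((L + l - 1) * T + t)
      (vertFlow L T G X t a a' l) with hu
    have u0 : u.idx 0 = L := by simp [hu, e0]
    have u1 : u.idx 1 = T := by simp [hu, e1]
    have u11 : u.idx 11 = t := by simp [hu, e11]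
    have u12 : u.idx 12 = a' := by simp [hu, e12]
    have u14 : u.idx 14 = l := by simp [hu]
    have ur : ∀ i, i ≠ l * T + t → i ≠ (L + l - 1) * T + t → u.real i = s'.real i :=
      fun i h1 h2 => by simp only [hu, State.putReal_real, if_neg h1, if_neg h2, State.putIdx_real]
    change u.real (u.idx 11) - (u.real (2 * u.idx 0 * u.idx 1 + 4 * (u.idx 12 * u.idx 0 +
      u.idx 14) + 2) - (u.real (2 * u.idx 0 * u.idx 1 + 4 * (u.idx 14 * u.idx 1 +
      (u.idx 11 + 1)) + 1) - u.real (2 * u.idx 0 * u.idx 1 + 4 * (u.idx 14 * u.idx 1) + 1))) = _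
    rw [u0, u1, u11, u12, u14, ur _ n6 n5, ur _ (n1 _ _) (n2 _ _), ur _ (n1 _ _) (n2 _ _),
      ur _ (n1 _ _) (n2 _ _), z1, x1, g3, ← add_assoc, g1]
    ring
  refine RunsB.setReal_eq (ad := 2 * L * T) (v := ∑ k ∈ Finset.Ico l L, (O .forward k t (X a' k) +
    O .downward (k - 1) t (vertFlow L T G X t a a' k))) (by simp [e0, e1]) ?_ ?_
  · set u := (((s'.putIdx 14 l).putReal (l * T + t) (X a' l)).putReal ((L + l - 1) * T + t)
      (vertFlow L T G X t a a' l)).putReal t (G (t + 1) - ∑ k ∈ Finset.Ico l L,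
      (X a' k - (G (k * T + (t + 1)) - G (k * T)))) with hu
    have u0 : u.idx 0 = L := by simp [hu, e0]
    have u1 : u.idx 1 = T := by simp [hu, e1]
    have u11 : u.idx 11 = t := by simp [hu, e11]
    have u14 : u.idx 14 = l := by simp [hu]
    have v1 : u.real (2 * L * T) = s'.real (2 * L * T) := by
      simp only [hu, State.putReal_real, if_neg n1', if_neg n2', if_neg n3', State.putIdx_real]
    have v2 : u.real (l * T + t) = X a' l := by
      simp only [hu, State.putReal_real, if_neg n8, if_neg n7, if_true]
    have v3 : u.real ((L + l - 1) * T + t) = vertFlow L T G X t a a' l := by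
      simp only [hu, State.putReal_real, if_neg n9, if_true]
    change u.real (2 * u.idx 0 * u.idx 1) + (O .forward (u.idx 14) (u.idx 11)
      (u.real (u.idx 14 * u.idx 1 + u.idx 11)) + O .downward (u.idx 14 - 1) (u.idx 11)
      (u.real ((u.idx 0 + u.idx 14 - 1) * u.idx 1 + u.idx 11))) = _
    rw [u0, u1, u11, u14, v1, v2, v3, c1, Finset.sum_eq_sum_Ico_succ_bot hlL]
    ring
  set s₁ := ((((s'.putIdx 14 l).putReal (l * T + t) (X a' l)).putReal ((L + l - 1) * T + t)
    (vertFlow L T G X t a a' l)).putReal t (G (t + 1) - ∑ k ∈ Finset.Ico l L,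
    (X a' k - (G (k * T + (t + 1)) - G (k * T))))).putReal (2 * L * T) (∑ k ∈ Finset.Ico l L,
    (O .forward k t (X a' k) + O .downward (k - 1) t (vertFlow L T G X t a a' k))) with hs₁
  have i1 : ∀ i, i ≠ 14 → s₁.idx i = s'.idx i := fun i hi => by simp [hs₁, hi]
  have r1 : s₁.real (l * T + t) = X a' l := by
    simp only [hs₁, State.putReal_real, if_neg n10, if_neg n8, if_neg n7, if_true]
  have r2 : s₁.real ((L + l - 1) * T + t) = vertFlow L T G X t a a' l := by
    simp only [hs₁, State.putReal_real, if_neg n11, if_neg n9, if_true]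
  have r3 : ∀ i, i ≠ l * T + t → i ≠ (L + l - 1) * T + t → i ≠ t → i ≠ 2 * L * T →
      s₁.real i = s'.real i := fun i h1 h2 h3 h4 => by
    simp only [hs₁, State.putReal_real, if_neg h1, if_neg h2, if_neg h3, if_neg h4,
      State.putIdx_real]
  -- The two outcomes of the sign test differ only in register 15, so the invariant is checked once
  -- for both.
  have main : ∀ s₂ : State, s₂.real = s₁.real → (∀ i, i ≠ 15 → s₂.idx i = s₁.idx i) →
      (s₂.idx 15 = 1 ↔ s'.idx 15 = 1 ∧ 0 ≤ X a' l ∧ 0 ≤ vertFlow L T G X t a a' l) →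
      ColumnInv L T G X O t a a' l s s₂ := by
    intro s₂ hr hi hok
    refine ⟨⟨fun i k1 k2 => ?_, fun i c k1 k2 => ?_, fun k t' k1 k2 k3 => ?_⟩, ?_, fun k k1 k2 => ?_,
      fun k k1 k2 => ?_, ?_, ?_, ?_⟩
    · rw [hi i k2, i1 i k1, h.frame.idx i k1 k2]
    · rw [hr, r3 _ (n1 i c) (n2 i c) (n3 i c) (by omega), h.frame.arrays i c k1 k2]
    · rw [hr, r3, h.frame.columns k t' k1 k2 k3]
      · rw [Ne, table_addr_inj k2 ht]; omega
      · rw [Ne, table_addr_inj k2 ht]; omega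
      · intro heq
        have := (table_addr_inj (s := k) (s' := 0) k2 ht).1 (by omega)
        omega
      · have := row_addr_lt k2 k1
        omega
    · rw [hi 14 (by omega)]; simp [hs₁]
    · rw [hr]
      rcases k1.eq_or_lt with rfl | k1
      · exact r1
      · have := row_addr_lt ht k2
        have f1 : k * T + t ≠ l * T + t := by rw [Ne, table_addr_inj ht ht]; omega
        have f2 : T ≤ k * T := Nat.le_mul_of_pos_left _ (by omega)
        rw [r3 _ f1 (by omega) (by omega) (by omega), h.fwd k k1 k2]
    · rw [hr]
      rcases k1.eq_or_lt with rfl | k1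
      · exact r2
      · have := row_addr_lt (L := 2 * L) ht (show L + k - 1 < 2 * L by omega)
        have f1 : (L + k - 1) * T + t ≠ (L + l - 1) * T + t := by
          rw [Ne, table_addr_inj ht ht]; omega
        have f2 : L * T ≤ (L + k - 1) * T := Nat.mul_le_mul_right _ (by omega)
        rw [r3 _ (by omega) f1 (by omega) (by omega), h.down k k1 k2]
    · rw [hr]; simp only [hs₁, State.putReal_real, if_neg n3'.symm, if_true]
    · rw [hr]; simp only [hs₁, State.putReal_real, if_true]
    · rw [hok, h.ok]
      constructor
      · rintro ⟨k1, k2⟩ k k3 k4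
        rcases k3.eq_or_lt with rfl | k3
        · exact k2
        · exact k1 k k3 k4
      · exact fun k1 => ⟨fun k k2 k3 => k1 k (by omega) k3, k1 l le_rfl hlL⟩
  have i0 : s₁.idx 0 = L := (i1 0 (by omega)).trans e0
  have i1' : s₁.idx 1 = T := (i1 1 (by omega)).trans e1
  have i11 : s₁.idx 11 = t := (i1 11 (by omega)).trans e11
  have i14 : s₁.idx 14 = l := by simp [hs₁]
  refine RunsB.ite (fun hb => RunsB.skip ?_) fun hb => RunsB.setIdx ?_
  · simp only [BExp.eval_and, BExp.eval_leReal, RExp.eval_const, RExp.eval_load, IExp.eval_add,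
      IExp.eval_mul, IExp.eval_sub, reg_eval, IExp.eval_ofNat, i0, i1', i11, i14, r1, r2,
      Int.cast_zero] at hb
    exact main s₁ rfl (fun _ _ => rfl) (by rw [i1 15 (by omega)]; tauto)
  · simp only [BExp.eval_and, BExp.eval_leReal, RExp.eval_const, RExp.eval_load, IExp.eval_add,
      IExp.eval_mul, IExp.eval_sub, reg_eval, IExp.eval_ofNat, i0, i1', i11, i14, r1, r2,
      Int.cast_zero] at hb
    refine main _ rfl (fun i hi => by simp [hi]) ?_
    simp only [IExp.eval_ofNat, State.putIdx_idx, if_true]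
    simp only [zero_ne_one, false_iff]
    tauto

/-- Pricing a transition also writes the flow of its column into the output registers, so the same
code serves the search and the final output. The recursion starts from the flow `0` below the bottom
row, kept in a register of the output area that belongs to no arc. -/
theorem runs_columnProg {L T M : ℕ} {G : ℕ → ℝ} {X : ℕ → ℕ → ℝ} {s : State}
    (hs : Tables L T M G X s) {t a a' : ℕ} (hL : 0 < L) (ht : t < T) (ha : a < M) (ha' : a' < M)
    (h11 : s.idx 11 = t) (h12 : s.idx 12 = a') (h13 : s.idx 13 = a) :
    Runs O columnProg (L * 600) s fun s' => ColumnFrame L T t s s' ∧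
      (∀ l, 1 ≤ l → l < L → s'.real (l * T + t) = X a' l) ∧
      (∀ l, 1 ≤ l → l < L → s'.real ((L + l - 1) * T + t) = vertFlow L T G X t a a' l) ∧
      s'.real t = topFlow L T G X (t + 1) a' ∧
      s'.real (2 * L * T) = stepCost L T G X O t a a' ∧
      (s'.idx 15 = 1 ↔ StepOK L T G X t a a') := by
  have hD : 2 * L * T = L * T + L * T := by ring
  have e0 := hs.rows
  have e1 := hs.cols
  have b2 : (L + L - 1) * T + t < 2 * L * T := row_addr_lt ht (by omega)
  have b3 : L * T ≤ (L + L - 1) * T := Nat.mul_le_mul_right T (by omega)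
  have b5 : T ≤ L * T := Nat.le_mul_of_pos_left _ hL
  have g1 := hs.sums (t + 1) (by omega)
  refine (Runs.seq (m := 80) (n := L * 600 - 80) ?_).mono (by omega) fun _ h => h
  refine RunsB.le ?_ (by decide)
  refine RunsB.seq (RunsB.setReal_eq (ad := (L + L - 1) * T + t) (v := 0) (by simp [e0, e1, h11])
    (by simp) (RunsB.seq ?_))
  refine RunsB.setReal_eq (ad := t) (v := G (t + 1)) (by simp [h11]) ?_ (RunsB.seq ?_)
  · simp only [RExp.eval_load, slot_eval, State.putReal_idx, State.putReal_real, e0, e1, h11,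
      IExp.eval_add, reg_eval, IExp.eval_ofNat]
    rw [if_neg (by omega), g1]
  refine RunsB.setReal_eq (ad := 2 * L * T) (v := 0) (by simp [e0, e1]) (by simp)
    (RunsB.seq (RunsB.setIdx (RunsB.setIdx ?_)))
  simp only [IExp.eval_ofNat, reg_eval]
  set s₁ := (((s.putReal ((L + L - 1) * T + t) 0).putReal t (G (t + 1))).putReal (2 * L * T)
    0).putIdx 15 1 with hs₁
  have i1 : ∀ i, i ≠ 15 → s₁.idx i = s.idx i := fun i hi => by simp [hs₁, hi]
  have r3 : ∀ i, i ≠ (L + L - 1) * T + t → i ≠ t → i ≠ 2 * L * T →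
      s₁.real i = s.real i := fun i h2 h3 h4 => by
    simp only [hs₁, State.putReal_real, if_neg h2, if_neg h3, if_neg h4, State.putIdx_real]
  refine (Runs.seq (m := (L - 1) * 480 + 10) (n := 50) ?_).mono (by omega) fun _ h => h
  refine Runs.while_le (c := 470) (N := L - 1) (fun k s' => ColumnInv L T G X O t a a' (L - k) s s')
    ?_ ?_ ?_ ?_ ?_ ?_
  · have : (BExp.leIdx 2 (reg 14)).cost = 4 := by decide
    rw [this]; omega
  · rintro k s' hk h
    simp [h.row]; omega
  · rintro s' h
    simp [h.row]; omega
  · rintro k s' hk h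
    refine RunsB.le ?_ (by decide)
    exact runs_columnBody hs ht ha ha' h11 h12 h13 (by omega) (by omega)
      (by rwa [show L - (k + 1) + 1 = L - k by omega])
  · rw [Nat.sub_zero]
    refine ⟨⟨fun i k1 k2 => ?_, fun i c k1 k2 => ?_, fun k t' k1 k2 k3 => ?_⟩, ?_, fun k k1 k2 => ?_,
      fun k k1 k2 => ?_, ?_, ?_, ?_⟩
    · simp [k1, i1 i k2]
    · rw [State.putIdx_real, r3 _ (by omega) (by omega) (by omega)]
    · rw [State.putIdx_real, r3]
      · rw [Ne, table_addr_inj k2 ht]; omega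
      · intro heq
        have := (table_addr_inj (s := k) (s' := 0) k2 ht).1 (by omega)
        omega
      · have := row_addr_lt k2 k1
        omega
    · simp [i1 0, e0]
    · omega
    · obtain rfl : k = L := by omega
      rw [vertFlow_last]
      simp only [hs₁, State.putIdx_real, State.putReal_real]
      rw [if_neg (by omega), if_neg (by omega), if_pos trivial]
    · simp only [hs₁, State.putIdx_real, State.putReal_real]
      rw [if_neg (by omega), if_pos trivial]
      simp
    · simp [hs₁]
    · simp only [hs₁, State.putIdx_idx]
      simp
      intro k k1 k2; omega
  · intro s₂ h
    rw [show L - (L - 1) = 1 by omega] at h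
    have f0 := (h.frame.tables hs).rows
    have f1 := (h.frame.tables hs).cols
    have f11 : s₂.idx 11 = t := (h.frame.idx 11 (by omega) (by omega)).trans h11
    have f12 : s₂.real t = topFlow L T G X (t + 1) a' := h.top
    refine RunsB.le ?_ (by decide)
    refine RunsB.seq (RunsB.setReal_eq (ad := 2 * L * T) (v := stepCost L T G X O t a a')
      (by simp [f0, f1]) (by simp [f0, f1, f11, f12, h.cost, stepCost]) ?_)
    have main : ∀ s₃ : State, s₃.real = (s₂.putReal (2 * L * T) (stepCost L T G X O t a a')).real →
        (∀ i, i ≠ 15 → s₃.idx i = s₂.idx i) →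
        (s₃.idx 15 = 1 ↔ s₂.idx 15 = 1 ∧ 0 ≤ topFlow L T G X (t + 1) a') →
        ColumnFrame L T t s s₃ ∧
      (∀ l, 1 ≤ l → l < L → s₃.real (l * T + t) = X a' l) ∧
      (∀ l, 1 ≤ l → l < L → s₃.real ((L + l - 1) * T + t) = vertFlow L T G X t a a' l) ∧
      s₃.real t = topFlow L T G X (t + 1) a' ∧
      s₃.real (2 * L * T) = stepCost L T G X O t a a' ∧
      (s₃.idx 15 = 1 ↔ StepOK L T G X t a a') := by
      intro s₃ hr hi hok
      have hr' : ∀ i, i ≠ 2 * L * T → s₃.real i = s₂.real i := fun i hne => by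
        rw [hr, State.putReal_real, if_neg hne]
      refine ⟨⟨fun i k1 k2 => ?_, fun i c k1 k2 => ?_, fun k t' k1 k2 k3 => ?_⟩, fun l k1 k2 => ?_,
        fun l k1 k2 => ?_, ?_, ?_, ?_⟩
      · rw [hi i k2, h.frame.idx i k1 k2]
      · rw [hr' _ (by omega), h.frame.arrays i c k1 k2]
      · have := row_addr_lt k2 k1
        rw [hr' _ (by omega), h.frame.columns k t' k1 k2 k3]
      · have := row_addr_lt ht k2
        rw [hr' _ (by omega), h.fwd l k1 k2]
      · have := row_addr_lt (L := 2 * L) ht (show L + l - 1 < 2 * L by omega)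
        rw [hr' _ (by omega), h.down l k1 k2.le]
      · rw [hr' _ (by omega), f12]
      · rw [hr, State.putReal_real, if_pos rfl]
      · rw [hok, h.ok, StepOK]
    refine RunsB.ite (fun hb => RunsB.skip ?_) fun hb => RunsB.setIdx ?_
    · simp only [BExp.eval_leReal, RExp.eval_const, RExp.eval_load, reg_eval, State.putReal_idx,
        State.putReal_real, f11, Int.cast_zero] at hb
      rw [if_neg (by omega), f12] at hb
      exact main _ rfl (fun _ _ => rfl) (by rw [State.putReal_idx]; tauto)
    · simp only [BExp.eval_leReal, RExp.eval_const, RExp.eval_load, reg_eval, State.putReal_idx,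
        State.putReal_real, f11, Int.cast_zero] at hb
      rw [if_neg (by omega), f12] at hb
      refine main _ rfl (fun i hi => by simp [hi]) ?_
      simp only [IExp.eval_ofNat, State.putIdx_idx, if_true]
      simp only [zero_ne_one, false_iff]
      tauto

end RealRAM

/-! ## Dynamic programming over layers -/

/-- The tables of the dynamic program over layers of `M` states. The entry `p t s` is `0` if no
sequence of transitions from the state `0` of layer `0` to the state `s` of layer `t` is known, and
otherwise `F t s` is the cost of such a sequence, whose last but one state is `p t s - 1`. All
transitions to layers up to `t₀`, all transitions from layer `t₀` to states before `m'`, and those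
to `m'` from states before `m` have been taken into account. -/
structure Relaxed (M : ℕ) (ok : ℕ → ℕ → ℕ → Prop) (c : ℕ → ℕ → ℕ → ℝ) (t₀ m' m : ℕ)
    (p : ℕ → ℕ → ℕ) (F : ℕ → ℕ → ℝ) : Prop where
  base : ∀ s < M, p 0 s ≠ 0 → s = 0
  start : p 0 0 ≠ 0
  fresh : ∀ t, t₀ + 1 < t → ∀ s < M, p t s = 0
  sound : ∀ t, ∀ s' < M, p (t + 1) s' ≠ 0 → p (t + 1) s' - 1 < M ∧ p t (p (t + 1) s' - 1) ≠ 0 ∧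
    ok t (p (t + 1) s' - 1) s' ∧
    F (t + 1) s' = F t (p (t + 1) s' - 1) + c t (p (t + 1) s' - 1) s'
  complete : ∀ t s s', s < M → s' < M → t < t₀ ∨ t = t₀ ∧ (s' < m' ∨ s' = m' ∧ s < m) →
    p t s ≠ 0 → ok t s s' → p (t + 1) s' ≠ 0 ∧ F (t + 1) s' ≤ F t s + c t s s'

namespace Relaxed

variable {M : ℕ} {ok : ℕ → ℕ → ℕ → Prop} {c : ℕ → ℕ → ℕ → ℝ} {t m' m : ℕ} {p q : ℕ → ℕ → ℕ}
  {F H : ℕ → ℕ → ℝ}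

/-- The machine stores entry `(t, s)` at offset `t * M + s`, which identifies entries only for `s <
M`; agreement there suffices. -/
theorem congr (h : Relaxed M ok c t m' m p F) (hM : 0 < M) (hq : ∀ k, ∀ s < M, q k s = p k s)
    (hH : ∀ k, ∀ s < M, H k s = F k s) : Relaxed M ok c t m' m q H where
  base s hs hp := h.base s hs (by rwa [← hq 0 s hs])
  start := by rw [hq 0 0 hM]; exact h.start
  fresh k hk s hs := by rw [hq k s hs, h.fresh k hk s hs]
  sound k s' hs' hp := by
    rw [hq _ _ hs'] at hp ⊢
    obtain ⟨h1, h2, h3, h4⟩ := h.sound k s' hs' hp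
    rw [hq _ _ h1, hH _ _ hs', hH _ _ h1]
    exact ⟨h1, h2, h3, h4⟩
  complete k s s' hs hs' hk hp hok := by
    rw [hq _ _ hs] at hp
    rw [hq _ _ hs', hH _ _ hs, hH _ _ hs']
    exact h.complete k s s' hs hs' hk hp hok

/-- A transition that does not improve the table. -/
theorem skip (h : Relaxed M ok c t m' m p F)
    (hn : p t m ≠ 0 → ok t m m' → p (t + 1) m' ≠ 0 ∧ F (t + 1) m' ≤ F t m + c t m m') :
    Relaxed M ok c t m' (m + 1) p F where
  base := h.base
  start := h.start
  fresh := h.fresh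
  sound := h.sound
  complete k s s' hs hs' hk hp hok := by
    by_cases heq : k = t ∧ s' = m' ∧ s = m
    · obtain ⟨rfl, rfl, rfl⟩ := heq
      exact hn hp hok
    · exact h.complete k s s' hs hs' (by omega) hp hok

/-- A transition that improves the table. -/
theorem update (h : Relaxed M ok c t m' m p F) (hM : 0 < M) (hm : m < M) (hp : p t m ≠ 0)
    (hok : ok t m m')
    (hlt : p (t + 1) m' ≠ 0 → F t m + c t m m' ≤ F (t + 1) m')
    (hq : ∀ k, ∀ s < M, q k s = if k = t + 1 ∧ s = m' then m + 1 else p k s)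
    (hH : ∀ k, ∀ s < M, H k s = if k = t + 1 ∧ s = m' then F t m + c t m m' else F k s) :
    Relaxed M ok c t m' (m + 1) q H where
  base s hs h0 := h.base s hs (by rwa [hq 0 s hs, if_neg (by omega)] at h0)
  start := by rw [hq 0 0 hM, if_neg (by omega)]; exact h.start
  fresh k hk s hs := by rw [hq k s hs, if_neg (by omega), h.fresh k hk s hs]
  sound k s' hs' h0 := by
    by_cases heq : k = t ∧ s' = m'
    · obtain ⟨rfl, rfl⟩ := heq
      rw [hq _ _ hs', if_pos ⟨rfl, rfl⟩, Nat.add_sub_cancel, hH _ _ hs', if_pos ⟨rfl, rfl⟩,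
        hq _ _ hm, if_neg (by omega), hH _ _ hm, if_neg (by omega)]
      exact ⟨hm, hp, hok, rfl⟩
    · have e : ¬ (k + 1 = t + 1 ∧ s' = m') := by omega
      rw [hq _ _ hs', if_neg e] at h0 ⊢
      obtain ⟨h1, h2, h3, h4⟩ := h.sound k s' hs' h0
      -- An entry could be spoiled only if its predecessor were the changed one, in layer `t + 1`;
      -- but the layers after `t + 1` are still empty.
      have hkt : k ≤ t := by
        by_contra hkt
        exact h0 (h.fresh (k + 1) (by omega) s' hs')
      rw [hq _ _ h1, if_neg (by omega), hH _ _ hs', if_neg e, hH _ _ h1, if_neg (by omega)]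
      exact ⟨h1, h2, h3, h4⟩
  complete k s s' hs hs' hk h0 h1 := by
    rw [hq _ _ hs, if_neg (by omega)] at h0
    rw [hH k _ hs, if_neg (by omega), hq _ _ hs', hH _ _ hs']
    by_cases heq : k = t ∧ s' = m'
    · obtain ⟨rfl, rfl⟩ := heq
      rw [if_pos ⟨rfl, rfl⟩, if_pos ⟨rfl, rfl⟩]
      refine ⟨by omega, ?_⟩
      by_cases hsm : s = m
      · rw [hsm]
      -- Earlier transitions to `m'` bounded the old value, and the new value is no larger.
      · obtain ⟨h2, h3⟩ := h.complete k s s' hs hs' (by omega) h0 h1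
        exact (hlt h2).trans h3
    · rw [if_neg (by omega), if_neg (by omega)]
      exact h.complete k s s' hs hs' (by omega) h0 h1

theorem next_state (h : Relaxed M ok c t m' M p F) : Relaxed M ok c t (m' + 1) 0 p F where
  base := h.base
  start := h.start
  fresh := h.fresh
  sound := h.sound
  complete k s s' hs hs' hk hp hok := h.complete k s s' hs hs' (by omega) hp hok

theorem next_layer (h : Relaxed M ok c t M 0 p F) : Relaxed M ok c (t + 1) 0 0 p F where
  base := h.base
  start := h.start
  fresh k hk := h.fresh k (by omega)
  sound := h.sound
  complete k s s' hs hs' hk hp hok := h.complete k s s' hs hs' (by omega) hp hok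

/-- The inequalities of `complete` are added up along the chain; `F 0 0` is an arbitrary offset. -/
theorem le_of_chain {T : ℕ} (h : Relaxed M ok c T 0 0 p F) {σ : ℕ → ℕ} (h0 : σ 0 = 0)
    (hM : ∀ k, k ≤ T → σ k < M) (hok : ∀ k, k < T → ok k (σ k) (σ (k + 1))) {k : ℕ} (hk : k ≤ T) :
    p k (σ k) ≠ 0 ∧ F k (σ k) ≤ F 0 0 + ∑ i ∈ Finset.range k, c i (σ i) (σ (i + 1)) := by
  induction k with
  | zero => rw [h0]; exact ⟨h.start, by simp⟩
  | succ k ih =>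
    obtain ⟨h1, h2⟩ := ih (by omega)
    obtain ⟨h3, h4⟩ := h.complete k (σ k) (σ (k + 1)) (hM k (by omega)) (hM _ hk) (by omega) h1
      (hok k hk)
    rw [Finset.sum_range_succ]
    exact ⟨h3, by linarith⟩

/-- The sequence of states obtained by following the predecessors. -/
theorem exists_optimal_chain {T : ℕ} (h : Relaxed M ok c T 0 0 p F) {σ : ℕ → ℕ} (h0 : σ 0 = 0)
    (hT : σ T = 0) (hM : ∀ k, k ≤ T → σ k < M) (hok : ∀ k, k < T → ok k (σ k) (σ (k + 1))) :
    ∃ τ : ℕ → ℕ, τ 0 = 0 ∧ τ T = 0 ∧ (∀ k, k ≤ T → τ k < M) ∧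
      (∀ k, k < T → ok k (τ k) (τ (k + 1))) ∧ (∀ k, k < T → τ k = p (k + 1) (τ (k + 1)) - 1) ∧
      ∀ σ : ℕ → ℕ, σ 0 = 0 → σ T = 0 → (∀ k, k ≤ T → σ k < M) →
        (∀ k, k < T → ok k (σ k) (σ (k + 1))) →
        ∑ i ∈ Finset.range T, c i (τ i) (τ (i + 1)) ≤
          ∑ i ∈ Finset.range T, c i (σ i) (σ (i + 1)) := by
  -- `ρ j` is the state in layer `T - j` on the trail of predecessors that ends in the state `0` of
  -- layer `T`.
  let ρ : ℕ → ℕ := fun j => Nat.rec 0 (fun j r => p (T - j) r - 1) j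
  have hρ : ∀ j, ρ (j + 1) = p (T - j) (ρ j) - 1 := fun j => rfl
  let τ : ℕ → ℕ := fun k => ρ (T - k)
  have hτT : τ T = 0 := by simp [τ, ρ]
  have hτ : ∀ k, k < T → τ k = p (k + 1) (τ (k + 1)) - 1 := fun k hk => by
    have := hρ (T - (k + 1))
    rw [show T - (k + 1) + 1 = T - k by omega, show T - (T - (k + 1)) = k + 1 by omega] at this
    exact this
  -- The given chain `σ` shows that the end of the trail is reached; `sound` passes this back to
  -- each predecessor.
  have key : ∀ j, j ≤ T → τ (T - j) < M ∧ p (T - j) (τ (T - j)) ≠ 0 := by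
    intro j
    induction j with
    | zero =>
      intro _
      have h1 := hM T le_rfl
      have h2 := (h.le_of_chain h0 hM hok le_rfl).1
      rw [hT] at h1 h2
      rw [Nat.sub_zero, hτT]
      exact ⟨h1, h2⟩
    | succ j ih =>
      intro hj
      obtain ⟨h1, h2⟩ := ih (by omega)
      have e : T - j = T - (j + 1) + 1 := by omega
      rw [e] at h1 h2
      obtain ⟨h3, h4, -, -⟩ := h.sound _ _ h1 h2
      rw [hτ (T - (j + 1)) (by omega)]
      exact ⟨h3, h4⟩
  have key' : ∀ k, k ≤ T → τ k < M ∧ p k (τ k) ≠ 0 := fun k hk => by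
    have := key (T - k) (by omega)
    rwa [show T - (T - k) = k by omega] at this
  have hτ0 : τ 0 = 0 := h.base _ (key' 0 (by omega)).1 (key' 0 (by omega)).2
  have hF : ∀ k, k ≤ T → F k (τ k) = F 0 0 + ∑ i ∈ Finset.range k, c i (τ i) (τ (i + 1)) := by
    intro k
    induction k with
    | zero => intro _; rw [hτ0]; simp
    | succ k ih =>
      intro hk
      obtain ⟨-, -, -, h4⟩ := h.sound k _ (key' (k + 1) hk).1 (key' (k + 1) hk).2
      rw [← hτ k hk] at h4
      rw [h4, ih (by omega), Finset.sum_range_succ, add_assoc]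
  refine ⟨τ, hτ0, hτT, fun k hk => (key' k hk).1, fun k hk => ?_, hτ, ?_⟩
  · obtain ⟨-, -, h3, -⟩ := h.sound k _ (key' (k + 1) hk).1 (key' (k + 1) hk).2
    rwa [← hτ k hk] at h3
  · intro σ' k0 kT kM kok
    have h1 := (h.le_of_chain k0 kM kok le_rfl).2
    have h2 := hF T le_rfl
    rw [kT] at h1
    rw [hτT] at h2
    linarith

end Relaxed

/-! ## The program for the dynamic program -/

namespace RealRAM

variable {O : Oracle}

theorem loop_cost_le {N b c d n : ℕ} (h : 1 + b + c ≤ d) (hn : N * d + (1 + b) ≤ n) :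
    N * (1 + b + c) + (1 + b) ≤ n :=
  (Nat.add_le_add_right (Nat.mul_le_mul_left N h) _).trans hn

/-- The predecessor table of the dynamic program. -/
def predAt (M : ℕ) (s : State) (t m : ℕ) : ℕ := s.idx (32 + (t * M + m))

/-- The cost table of the dynamic program. -/
def valueAt (L T M : ℕ) (s : State) (t m : ℕ) : ℝ := s.real (2 * L * T + 4 * (t * M + m) + 3)

/-- The state of the machine during the dynamic program. -/
structure DPInv (L T M : ℕ) (G : ℕ → ℝ) (X : ℕ → ℕ → ℝ) (O : Oracle) (t m' m : ℕ) (s : State) :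
    Prop where
  tables : Tables L T M G X s
  column : s.idx 11 = t
  relaxed : Relaxed M (StepOK L T G X) (stepCost L T G X O) t m' m (predAt M s) (valueAt L T M s)

theorem Tables.of_eq {L T M : ℕ} {G : ℕ → ℝ} {X : ℕ → ℕ → ℝ} {s s' : State}
    (h : Tables L T M G X s) (hi : ∀ i, i ≤ 3 → s'.idx i = s.idx i)
    (hr : ∀ i a, 1 ≤ a → a ≤ 2 → s'.real (2 * L * T + 4 * i + a) = s.real (2 * L * T + 4 * i + a)) :
    Tables L T M G X s' where
  rows := (hi 0 (by omega)).trans h.rows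
  cols := (hi 1 (by omega)).trans h.cols
  states := (hi 3 (by omega)).trans h.states
  sums i hk := (hr i 1 (by omega) (by omega)).trans (h.sums i hk)
  flows n hn l h1 h2 := (hr _ 2 (by omega) (by omega)).trans (h.flows n hn l h1 h2)

theorem DPInv.putIdx {L T M : ℕ} {G : ℕ → ℝ} {X : ℕ → ℕ → ℝ} {t m' m i v : ℕ} {s : State}
    (h : DPInv L T M G X O t m' m s) (hi : i = 12 ∨ i = 13) :
    DPInv L T M G X O t m' m (s.putIdx i v) where
  tables := h.tables.of_eq (fun j hj => by rw [State.putIdx_idx, if_neg (by omega)]) fun _ _ _ _ => rfl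
  column := by rw [State.putIdx_idx, if_neg (by omega), h.column]
  relaxed := by
    have : predAt M (s.putIdx i v) = predAt M s := by
      funext t m; simp only [predAt, State.putIdx_idx]; rw [if_neg (by omega)]
    rw [this]; exact h.relaxed

/-- Takes one transition into account. -/
def relaxProg : Prog :=
  .ite (.and (.and (.leIdx 1 (reg 15)) (.leIdx (reg 15) 1))
      (.and (.leIdx 1 (.load (32 + (reg 11 * reg 3 + reg 13))))
        (.not (.and (.leIdx 1 (.load (32 + ((reg 11 + 1) * reg 3 + reg 12))))
          (.leReal (.load (slot 3 ((reg 11 + 1) * reg 3 + reg 12)))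
            (.load (slot 3 (reg 11 * reg 3 + reg 13)) + .load (slot 0 0)))))))
    (.seq (.setReal (slot 3 ((reg 11 + 1) * reg 3 + reg 12))
        (.load (slot 3 (reg 11 * reg 3 + reg 13)) + .load (slot 0 0)))
      (.setIdx (32 + ((reg 11 + 1) * reg 3 + reg 12)) (reg 13 + 1))) .skip

/-- Predecessors are stored as `m + 1`, so that `0` can mean unreached; the comparison with the old
cost counts only if an old entry exists. The new value is written exactly when the transition is
feasible, starts from a reached state and meets either no entry or a more expensive one. -/
theorem runs_relaxProg {L T M : ℕ} {G : ℕ → ℝ} {X : ℕ → ℕ → ℝ} {t m' m : ℕ} {s : State}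
    (hM : 0 < M) (h : DPInv L T M G X O t m' m s) (hm : m < M) (hm' : m' < M)
    (h12 : s.idx 12 = m') (h13 : s.idx 13 = m)
    (hc : s.real (2 * L * T) = stepCost L T G X O t m m')
    (hok : s.idx 15 = 1 ↔ StepOK L T G X t m m') :
    RunsB O relaxProg s fun s' => DPInv L T M G X O t m' (m + 1) s' ∧ s'.idx 12 = m' ∧
      s'.idx 13 = m := by
  have e0 := h.tables.rows
  have e1 := h.tables.cols
  have e3 := h.tables.states
  have e11 := h.column
  refine RunsB.ite (fun hb => ?_) fun hb => RunsB.skip ⟨⟨h.tables, h.column, h.relaxed.skip ?_⟩, h12, h13⟩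
  · change ((1 ≤ s.idx 15 ∧ s.idx 15 ≤ 1) ∧ (1 ≤ s.idx (32 + (s.idx 11 * s.idx 3 + s.idx 13)) ∧
      ¬ (1 ≤ s.idx (32 + ((s.idx 11 + 1) * s.idx 3 + s.idx 12)) ∧
      s.real (2 * s.idx 0 * s.idx 1 + 4 * ((s.idx 11 + 1) * s.idx 3 + s.idx 12) + 3) ≤
      s.real (2 * s.idx 0 * s.idx 1 + 4 * (s.idx 11 * s.idx 3 + s.idx 13) + 3) +
      s.real (2 * s.idx 0 * s.idx 1)))) at hb
    rw [e0, e1, e3, e11, h12, h13, hc] at hb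
    obtain ⟨hb1, hb2, hb3⟩ := hb
    refine RunsB.seq (RunsB.setReal_eq (ad := 2 * L * T + 4 * ((t + 1) * M + m') + 3)
      (v := valueAt L T M s t m + stepCost L T G X O t m m') ?_ ?_ (RunsB.setIdx ?_))
    · change 2 * s.idx 0 * s.idx 1 + 4 * ((s.idx 11 + 1) * s.idx 3 + s.idx 12) + 3 = _
      rw [e0, e1, e3, e11, h12]
    · change s.real (2 * s.idx 0 * s.idx 1 + 4 * (s.idx 11 * s.idx 3 + s.idx 13) + 3) +
        s.real (2 * s.idx 0 * s.idx 1) = _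
      rw [e0, e1, e3, e11, h13, hc]; rfl
    set u := s.putReal (2 * L * T + 4 * ((t + 1) * M + m') + 3)
      (valueAt L T M s t m + stepCost L T G X O t m m') with hu
    have hput : u.putIdx (IExp.eval u (32 + ((reg 11 + 1) * reg 3 + reg 12)))
        (IExp.eval u (reg 13 + 1)) =
      u.putIdx (32 + ((s.idx 11 + 1) * s.idx 3 + s.idx 12)) (s.idx 13 + 1) := rfl
    rw [hput, e3, e11, h12, h13]
    refine ⟨⟨h.tables.of_eq (fun i hi => ?_) fun i a h1 h2 => ?_, ?_, ?_⟩, ?_, ?_⟩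
    · rw [State.putIdx_idx, if_neg (by omega)]; rfl
    · rw [State.putIdx_real, hu, State.putReal_real, if_neg (by omega)]
    · rw [State.putIdx_idx, if_neg (by omega)]; exact e11
    · refine h.relaxed.update hM hm (Nat.one_le_iff_ne_zero.1 hb2) (hok.1 (le_antisymm hb1.2 hb1.1))
        (fun h0 => ?_) (fun k i hi => ?_) fun k i hi => ?_
      · exact (not_le.1 fun hle => hb3 ⟨Nat.one_le_iff_ne_zero.2 h0, hle⟩).le
      · unfold predAt
        rw [State.putIdx_idx]
        have : 32 + (k * M + i) = 32 + ((t + 1) * M + m') ↔ k = t + 1 ∧ i = m' := by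
          rw [← table_addr_inj hi hm']; omega
        simp only [this]
        rfl
      · unfold valueAt
        rw [State.putIdx_real, hu, State.putReal_real]
        have : 2 * L * T + 4 * (k * M + i) + 3 = 2 * L * T + 4 * ((t + 1) * M + m') + 3 ↔
            k = t + 1 ∧ i = m' := by
          rw [← table_addr_inj hi hm']; omega
        simp only [this]
        rfl
    · rw [State.putIdx_idx, if_neg (by omega)]; exact h12
    · rw [State.putIdx_idx, if_neg (by omega)]; exact h13
  · intro h1 h2
    change ¬ ((1 ≤ s.idx 15 ∧ s.idx 15 ≤ 1) ∧ (1 ≤ s.idx (32 + (s.idx 11 * s.idx 3 + s.idx 13)) ∧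
      ¬ (1 ≤ s.idx (32 + ((s.idx 11 + 1) * s.idx 3 + s.idx 12)) ∧
      s.real (2 * s.idx 0 * s.idx 1 + 4 * ((s.idx 11 + 1) * s.idx 3 + s.idx 12) + 3) ≤
      s.real (2 * s.idx 0 * s.idx 1 + 4 * (s.idx 11 * s.idx 3 + s.idx 13) + 3) +
      s.real (2 * s.idx 0 * s.idx 1)))) at hb
    rw [e0, e1, e3, e11, h12, h13, hc] at hb
    by_contra hcon
    refine hb ⟨⟨(hok.2 h2).ge, (hok.2 h2).le⟩, Nat.one_le_iff_ne_zero.2 h1, fun hle => hcon ?_⟩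
    exact ⟨Nat.one_le_iff_ne_zero.1 hle.1, hle.2⟩

theorem ColumnFrame.dpInv {L T M : ℕ} {G : ℕ → ℝ} {X : ℕ → ℕ → ℝ} {t m' m : ℕ} {s s' : State}
    (hf : ColumnFrame L T t s s') (h : DPInv L T M G X O t m' m s) :
    DPInv L T M G X O t m' m s' where
  tables := hf.tables h.tables
  column := (hf.idx 11 (by omega) (by omega)).trans h.column
  relaxed := by
    have h1 : predAt M s' = predAt M s := by
      funext t m; exact hf.idx _ (by omega) (by omega)
    have h2 : valueAt L T M s' = valueAt L T M s := by
      funext t m; exact hf.arrays _ 3 (by omega) (by omega)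
    rw [h1, h2]; exact h.relaxed

/-- Takes all transitions from one layer to the next into account. -/
def layerProg : Prog :=
  .seq (.setIdx 12 0) (.while (.leIdx (reg 12 + 1) (reg 3))
    (.seq (.setIdx 13 0) (.seq (.while (.leIdx (reg 13 + 1) (reg 3))
      (.seq columnProg (.seq relaxProg (.setIdx 13 (reg 13 + 1)))))
      (.setIdx 12 (reg 12 + 1)))))

theorem runs_layerProg {L T M : ℕ} {G : ℕ → ℝ} {X : ℕ → ℕ → ℝ} {t : ℕ} {s : State}
    (hL : 0 < L) (ht : t < T) (hM : 0 < M) (h : DPInv L T M G X O t 0 0 s) :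
    Runs O layerProg (M * (M * (L * 600 + 300) + 40) + 20) s fun s' =>
      DPInv L T M G X O t M 0 s' := by
  refine (Runs.seq (m := 5) (n := M * (M * (L * 600 + 300) + 40) + 15)
    (Runs.setIdx (by decide) ?_)).mono (by omega) fun _ h => h
  refine Runs.while_le (c := M * (L * 600 + 300) + 30) (N := M)
    (fun k s' => DPInv L T M G X O t k 0 s' ∧ s'.idx 12 = k) ?_ ?_ ?_ ?_ ?_ fun _ h => h.1
  · have : (BExp.leIdx (reg 12 + 1) (reg 3)).cost = 7 := by decide
    exact loop_cost_le (d := M * (L * 600 + 300) + 40) (by omega) (by omega)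
  · rintro k s' hk ⟨h1, h2⟩
    simp [h1.tables.states, h2]; omega
  · rintro s' ⟨h1, h2⟩
    simp [h1.tables.states, h2]
  · rintro k s' hk ⟨h1, h2⟩
    refine (Runs.seq (m := 5) (n := M * (L * 600 + 300) + 25)
      (Runs.setIdx (by decide) ?_)).mono (by omega) fun _ h => h
    refine (Runs.seq (m := M * (L * 600 + 300) + 10) (n := 10) ?_).mono (by omega) fun _ h => h
    refine Runs.while_le (c := L * 600 + 290) (N := M) (fun j s'' => DPInv L T M G X O t k j s'' ∧
      s''.idx 12 = k ∧ s''.idx 13 = j) ?_ ?_ ?_ ?_ ?_ ?_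
    · have : (BExp.leIdx (reg 13 + 1) (reg 3)).cost = 7 := by decide
      exact loop_cost_le (d := L * 600 + 300) (by omega) (by omega)
    · rintro j s'' hj ⟨k1, -, k2⟩
      simp [k1.tables.states, k2]; omega
    · rintro s'' ⟨k1, -, k2⟩
      simp [k1.tables.states, k2]
    · rintro j s'' hj ⟨k1, k2, k3⟩
      refine (Runs.seq (m := L * 600) (n := 290) ?_).mono (by omega) fun _ h => h
      refine (runs_columnProg k1.tables hL ht hj hk k1.column k2 k3).mono le_rfl ?_
      rintro u ⟨hf, -, -, -, hc, hok⟩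
      refine (Runs.seq (m := 270) (n := 20) ?_)
      refine RunsB.le ?_ (by decide)
      refine (runs_relaxProg hM (hf.dpInv k1) hj hk
        ((hf.idx 12 (by omega) (by omega)).trans k2)
        ((hf.idx 13 (by omega) (by omega)).trans k3) hc hok).mono ?_
      rintro v ⟨l1, l2, l3⟩
      refine Runs.setIdx (by decide) ?_
      exact ⟨l1.putIdx (Or.inr rfl), by simp [l2], by simp [l3]⟩
    · exact ⟨h1.putIdx (Or.inr rfl), by simp [h2], by simp⟩
    · rintro u ⟨k1, k2, -⟩
      refine Runs.setIdx (by decide) ?_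
      refine ⟨DPInv.putIdx ⟨k1.tables, k1.column, k1.relaxed.next_state⟩ (Or.inl rfl), by simp [k2]⟩
  · exact ⟨h.putIdx (Or.inl rfl), by simp⟩

/-- Computes the tables of the dynamic program. -/
def dynamicProg : Prog :=
  .seq (.setIdx 32 1) (.seq (.setIdx 11 0) (.while (.leIdx (reg 11 + 1) (reg 1))
    (.seq layerProg (.setIdx 11 (reg 11 + 1)))))

/-- Register 32 is the entry of state `0` in layer `0`, the only one marked at the start. Its cost
cell needs no initial value, since a common offset does not change which chain is cheapest. -/
theorem runs_dynamicProg {L T M : ℕ} {G : ℕ → ℝ} {X : ℕ → ℕ → ℝ} {s : State}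
    (hL : 0 < L) (hM : 0 < M) (h : Tables L T M G X s) (hp : ∀ i, 32 ≤ i → s.idx i = 0) :
    Runs O dynamicProg (T * (M * (M * (L * 600 + 300) + 40) + 50) + 30) s fun s' =>
      DPInv L T M G X O T 0 0 s' := by
  refine (Runs.seq (m := 5) (n := T * (M * (M * (L * 600 + 300) + 40) + 50) + 25)
    (Runs.setIdx (by decide) ?_)).mono (by omega) fun _ h => h
  refine (Runs.seq (m := 5) (n := T * (M * (M * (L * 600 + 300) + 40) + 50) + 20)
    (Runs.setIdx (by decide) ?_)).mono (by omega) fun _ h => h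
  refine Runs.while_le (c := M * (M * (L * 600 + 300) + 40) + 30) (N := T)
    (fun k s' => DPInv L T M G X O k 0 0 s') ?_ ?_ ?_ ?_ ?_ fun _ h => h
  · have : (BExp.leIdx (reg 11 + 1) (reg 1)).cost = 7 := by decide
    exact loop_cost_le (d := M * (M * (L * 600 + 300) + 40) + 50) (by omega) (by omega)
  · rintro k s' hk h1
    simp [h1.tables.cols, h1.column]; omega
  · rintro s' h1
    simp [h1.tables.cols, h1.column]
  · rintro k s' hk h1
    refine (Runs.seq (m := M * (M * (L * 600 + 300) + 40) + 20) (n := 10) ?_).mono (by omega)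
      fun _ h => h
    refine (runs_layerProg hL hk hM h1).mono le_rfl fun u hu => ?_
    refine Runs.setIdx (by decide) ⟨hu.tables.of_eq (fun i hi => ?_) fun _ _ _ _ => rfl, ?_, ?_⟩
    · simp only [State.putIdx_idx, IExp.eval_ofNat]; rw [if_neg (by omega)]
    · simp [hu.column]
    · refine hu.relaxed.next_layer.congr hM (fun t i hi => ?_) fun _ _ _ => rfl
      simp only [predAt, State.putIdx_idx, IExp.eval_ofNat]; rw [if_neg (by omega)]
  · have hp' : ∀ t i, predAt M ((s.putIdx (IExp.eval s 32) (IExp.eval s 1)).putIdx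
        (IExp.eval (s.putIdx (IExp.eval s 32) (IExp.eval s 1)) 11)
        (IExp.eval (s.putIdx (IExp.eval s 32) (IExp.eval s 1)) 0)) t i =
        if t * M + i = 0 then 1 else 0 := fun t i => by
      simp only [predAt, State.putIdx_idx, IExp.eval_ofNat]
      rw [if_neg (by omega), hp _ (by omega)]
      congr 1
      simp
    refine ⟨h.of_eq (fun i hi => ?_) fun _ _ _ _ => rfl, ?_, ?_⟩
    · simp only [State.putIdx_idx, IExp.eval_ofNat]; rw [if_neg (by omega), if_neg (by omega)]
    · simp
    · refine ⟨fun i hi h0 => ?_, ?_, fun t h0 i hi => ?_, fun t i hi h0 => ?_, fun t i i' _ _ h0 => ?_⟩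
      · rw [hp'] at h0
        by_contra hne
        exact h0 (if_neg (by omega))
      · rw [hp']; simp
      · rw [hp', if_neg]
        have := Nat.mul_pos (show 0 < t by omega) hM
        omega
      · rw [hp', if_neg] at h0
        · exact absurd rfl h0
        have := Nat.mul_pos (show 0 < t + 1 by omega) hM
        omega
      · omega

/-- Follows the predecessors from the last layer to the first and computes the flow. -/
def backtrackProg : Prog :=
  .seq (.setIdx 11 (reg 1)) (.seq (.setIdx 12 0) (.while (.leIdx 1 (reg 11))
    (.seq (.setIdx 13 (.load (32 + (reg 11 * reg 3 + reg 12)) - 1))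
    (.seq (.setIdx 11 (reg 11 - 1)) (.seq columnProg (.setIdx 12 (reg 13)))))))

/-- The flow in the columns from `t₀` on is known. -/
structure BacktrackInv (L T M : ℕ) (G : ℕ → ℝ) (X : ℕ → ℕ → ℝ) (τ : ℕ → ℕ) (s : State) (t₀ : ℕ)
    (s' : State) : Prop where
  tables : Tables L T M G X s'
  pred : ∀ i, 32 ≤ i → s'.idx i = s.idx i
  column : s'.idx 11 = t₀
  state : s'.idx 12 = τ t₀
  fwd : ∀ t, t₀ ≤ t → t < T → ∀ l < L, s'.real (l * T + t) = chainForward L T G X τ l t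
  down : ∀ t, t₀ ≤ t → t < T → ∀ l, l + 1 < L →
    s'.real (L * T + l * T + t) = chainDownward L T G X τ l t

/-- The search has left traces of rejected transitions in the output registers. Rerunning the chosen
transition of each column overwrites them, and `ColumnFrame` protects the columns already finished.
-/
theorem runs_backtrackProg {L T M : ℕ} {G : ℕ → ℝ} {X : ℕ → ℕ → ℝ} {s : State} {τ : ℕ → ℕ}
    (hL : 0 < L) (h : Tables L T M G X s) (hT : τ T = 0) (hM : ∀ t, t ≤ T → τ t < M)
    (hτ : ∀ t, t < T → τ t = predAt M s (t + 1) (τ (t + 1)) - 1) :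
    Runs O backtrackProg (T * (L * 600 + 60) + 30) s fun s' =>
      (∀ t, t < T → ∀ l < L, s'.real (l * T + t) = chainForward L T G X τ l t) ∧
      ∀ t, t < T → ∀ l, l + 1 < L → s'.real (L * T + l * T + t) = chainDownward L T G X τ l t := by
  refine (Runs.seq (m := 5) (n := T * (L * 600 + 60) + 25)
    (Runs.setIdx (by decide) ?_)).mono (by omega) fun _ h => h
  refine (Runs.seq (m := 5) (n := T * (L * 600 + 60) + 20)
    (Runs.setIdx (by decide) ?_)).mono (by omega) fun _ h => h
  refine Runs.while_le (c := L * 600 + 50) (N := T)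
    (fun k s' => BacktrackInv L T M G X τ s (T - k) s') ?_ ?_ ?_ ?_ ?_ ?_
  · have : (BExp.leIdx 1 (reg 11)).cost = 4 := by decide
    exact loop_cost_le (d := L * 600 + 60) (by omega) (by omega)
  · rintro k s' hk h1
    simp [h1.column]; omega
  · rintro s' h1
    simp [h1.column]
  · rintro k s' hk h1
    obtain ⟨t, ht⟩ : ∃ t, T - k = t + 1 := ⟨T - k - 1, by omega⟩
    rw [show T - (k + 1) = t by omega]
    rw [ht] at h1
    have htT : t < T := by omega
    refine (Runs.seq (m := 20) (n := L * 600 + 30) (Runs.setIdx (by decide) ?_)).mono (by omega)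
      fun _ h => h
    refine (Runs.seq (m := 20) (n := L * 600 + 10) (Runs.setIdx (by decide) ?_)).mono (by omega)
      fun _ h => h
    refine Runs.seq (m := L * 600) (n := 10) ?_
    have hpred : IExp.eval s' (.load (32 + (reg 11 * reg 3 + reg 12)) - 1) = τ t := by
      change s'.idx (32 + (s'.idx 11 * s'.idx 3 + s'.idx 12)) - 1 = _
      rw [h1.pred _ (by omega), h1.column, h1.state, h1.tables.states, hτ t htT]
      rfl
    rw [hpred]
    have hdec : IExp.eval (s'.putIdx (IExp.eval s' 13) (τ t)) (reg 11 - 1) = t := by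
      simp [h1.column]
    rw [hdec]
    set u := (s'.putIdx (IExp.eval s' 13) (τ t)).putIdx
      (IExp.eval (s'.putIdx (IExp.eval s' 13) (τ t)) 11) t with hu
    have ui : ∀ i, i ≠ 11 → i ≠ 13 → u.idx i = s'.idx i := fun i h1 h2 => by simp [hu, h1, h2]
    have u11 : u.idx 11 = t := by simp [hu]
    have u13 : u.idx 13 = τ t := by simp [hu]
    have ut : Tables L T M G X u :=
      h1.tables.of_eq (fun i hi => ui i (by omega) (by omega)) fun _ _ _ _ => rfl
    have u12 : u.idx 12 = τ (t + 1) := (ui 12 (by omega) (by omega)).trans h1.state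
    refine (runs_columnProg ut hL htT (hM t htT.le) (hM (t + 1) htT) u11 u12 u13).mono le_rfl ?_
    rintro v ⟨hf, w1, w2, w3, -, -⟩
    refine Runs.setIdx (by decide) ⟨?_, fun i hi => ?_, ?_, ?_, fun t' k1 k2 l hl => ?_,
      fun t' k1 k2 l hl => ?_⟩
    · refine (hf.tables ut).of_eq (fun i hi => ?_) fun _ _ _ _ => rfl
      simp only [State.putIdx_idx, IExp.eval_ofNat]; rw [if_neg (by omega)]
    · simp only [State.putIdx_idx, IExp.eval_ofNat]
      rw [if_neg (by omega), hf.idx i (by omega) (by omega), ui i (by omega) (by omega),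
        h1.pred i hi]
    · simp [hf.idx, u11]
    · simp [hf.idx, u13]
    · rw [State.putIdx_real]
      rcases k1.eq_or_lt with rfl | k1
      · unfold chainForward
        split_ifs with hl0
        · subst hl0; rw [← w3]; simp
        · exact w1 l (by omega) hl
      · rw [hf.columns l t' (by omega) k2 (by omega)]
        exact h1.fwd t' k1 k2 l hl
    · rw [State.putIdx_real, ← Nat.add_mul]
      rcases k1.eq_or_lt with rfl | k1
      · exact w2 (l + 1) (by omega) hl
      · rw [hf.columns (L + l) t' (by omega) k2 (by omega), Nat.add_mul]
        exact h1.down t' k1 k2 l hl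
  · refine ⟨h.of_eq (fun i hi => ?_) fun _ _ _ _ => rfl, fun i hi => ?_, ?_, ?_,
      fun t' k1 k2 => by omega, fun t' k1 k2 => by omega⟩
    · simp only [State.putIdx_idx, IExp.eval_ofNat]; rw [if_neg (by omega), if_neg (by omega)]
    · simp only [State.putIdx_idx, IExp.eval_ofNat]; rw [if_neg (by omega), if_neg (by omega)]
    · simp [h.cols]
    · simp [hT]
  · intro s' h1
    rw [Nat.sub_self] at h1
    exact ⟨fun t ht => h1.fwd t (by omega) ht, fun t ht => h1.down t (by omega) ht⟩

end RealRAM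

/-! ## The program and its running time -/

namespace RealRAM

/-- The program that computes optimal flows. -/
def optimalFlowProg : Prog :=
  .seq prefixProg (.seq statesProg (.seq tableProg (.seq dynamicProg backtrackProg)))

end RealRAM

theorem numStates_pos {L T : ℕ} (hT : 0 < T) : 0 < numStates L T :=
  Nat.pow_pos (Nat.mul_pos hT hT)

/-- For `T ≥ 2` the number of states is `T` to the power `2(L - 1)(2L - 1)`, and `4(L - 1)(2L - 1) +
1 = 8L² - 12L + 5`. For `T = 1` both sides are `1`. -/
theorem mul_numStates_sq {L T : ℕ} (hL : 1 ≤ L) (hT : 1 ≤ T) :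
    T * numStates L T ^ 2 = T ^ (8 * L ^ 2 + 5 - 12 * L) := by
  rcases hT.eq_or_lt with rfl | hT
  · simp [numStates]
  · obtain ⟨l, rfl⟩ : ∃ l, L = l + 1 := ⟨L - 1, by omega⟩
    have hJ : numIntervals (l + 1) T = 2 * l + 1 := by
      unfold numIntervals
      rw [show 1 - (2 - T) = 1 by omega, mul_one]; omega
    have he : 8 * (l + 1) ^ 2 + 5 - 12 * (l + 1) = 2 * (l * (2 * l + 1)) * 2 + 1 := by
      have : 8 * (l + 1) ^ 2 + 5 = 2 * (l * (2 * l + 1)) * 2 + 1 + 12 * (l + 1) := by ring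
      omega
    rw [he, pow_succ' T, pow_mul, pow_mul, numStates, hJ, Nat.add_sub_cancel, ← pow_two T]

/-- For `T = 1` the permitted time is only linear in `L`, too short for loops over `(L - 1)(2L - 1)`
intervals; this is why `numIntervals` carries a factor that vanishes there. For `T ≥ 2` it is `n < b
^ n` with `b = T * T`. -/
theorem mul_numIntervals_le {L T : ℕ} (hT : 1 ≤ T) :
    (L - 1) * numIntervals L T ≤ numStates L T := by
  rcases hT.eq_or_lt with rfl | hT
  · simp [numIntervals]
  · have h4 : 1 < T * T := by nlinarith
    exact (Nat.lt_pow_self h4).le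

/-- The total running time of the parts of the program. -/
theorem total_steps_le {L T : ℕ} (hL : 1 ≤ L) (hT : 1 ≤ T) {J M : ℕ} (hM : 1 ≤ M)
    (hJ : (L - 1) * J ≤ M) :
    L * T * 60 + 60 + ((L - 1) * J * 60 + 60 + ((L - 1) * (J * (M * 400 + 150) + 50) + 50 +
      (T * (M * (M * (L * 600 + 300) + 40) + 50) + 30 + (T * (L * 600 + 60) + 30)))) ≤
      3000 * (L * (T * M ^ 2)) := by
  have e1 : (L - 1) * (J * (M * 400 + 150) + 50) =
      (L - 1) * J * M * 400 + (L - 1) * J * 150 + (L - 1) * 50 := by ring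
  have e2 : T * (M * (M * (L * 600 + 300) + 40) + 50) =
      L * (T * M ^ 2) * 600 + T * M ^ 2 * 300 + T * M * 40 + T * 50 := by ring
  have e3 : T * (L * 600 + 60) = L * T * 600 + T * 60 := by ring
  have f1 : (L - 1) * J * M ≤ M ^ 2 := by
    rw [pow_two]; exact Nat.mul_le_mul_right M hJ
  have a1 : M ≤ M ^ 2 := by rw [pow_two]; exact Nat.le_mul_of_pos_left M hM
  have a2 : M ^ 2 ≤ T * M ^ 2 := Nat.le_mul_of_pos_left _ hT
  have a3 : T * M ≤ T * M ^ 2 := Nat.mul_le_mul_left T a1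
  have a4 : T ≤ T * M := Nat.le_mul_of_pos_right T hM
  have a5 : T * M ^ 2 ≤ L * (T * M ^ 2) := Nat.le_mul_of_pos_left _ hL
  have a6 : L * T ≤ L * (T * M ^ 2) := Nat.mul_le_mul_left L (a4.trans a3)
  have a7 : L ≤ L * T := Nat.le_mul_of_pos_right L hT
  rw [e1, e2, e3]
  -- With the products as atoms, only linear inequalities remain.
  generalize L * (T * M ^ 2) = B at *
  generalize T * M ^ 2 = B₁ at *
  generalize M ^ 2 = B₂ at *
  generalize (L - 1) * J * M = B₃ at *
  generalize (L - 1) * J = B₄ at *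
  generalize T * M = B₅ at *
  generalize L * T = B₆ at *
  omega

theorem RealRAM.State.atForward_outputFlow {L T : ℕ} (s : RealRAM.State) {l t : ℕ} (hl : l < L)
    (ht : t + 1 < T) : atForward (s.outputFlow L T) l t = s.real (l * T + t) := by
  rw [atForward, dif_pos ⟨hl, ht⟩]
  exact if_pos rfl

theorem RealRAM.State.atDownward_outputFlow {L T : ℕ} (s : RealRAM.State) {l t : ℕ}
    (hl : l + 1 < L) (ht : t < T) :
    atDownward (s.outputFlow L T) l t = s.real (L * T + l * T + t) := by
  rw [atDownward, dif_pos ⟨hl, ht⟩]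
  refine if_neg fun h => ?_
  have := congrArg Fin.val h
  simp [GridArc.downward] at this

-- Feasibility supplies one chain, so the search reaches the state `0` in the last layer. The chain
-- it finds is a feasible flow of the same cost, and every feasible flow costs at least as much as
-- some chain. The existence of an optimal flow is thus a result, obtained from the finiteness of
-- the set of states.
open RealRAM in
theorem UMFG.runs_optimalFlowProg {L T : ℕ} (hL : 1 ≤ L) (hT : 1 ≤ T) (I : UMFG L T)
    (hI : I.SourcesInOneRow) (hx : ∃ x, I.IsFeasibleFlow x) :
    Runs I.oracle optimalFlowProg (3000 * (L * (T * numStates L T ^ 2))) I.initState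
      fun s => I.IsOptimalFlow (s.outputFlow L T) := by
  have hM := numStates_pos (L := L) hT
  refine Runs.mono ?_ (total_steps_le hL hT hM (mul_numIntervals_le hT)) fun _ h => h
  refine Runs.seq ((runs_prefixProg (β := I.initState.real) (fun i hi => dif_neg (not_lt.2 hi)) rfl
    rfl (fun i hi => ?_) rfl).mono le_rfl fun s₁ h₁ => ?_)
  · change (if i = 0 then L else if i = 1 then T else 0) = 0
    rw [if_neg (by omega), if_neg (by omega)]
  refine Runs.seq ((runs_statesProg h₁.1 h₁.2).mono le_rfl fun s₂ h₂ => ?_)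
  refine Runs.seq ((runs_tableProg hL hT h₂.1 h₂.2.1 h₂.2.2).mono le_rfl fun s₃ h₃ => ?_)
  have tb : Tables L T (numStates L T) I.prefixSupply (entry L T I.prefixSupply) s₃ :=
    ⟨h₃.1.rows, h₃.1.cols, h₃.2.1, h₃.1.sums, h₃.2.2⟩
  refine Runs.seq ((runs_dynamicProg hL hM tb h₃.1.pred).mono le_rfl fun s₄ h₄ => ?_)
  obtain ⟨x, hx⟩ := hx
  obtain ⟨σ, hσ, -⟩ := hx.exists_stateChain hL hI hM
  obtain ⟨τ, τ0, τT, τM, τok, τp, τmin⟩ :=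
    h₄.relaxed.exists_optimal_chain hσ.zero hσ.last hσ.lt hσ.ok
  refine (runs_backtrackProg hL h₄.tables τT τM τp).mono le_rfl fun s₅ h₅ => ?_
  have hτ : IsStateChain L T I.prefixSupply (entry L T I.prefixSupply) (numStates L T) τ :=
    ⟨τ0, τT, τM, τok⟩
  obtain ⟨hfeas, hcost⟩ := hτ.isFeasibleFlow (x := s₅.outputFlow L T) hL
    (fun l => entry_zero L T _ l)
    (fun l t hl ht => (s₅.atForward_outputFlow hl ht).trans (h₅.1 t (by omega) l hl))
    (fun l t hl ht => (s₅.atDownward_outputFlow hl ht).trans (h₅.2 t ht l hl))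
  refine ⟨hfeas, fun y hy => ?_⟩
  obtain ⟨σ', hσ', hle⟩ := hy.exists_stateChain hL hI hM
  rw [hcost]
  exact (τmin σ' hσ'.zero hσ'.last hσ'.lt hσ'.ok).trans hle

/-- One program and one constant `C` serve all grids and all feasible instances with sources in one
row; the exponent is `8 L² - 12 L + 5`, which is at least `1` for `L ≥ 1`, written so that the
subtraction of natural numbers does not truncate. -/
theorem mainTheorem2 :
    ∃ (P : RealRAM.Prog) (C : ℕ), ∀ (L T : ℕ), 1 ≤ L → 1 ≤ T → ∀ I : UMFG L T,
      I.SourcesInOneRow → (∃ x, I.IsFeasibleFlow x) →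
      ∃ (s : RealRAM.State) (n : ℕ),
        RealRAM.Exec I.oracle P I.initState s n ∧
        n ≤ C * (L * T ^ (8 * L ^ 2 + 5 - 12 * L)) ∧
        I.IsOptimalFlow (s.outputFlow L T) := by
  refine ⟨RealRAM.optimalFlowProg, 3000, fun L T hL hT I hI hx => ?_⟩
  rw [← mul_numStates_sq hL hT]
  exact I.runs_optimalFlowProg hL hT hI hx
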